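/- Let $d\ge 1$, $\beta>2$, $L>0$, $\ell=\lfloor\beta\rfloor$, and $\varphi_t(x)=(2\pi t)^{-d/2}e^{-\|x\|^2/(2t)}$ on $\mathbb R^d$. Let $K:\mathbb R^d\to\mathbb R$ be a bounded kernel of order $\ell$: $K$ vanishes outside $[-1,1]^d$, $\int K=1$, $\int u^\alpha K(u)\,du=0$ for all multi-indices $\alpha$ with $1\le|\alpha|\le\ell$, and $K,\nabla K\in L^2(\mathbb R^d)$ ($\nabla K$ in the weak sense). For a probability density $p_0$ on $\mathbb R^d$ consider, with $\gamma,C_2>0$, $k\ge1$, $M\ge0$, the following conditions. (i) Polynomial tails: $p_0(x)\le C_2(1+\|x\|^2)^{-(1+\gamma+d)/2}$ for all $x$. (ii) Sobolev regularity: for all $\alpha\in[0,\infty)^d$ with $\sum_i\alpha_i=\beta$, $\int\prod_i|\omega_i|^{2\alpha_i}\,|\mathcal F[p_0](\omega)|^2\,d\omega\le(2\pi)^dL^2$, where $\mathcal F[p_0](\omega)=\int p_0(x)e^{-i\langle\omega,x\rangle}dx$. (For integer $\beta$ it is equivalent to require this for $\alpha\in\mathbb N_0^d$ only.) (iii) Hölder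 regularity: $p_0$ is bounded, $\ell$ times continuously differentiable, and $|D^\alpha p_0(x)-D^\alpha p_0(y)|\le L\|x-y\|^{\beta-\ell}$ for all $x,y$ and $|\alpha|=\ell$. (iv) Score moment: $\int\|\nabla\log p_0(x)\|^{2k}p_0(x)\,dx\le M$. For $t>0$ put $p_t=p_0*\varphi_t$ and $s_t=\nabla\log p_t$. Given $X_1,\dots,X_n$ i.i.d. from $p_0$ and a bandwidth $h>0$, put $$\hat f_h(y)=\frac1{nh^d}\sum_{i=1}^nK\Big(\frac{y-X_i}h\Big),\qquad \hat p_t=\hat f_h*\varphi_t,\qquad \hat s_t(x)=\frac{\nabla\hat p_t(x)}{\hat p_t(x)}\mathbf 1_{\{\hat p_t(x)\ge\rho_n\}},\qquad \rho_n=C_\rho h^\beta .$$ Then there is $C_0>0$, depending only on $d,\beta,L,K$, such that for every $C_\rho\ge C_0$ and all $\gamma,C_2>0$, $k\ge1$, $M\ge0$, $T>0$, $0<a\le b$ there is a constant $C>0$ such that for every density $p_0$ satisfying (i)–(iv), every $n\ge1$, every $h$ with $a\,n^{-1/(2\beta+d)}\le h\le b\,n^{-1/(2\beta+d)}$, and every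 $t\in(0,T]$, $$\mathbb E\left[\int_{\mathbb R^d}\|\hat s_t(x)-s_t(x)\|^2p_t(x)\,dx\right]\le C\left(n^{-\frac{\beta-2}{2\beta+d}}+n^{-\frac{\beta(\gamma+1)}{k'(2\beta+d)(d+\gamma+1)}}\right),$$ where $\frac1k+\frac1{k'}=1$ (so $\frac1{k'}=0$ if $k=1$). -/

import Mathlib

open MeasureTheory
open scoped ContDiff ENNReal

noncomputable section

namespace DecoupledScore

/-- The Euclidean space `ℝ^d`. -/
abbrev E (d : ℕ) : Type := EuclideanSpace ℝ (Fin d)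

/-- The monomial `u^α` for a multi-index `α ∈ ℕ^d`. -/
def monomial {d : ℕ} (α : Fin d → ℕ) (u : E d) : ℝ := ∏ i, u i ^ α i

/-- The Fourier transform `ξ ↦ ∫ g(x) exp(-i⟨ξ,x⟩) dx`. -/
def fourierTransform {d : ℕ} (g : E d → ℝ) (ξ : E d) : ℂ :=
  ∫ x : E d, (g x : ℂ) * Complex.exp (-(Complex.I * ((inner ℝ ξ x : ℝ) : ℂ)))

/-- The centred Gaussian density with covariance `t I_d`. -/
def gaussianDensity (d : ℕ) (t : ℝ) (x : E d) : ℝ :=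
  1 / (2 * Real.pi * t) ^ ((d : ℝ) / 2) * Real.exp (-(‖x‖ ^ 2) / (2 * t))

/-- The convolution `(f * φ_t)(x) = ∫ f(y) φ_t(x - y) dy` with the Gaussian density. -/
def gaussianSmooth {d : ℕ} (t : ℝ) (f : E d → ℝ) (x : E d) : ℝ :=
  ∫ y : E d, f y * gaussianDensity d t (x - y)

/-- The score `∇ log p` of a density `p`. -/
def score {d : ℕ} (p : E d → ℝ) (x : E d) : E d :=
  gradient (fun y => Real.log (p y)) x

/-- `p` is a probability density. -/
def IsDensity {d : ℕ} (p : E d → ℝ) : Prop :=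
  Integrable p ∧ (∀ x, 0 ≤ p x) ∧ ∫ x, p x = 1

/-- The polynomial tail bound `p(x) ≤ C₂ (1 + ‖x‖²)^{-(1+γ+d)/2}`. -/
def PolynomialTail {d : ℕ} (γ C₂ : ℝ) (p : E d → ℝ) : Prop :=
  ∀ x, p x ≤ C₂ / (1 + ‖x‖ ^ 2) ^ ((1 + γ + (d : ℝ)) / 2)

/-- The Sobolev class of densities of order `β` and radius `L`: for all exponents `α` of total
order `β`, `∫ |ξ^α|² |F[p](ξ)|² dξ ≤ (2π)^d L²`.  The exponents are nonnegative reals, so that the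
condition has a content also when `β` is not an integer.  For an integer `β` it is the same class
as with `α ∈ ℕ^d`: the left side is log-convex in `α`, and every real `α` is a convex combination
of the multi-indices `β e_i`. -/
def SobolevClass {d : ℕ} (β L : ℝ) (p : E d → ℝ) : Prop :=
  IsDensity p ∧
    ∀ α : Fin d → ℝ, (∀ i, 0 ≤ α i) → ∑ i, α i = β →
      ∫⁻ ξ : E d, ENNReal.ofReal ((∏ i, |ξ i| ^ α i) ^ 2 * ‖fourierTransform p ξ‖ ^ 2)
        ≤ ENNReal.ofReal ((2 * Real.pi) ^ d * L ^ 2)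

/-- The Hölder class `Σ(β, L)` of bounded functions, with `ℓ = ⌊β⌋`: `p` is of class `C^ℓ` and
all its partial derivatives of order `ℓ` are `(β - ℓ)`-Hölder with constant `L`.  The partial
derivatives of order `ℓ` are indexed by the sequences `(i_1, …, i_ℓ)` of coordinates. -/
def HolderClass {d : ℕ} (β L : ℝ) (p : E d → ℝ) : Prop :=
  (∃ B : ℝ, ∀ x, |p x| ≤ B) ∧
  ContDiff ℝ (⌊β⌋₊ : ℕ) p ∧
    ∀ (i : Fin ⌊β⌋₊ → Fin d) (x y : E d),
      |iteratedFDeriv ℝ ⌊β⌋₊ p x (fun j => EuclideanSpace.single (i j) 1)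
        - iteratedFDeriv ℝ ⌊β⌋₊ p y (fun j => EuclideanSpace.single (i j) 1)|
        ≤ L * ‖x - y‖ ^ (β - (⌊β⌋₊ : ℝ))

/-- The score moment bound `E_p ‖∇ log p‖^{2k} ≤ M`. -/
def ScoreMomentBound {d : ℕ} (k M : ℝ) (p : E d → ℝ) : Prop :=
  ∫⁻ x : E d, ENNReal.ofReal (‖score p x‖ ^ (2 * k) * p x) ≤ ENNReal.ofReal M

/-- `G` is the weak (distributional) gradient of `K`. -/
def HasWeakGradient {d : ℕ} (K : E d → ℝ) (G : E d → E d) : Prop :=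
  LocallyIntegrable K ∧ LocallyIntegrable G ∧
    ∀ ψ : E d → ℝ, ContDiff ℝ ∞ ψ → HasCompactSupport ψ → ∀ i : Fin d,
      ∫ x, K x * fderiv ℝ ψ x (EuclideanSpace.single i 1) = -∫ x, G x i * ψ x

/-- A bounded kernel of order `ℓ` supported on `[-1,1]^d` with `K, ∇K ∈ L²`. -/
structure IsKernel {d : ℕ} (ℓ : ℕ) (K : E d → ℝ) : Prop where
  support_subset : ∀ u : E d, K u ≠ 0 → ∀ i, u i ∈ Set.Icc (-1 : ℝ) 1
  bounded : MemLp K ∞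
  memLp_two : MemLp K 2
  gradient_memLp_two : ∃ G : E d → E d, HasWeakGradient K G ∧ MemLp G 2
  integral_eq_one : ∫ u, K u = 1
  moments : ∀ α : Fin d → ℕ, 1 ≤ ∑ i, α i → ∑ i, α i ≤ ℓ → ∫ u, monomial α u * K u = 0

/-- The kernel density estimator `(n h^d)⁻¹ ∑ᵢ K((y - Xᵢ)/h)`. -/
def kde {d n : ℕ} (K : E d → ℝ) (h : ℝ) (X : Fin n → E d) (y : E d) : ℝ :=
  1 / ((n : ℝ) * h ^ d) * ∑ i, K (h⁻¹ • (y - X i))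

/-- The decoupled density estimator: the kernel density estimator convolved with `φ_t`. -/
def densityEstimator {d n : ℕ} (K : E d → ℝ) (h t : ℝ) (X : Fin n → E d) : E d → ℝ :=
  gaussianSmooth t (kde K h X)

open Classical in
/-- The decoupled score estimator with threshold `ρ`. -/
def scoreEstimator {d n : ℕ} (K : E d → ℝ) (h ρ t : ℝ) (X : Fin n → E d) (x : E d) : E d :=
  if ρ ≤ densityEstimator K h t X x then
    (densityEstimator K h t X x)⁻¹ • gradient (densityEstimator K h t X) x
  else 0

/-- The law of an i.i.d. sample of size `n` from the density `p`. -/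
def sampleLaw {d : ℕ} (p : E d → ℝ) (n : ℕ) : Measure (Fin n → E d) :=
  Measure.pi fun _ => (volume : Measure (E d)).withDensity fun x => ENNReal.ofReal (p x)

/-- The risk `E ∫ ‖ŝ_t(x) - s_t(x)‖² p_t(x) dx`, where `p_t = p * φ_t`, `s_t = ∇ log p_t`. -/
def risk {d : ℕ} (K : E d → ℝ) (h ρ t : ℝ) (p : E d → ℝ) (n : ℕ) : ℝ≥0∞ :=
  ∫⁻ X : Fin n → E d,
    (∫⁻ x : E d, ENNReal.ofReal
      (‖scoreEstimator K h ρ t X x - score (gaussianSmooth t p) x‖ ^ 2 * gaussianSmooth t p x))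
    ∂(sampleLaw p n)

end DecoupledScore

end

noncomputable section

namespace DecoupledScore

section BoundedMeasurable

variable {Ω Ω' : Type*} [MeasurableSpace Ω] [MeasurableSpace Ω']

/-- A bounded measurable real function. -/
structure BddMeas (f : Ω → ℝ) : Prop where
  measurable : Measurable f
  bounded : ∃ C, ∀ x, |f x| ≤ C

namespace BddMeas

variable {f g : Ω → ℝ}

lemma const (c : ℝ) : BddMeas (fun _ : Ω => c) := ⟨measurable_const, |c|, fun _ => le_rfl⟩

lemma add (hf : BddMeas f) (hg : BddMeas g) : BddMeas (fun x => f x + g x) := by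
  obtain ⟨C, hC⟩ := hf.bounded
  obtain ⟨D, hD⟩ := hg.bounded
  exact ⟨hf.measurable.add hg.measurable, C + D, fun x =>
    (abs_add_le _ _).trans (add_le_add (hC x) (hD x))⟩

lemma mul (hf : BddMeas f) (hg : BddMeas g) : BddMeas (fun x => f x * g x) := by
  obtain ⟨C, hC⟩ := hf.bounded
  obtain ⟨D, hD⟩ := hg.bounded
  refine ⟨hf.measurable.mul hg.measurable, C * D, fun x => ?_⟩
  rw [abs_mul]
  exact mul_le_mul (hC x) (hD x) (abs_nonneg _) ((abs_nonneg _).trans (hC x))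

lemma pow (hf : BddMeas f) (n : ℕ) : BddMeas (fun x => f x ^ n) := by
  induction n with
  | zero => simpa using const 1
  | succ n ih => simpa only [pow_succ] using ih.mul hf

lemma const_mul (hf : BddMeas f) (c : ℝ) : BddMeas (fun x => c * f x) := (const c).mul hf

lemma sub (hf : BddMeas f) (hg : BddMeas g) : BddMeas (fun x => f x - g x) := by
  simpa [sub_eq_add_neg] using hf.add (hg.const_mul (-1))

lemma comp (hf : BddMeas f) {u : Ω' → Ω} (hu : Measurable u) : BddMeas (fun x => f (u x)) := by
  obtain ⟨C, hC⟩ := hf.bounded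
  exact ⟨hf.measurable.comp hu, C, fun x => hC _⟩

lemma sum {ι : Type*} {f : ι → Ω → ℝ} (s : Finset ι) (hf : ∀ i, BddMeas (f i)) :
    BddMeas (fun x => ∑ i ∈ s, f i x) := by
  classical
  induction s using Finset.induction_on with
  | empty => simpa using const 0
  | insert a s ha ih => simpa [Finset.sum_insert ha] using (hf a).add ih

lemma integrable (hf : BddMeas f) (μ : Measure Ω) [IsFiniteMeasure μ] : Integrable f μ := by
  obtain ⟨C, hC⟩ := hf.bounded
  exact Integrable.of_bound hf.measurable.aestronglyMeasurable C (ae_of_all _ hC)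

lemma sum_comp_eval {n : ℕ} (hf : BddMeas f) :
    BddMeas (fun X : Fin n → Ω => ∑ i, f (X i)) :=
  sum _ fun i => hf.comp (measurable_pi_apply i)

end BddMeas

variable (μ : Measure Ω) [IsProbabilityMeasure μ]

lemma integral_pi_succ {n : ℕ} {F : (Fin (n + 1) → Ω) → ℝ} (hF : BddMeas F) :
    ∫ X, F X ∂(Measure.pi fun _ : Fin (n + 1) => μ) =
      ∫ X, ∫ y, F (Fin.cons y X) ∂μ ∂(Measure.pi fun _ : Fin n => μ) := by
  have h := (measurePreserving_piFinSuccAbove (fun _ : Fin (n + 1) => μ) 0).symm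
  rw [← h.integral_comp (MeasurableEquiv.measurableEmbedding _)]
  rw [integral_prod_symm]
  · simp [MeasurableEquiv.piFinSuccAbove_symm_apply, Fin.insertNthEquiv]
  · exact (hF.comp (MeasurableEquiv.measurable _)).integrable _

lemma integral_sum_eval_eq_zero {Z : Ω → ℝ} (hZ : BddMeas Z) (hZ0 : ∫ y, Z y ∂μ = 0) (n : ℕ) :
    ∫ X, ∑ i, Z (X i) ∂(Measure.pi fun _ : Fin n => μ) = 0 := by
  rw [integral_finsetSum _ fun i _ =>
    (hZ.comp (measurable_pi_apply i)).integrable (Measure.pi fun _ : Fin n => μ)]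
  refine Finset.sum_eq_zero fun i _ => ?_
  have h := measurePreserving_eval (fun _ : Fin n => μ) i
  have e := integral_map (μ := Measure.pi fun _ : Fin n => μ) h.measurable.aemeasurable
    hZ.measurable.aestronglyMeasurable
  rw [h.map_eq, hZ0] at e
  exact e.symm

lemma integral_add_mul_add {Z W : Ω → ℝ} (hZ : BddMeas Z) (hW : BddMeas W)
    (hZ0 : ∫ y, Z y ∂μ = 0) (hW0 : ∫ y, W y ∂μ = 0) (s t : ℝ) :
    ∫ y, (Z y + s) * (W y + t) ∂μ = ∫ y, Z y * W y ∂μ + s * t := by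
  have e : ∀ y, (Z y + s) * (W y + t) = Z y * W y + t * Z y + s * W y + s * t := fun y => by ring
  simp_rw [e]
  rw [integral_add (((((hZ.mul hW).add (hZ.const_mul t)).add (hW.const_mul s))).integrable μ)
      ((BddMeas.const _).integrable μ),
    integral_add ((((hZ.mul hW).add (hZ.const_mul t))).integrable μ) ((hW.const_mul s).integrable μ),
    integral_add ((hZ.mul hW).integrable μ) ((hZ.const_mul t).integrable μ),
    integral_const_mul, integral_const_mul, hZ0, hW0]
  simp

lemma integral_sum_mul_sum {Z W : Ω → ℝ} (hZ : BddMeas Z) (hW : BddMeas W)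
    (hZ0 : ∫ y, Z y ∂μ = 0) (hW0 : ∫ y, W y ∂μ = 0) (n : ℕ) :
    ∫ X, (∑ i, Z (X i)) * (∑ i, W (X i)) ∂(Measure.pi fun _ : Fin n => μ) =
      n * ∫ y, Z y * W y ∂μ := by
  induction n with
  | zero => simp
  | succ n ih =>
    rw [integral_pi_succ μ (hZ.sum_comp_eval.mul hW.sum_comp_eval)]
    simp only [Fin.sum_univ_succ, Fin.cons_zero, Fin.cons_succ]
    simp_rw [integral_add_mul_add μ hZ hW hZ0 hW0]
    rw [integral_add ((BddMeas.const _).integrable _)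
      ((hZ.sum_comp_eval.mul hW.sum_comp_eval).integrable _), ih]
    simp
    ring

lemma integral_add_sq_mul_add_sq {Z W : Ω → ℝ} (hZ : BddMeas Z) (hW : BddMeas W)
    (hZ0 : ∫ y, Z y ∂μ = 0) (hW0 : ∫ y, W y ∂μ = 0) (s t : ℝ) :
    ∫ y, (Z y + s) ^ 2 * (W y + t) ^ 2 ∂μ =
      ∫ y, Z y ^ 2 * W y ^ 2 ∂μ + (2 * ∫ y, Z y ^ 2 * W y ∂μ) * t
        + (2 * ∫ y, Z y * W y ^ 2 ∂μ) * s + (∫ y, Z y ^ 2 ∂μ) * t ^ 2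
        + (4 * ∫ y, Z y * W y ∂μ) * (s * t) + (∫ y, W y ^ 2 ∂μ) * s ^ 2 + s ^ 2 * t ^ 2 := by
  have e : ∀ y, (Z y + s) ^ 2 * (W y + t) ^ 2 = Z y ^ 2 * W y ^ 2 + (2 * t) * (Z y ^ 2 * W y)
      + (2 * s) * (Z y * W y ^ 2) + t ^ 2 * Z y ^ 2 + (4 * (s * t)) * (Z y * W y)
      + s ^ 2 * W y ^ 2 + (2 * s * t ^ 2) * Z y + (2 * s ^ 2 * t) * W y + s ^ 2 * t ^ 2 :=
    fun y => by ring
  have h1 := (hZ.pow 2).mul (hW.pow 2)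
  have h2 := h1.add (((hZ.pow 2).mul hW).const_mul (2 * t))
  have h3 := h2.add ((hZ.mul (hW.pow 2)).const_mul (2 * s))
  have h4 := h3.add ((hZ.pow 2).const_mul (t ^ 2))
  have h5 := h4.add ((hZ.mul hW).const_mul (4 * (s * t)))
  have h6 := h5.add ((hW.pow 2).const_mul (s ^ 2))
  have h7 := h6.add (hZ.const_mul (2 * s * t ^ 2))
  have h8 := h7.add (hW.const_mul (2 * s ^ 2 * t))
  simp_rw [e]
  rw [integral_add (h8.integrable μ) ((BddMeas.const _).integrable μ),
    integral_add (h7.integrable μ) ((hW.const_mul _).integrable μ),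
    integral_add (h6.integrable μ) ((hZ.const_mul _).integrable μ),
    integral_add (h5.integrable μ) (((hW.pow 2).const_mul _).integrable μ),
    integral_add (h4.integrable μ) (((hZ.mul hW).const_mul _).integrable μ),
    integral_add (h3.integrable μ) (((hZ.pow 2).const_mul _).integrable μ),
    integral_add (h2.integrable μ) (((hZ.mul (hW.pow 2)).const_mul _).integrable μ),
    integral_add (h1.integrable μ) ((((hZ.pow 2).mul hW).const_mul _).integrable μ)]
  simp only [integral_const_mul, hZ0, hW0, integral_const, probReal_univ, smul_eq_mul]
  ring

lemma sq_integral_mul_le {Z W : Ω → ℝ} (hZ : BddMeas Z) (hW : BddMeas W) :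
    (∫ y, Z y * W y ∂μ) ^ 2 ≤ (∫ y, Z y ^ 2 ∂μ) * ∫ y, W y ^ 2 ∂μ := by
  have key : ∀ r : ℝ, 0 ≤ (∫ y, W y ^ 2 ∂μ) * (r * r) + (2 * ∫ y, Z y * W y ∂μ) * r
      + ∫ y, Z y ^ 2 ∂μ := by
    intro r
    have h : 0 ≤ ∫ y, (Z y + r * W y) ^ 2 ∂μ := integral_nonneg fun y => sq_nonneg _
    have e : ∀ y, (Z y + r * W y) ^ 2 = Z y ^ 2 + (2 * r) * (Z y * W y) + r ^ 2 * W y ^ 2 :=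
      fun y => by ring
    simp_rw [e] at h
    rw [integral_add (((hZ.pow 2).add ((hZ.mul hW).const_mul _)).integrable μ)
        (((hW.pow 2).const_mul _).integrable μ),
      integral_add ((hZ.pow 2).integrable μ) (((hZ.mul hW).const_mul _).integrable μ),
      integral_const_mul, integral_const_mul] at h
    linarith
  have := discrim_le_zero key
  unfold discrim at this
  nlinarith

lemma integral_sum_sq_mul_sum_sq_le {Z W : Ω → ℝ} (hZ : BddMeas Z) (hW : BddMeas W)
    (hZ0 : ∫ y, Z y ∂μ = 0) (hW0 : ∫ y, W y ∂μ = 0) (n : ℕ) :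
    ∫ X, (∑ i, Z (X i)) ^ 2 * (∑ i, W (X i)) ^ 2 ∂(Measure.pi fun _ : Fin n => μ) ≤
      3 * (n * ∫ y, Z y ^ 2 ∂μ) * (n * ∫ y, W y ^ 2 ∂μ) + n * ∫ y, Z y ^ 2 * W y ^ 2 ∂μ := by
  induction n with
  | zero => simp
  | succ n ih =>
    have hS : BddMeas (fun X : Fin n → Ω => ∑ i, Z (X i)) := hZ.sum_comp_eval
    have hT : BddMeas (fun X : Fin n → Ω => ∑ i, W (X i)) := hW.sum_comp_eval
    rw [integral_pi_succ μ ((hZ.sum_comp_eval.pow 2).mul (hW.sum_comp_eval.pow 2))]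
    simp only [Fin.sum_univ_succ, Fin.cons_zero, Fin.cons_succ]
    simp_rw [integral_add_sq_mul_add_sq μ hZ hW hZ0 hW0]
    set a := ∫ y, Z y ^ 2 ∂μ
    set b := ∫ y, W y ^ 2 ∂μ
    set c := ∫ y, Z y * W y ∂μ with hc
    set e := ∫ y, Z y ^ 2 * W y ^ 2 ∂μ
    set u := ∫ y, Z y ^ 2 * W y ∂μ
    set v := ∫ y, Z y * W y ^ 2 ∂μ
    have h1 := (BddMeas.const (Ω := Fin n → Ω) e).add (hT.const_mul (2 * u))
    have h2 := h1.add (hS.const_mul (2 * v))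
    have h3 := h2.add ((hT.pow 2).const_mul a)
    have h4 := h3.add ((hS.mul hT).const_mul (4 * c))
    have h5 := h4.add ((hS.pow 2).const_mul b)
    rw [integral_add (h5.integrable _) (((hS.pow 2).mul (hT.pow 2)).integrable _),
      integral_add (h4.integrable _) (((hS.pow 2).const_mul _).integrable _),
      integral_add (h3.integrable _) (((hS.mul hT).const_mul _).integrable _),
      integral_add (h2.integrable _) (((hT.pow 2).const_mul _).integrable _),
      integral_add (h1.integrable _) ((hS.const_mul _).integrable _),
      integral_add ((BddMeas.const e).integrable _) ((hT.const_mul _).integrable _)]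
    simp only [integral_const_mul, integral_const, probReal_univ, smul_eq_mul,
      integral_sum_eval_eq_zero μ hZ hZ0, integral_sum_eval_eq_zero μ hW hW0,
      integral_sum_mul_sum μ hZ hW hZ0 hW0]
    have hSS := integral_sum_mul_sum μ hZ hZ hZ0 hZ0 n
    have hTT := integral_sum_mul_sum μ hW hW hW0 hW0 n
    simp only [← sq] at hSS hTT
    rw [hSS, hTT]
    have hcs : c ^ 2 ≤ a * b := sq_integral_mul_le μ hZ hW
    push_cast
    have hn : (0 : ℝ) ≤ n := n.cast_nonneg
    have ha : 0 ≤ a := integral_nonneg fun y => sq_nonneg _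
    have hb : 0 ≤ b := integral_nonneg fun y => sq_nonneg _
    nlinarith [mul_le_mul_of_nonneg_left hcs hn, mul_nonneg ha hb]

end BoundedMeasurable

section EmpiricalMeans

variable {Ω : Type*} [MeasurableSpace Ω]

/-- The empirical mean of `g` over the sample `X`. -/
def empMean {n : ℕ} (g : Ω → ℝ) (X : Fin n → Ω) : ℝ := (n : ℝ)⁻¹ * ∑ i, g (X i)

lemma BddMeas.empMean {n : ℕ} {g : Ω → ℝ} (hg : BddMeas g) :
    BddMeas (fun X : Fin n → Ω => empMean g X) := hg.sum_comp_eval.const_mul _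

lemma empMean_sub_integral (μ : Measure Ω) {n : ℕ} (hn : 1 ≤ n) (g : Ω → ℝ) (X : Fin n → Ω) :
    empMean g X - ∫ y, g y ∂μ = ∑ i, (n : ℝ)⁻¹ * (g (X i) - ∫ y, g y ∂μ) := by
  have : (n : ℝ) ≠ 0 := by positivity
  rw [← Finset.mul_sum, Finset.sum_sub_distrib, empMean]
  simp
  field_simp

variable (μ : Measure Ω) [IsProbabilityMeasure μ]

lemma integral_centered {g : Ω → ℝ} (hg : BddMeas g) (r : ℝ) :
    ∫ y, r * (g y - ∫ y, g y ∂μ) ∂μ = 0 := by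
  rw [integral_const_mul, integral_sub (hg.integrable μ) ((BddMeas.const _).integrable μ)]
  simp

lemma integral_centered_sq_le {g : Ω → ℝ} (hg : BddMeas g) :
    ∫ y, (g y - ∫ y, g y ∂μ) ^ 2 ∂μ ≤ ∫ y, g y ^ 2 ∂μ := by
  set q := ∫ y, g y ∂μ with hq
  have e : ∀ y, (g y - q) ^ 2 = g y ^ 2 - (2 * q) * g y + q ^ 2 := fun y => by ring
  simp_rw [e]
  rw [integral_add (((hg.pow 2).sub (hg.const_mul _)).integrable μ)
      ((BddMeas.const _).integrable μ),
    integral_sub ((hg.pow 2).integrable μ) ((hg.const_mul _).integrable μ), integral_const_mul, ← hq]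
  simp
  nlinarith [sq_nonneg q]

lemma natCast_mul_integral_centered_sq_le {n : ℕ} (hn : 1 ≤ n) {g : Ω → ℝ} (hg : BddMeas g) :
    n * ∫ y, ((n : ℝ)⁻¹ * (g y - ∫ y, g y ∂μ)) ^ 2 ∂μ ≤ (n : ℝ)⁻¹ * ∫ y, g y ^ 2 ∂μ := by
  have hn' : (0 : ℝ) < n := by positivity
  simp_rw [mul_pow]
  rw [integral_const_mul, ← mul_assoc]
  have : (n : ℝ) * (n : ℝ)⁻¹ ^ 2 = (n : ℝ)⁻¹ := by field_simp
  rw [this]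
  exact mul_le_mul_of_nonneg_left (integral_centered_sq_le μ hg) (by positivity)

lemma integral_empMean_sub_sq_le {n : ℕ} (hn : 1 ≤ n) {v : Ω → ℝ} (hv : BddMeas v) (P : ℝ) :
    ∫ X, (empMean v X - P) ^ 2 ∂(Measure.pi fun _ : Fin n => μ) ≤
      (n : ℝ)⁻¹ * ∫ y, v y ^ 2 ∂μ + (∫ y, v y ∂μ - P) ^ 2 := by
  set Q := ∫ y, v y ∂μ with hQ
  set Z : Ω → ℝ := fun y => (n : ℝ)⁻¹ * (v y - Q) with hZdef
  have hZ : BddMeas Z := (hv.sub (BddMeas.const Q)).const_mul _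
  have hZ0 : ∫ y, Z y ∂μ = 0 := integral_centered μ hv _
  have e : ∀ X : Fin n → Ω, (empMean v X - P) ^ 2 =
      (∑ i, Z (X i)) * (∑ i, Z (X i)) + (2 * (Q - P)) * (∑ i, Z (X i)) + (Q - P) ^ 2 := by
    intro X
    rw [← empMean_sub_integral μ hn, ← hQ]
    ring
  simp_rw [e]
  rw [integral_add (((hZ.sum_comp_eval.mul hZ.sum_comp_eval).add
      (hZ.sum_comp_eval.const_mul _)).integrable _) ((BddMeas.const _).integrable _),
    integral_add ((hZ.sum_comp_eval.mul hZ.sum_comp_eval).integrable _)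
      ((hZ.sum_comp_eval.const_mul _).integrable _), integral_sum_mul_sum μ hZ hZ hZ0 hZ0,
    integral_const_mul, integral_sum_eval_eq_zero μ hZ hZ0]
  have := natCast_mul_integral_centered_sq_le μ hn hv
  simp only [← sq]
  simp only [hZdef]
  simp
  linarith

lemma integral_empMean_sub_sq_mul_le {n : ℕ} (hn : 1 ≤ n) {g v : Ω → ℝ} (hg : BddMeas g)
    (hv : BddMeas v) {c τ p : ℝ} (hc : 1 ≤ c) (hτ : 0 < τ) (hgb : ∀ y, |g y| ≤ n * (c * τ))
    (hg2 : (n : ℝ)⁻¹ * ∫ y, g y ^ 2 ∂μ ≤ c * τ ^ 2) (hp : |∫ y, g y ∂μ - p| ≤ c * τ) (P : ℝ) :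
    ∫ X, (empMean v X - P) ^ 2 * (empMean g X - p) ^ 2 ∂(Measure.pi fun _ : Fin n => μ) ≤
      36 * c ^ 2 * τ ^ 2 * ((n : ℝ)⁻¹ * ∫ y, v y ^ 2 ∂μ + (∫ y, v y ∂μ - P) ^ 2) := by
  have hn' : (0 : ℝ) < n := by positivity
  set Q := ∫ y, v y ∂μ with hQ
  set q := ∫ y, g y ∂μ with hq
  set Z : Ω → ℝ := fun y => (n : ℝ)⁻¹ * (v y - Q) with hZdef
  set W : Ω → ℝ := fun y => (n : ℝ)⁻¹ * (g y - q) with hWdef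
  have hZ : BddMeas Z := (hv.sub (BddMeas.const Q)).const_mul _
  have hW : BddMeas W := (hg.sub (BddMeas.const q)).const_mul _
  have hZ0 : ∫ y, Z y ∂μ = 0 := integral_centered μ hv _
  have hW0 : ∫ y, W y ∂μ = 0 := integral_centered μ hg _
  have hqb : |q| ≤ n * (c * τ) := by
    have h := norm_integral_le_of_norm_le_const (μ := μ) (f := g) (ae_of_all _ hgb)
    simpa using h
  have hWb : ∀ y, W y ^ 2 ≤ 4 * c ^ 2 * τ ^ 2 := by
    intro y
    have h1 : |W y| ≤ 2 * (c * τ) := by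
      rw [hWdef, abs_mul, abs_of_pos (inv_pos.2 hn'), inv_mul_le_iff₀ hn']
      have := abs_sub (g y) q
      linarith [hgb y]
    calc W y ^ 2 = |W y| ^ 2 := (sq_abs _).symm
      _ ≤ (2 * (c * τ)) ^ 2 := pow_le_pow_left₀ (abs_nonneg _) h1 2
      _ = _ := by ring
  have hcc : c ≤ c ^ 2 := by nlinarith only [hc]
  have hA := natCast_mul_integral_centered_sq_le μ hn hv
  have hB := (natCast_mul_integral_centered_sq_le μ hn hg).trans hg2
  rw [← hQ] at hA
  rw [← hq] at hB
  set A := (n : ℝ)⁻¹ * ∫ y, v y ^ 2 ∂μ with hAdef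
  set z := n * ∫ y, Z y ^ 2 ∂μ with hz
  set w := n * ∫ y, W y ^ 2 ∂μ with hw
  have hz0 : 0 ≤ z := mul_nonneg hn'.le (integral_nonneg fun _ => sq_nonneg _)
  have hw0 : 0 ≤ w := mul_nonneg hn'.le (integral_nonneg fun _ => sq_nonneg _)
  have hzA : z ≤ A := hA
  have hwB : w ≤ c * τ ^ 2 := hB
  have hZW : n * ∫ y, Z y ^ 2 * W y ^ 2 ∂μ ≤ 4 * c ^ 2 * τ ^ 2 * z := by
    have : ∫ y, Z y ^ 2 * W y ^ 2 ∂μ ≤ ∫ y, (4 * c ^ 2 * τ ^ 2) * Z y ^ 2 ∂μ :=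
      integral_mono (((hZ.pow 2).mul (hW.pow 2)).integrable μ)
        (((hZ.pow 2).const_mul _).integrable μ) fun y => by
          have := mul_le_mul_of_nonneg_left (hWb y) (sq_nonneg (Z y))
          simp only
          linarith
    rw [integral_const_mul] at this
    have h2 := mul_le_mul_of_nonneg_left this hn'.le
    rw [hz]
    linarith
  have h4 := integral_sum_sq_mul_sum_sq_le μ hZ hW hZ0 hW0 n
  rw [← hz, ← hw] at h4
  set S : (Fin n → Ω) → ℝ := fun X => ∑ i, Z (X i) with hSdef
  set T : (Fin n → Ω) → ℝ := fun X => ∑ i, W (X i) with hTdef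
  have hS : BddMeas S := hZ.sum_comp_eval
  have hT : BddMeas T := hW.sum_comp_eval
  have eS : ∫ X, S X ^ 2 ∂(Measure.pi fun _ : Fin n => μ) = z := by
    have := integral_sum_mul_sum μ hZ hZ hZ0 hZ0 n
    simp only [← sq] at this
    exact this
  have eT : ∫ X, T X ^ 2 ∂(Measure.pi fun _ : Fin n => μ) = w := by
    have := integral_sum_mul_sum μ hW hW hW0 hW0 n
    simp only [← sq] at this
    exact this
  set B := Q - P with hBdef
  set b := q - p with hbdef
  have hb2 : b ^ 2 ≤ c ^ 2 * τ ^ 2 := by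
    calc b ^ 2 = |b| ^ 2 := (sq_abs _).symm
      _ ≤ (c * τ) ^ 2 := pow_le_pow_left₀ (abs_nonneg _) hp 2
      _ = _ := by ring
  have step : ∫ X, (empMean v X - P) ^ 2 * (empMean g X - p) ^ 2 ∂(Measure.pi fun _ : Fin n => μ)
      ≤ ∫ X, (4 * (S X ^ 2 * T X ^ 2) + (4 * b ^ 2) * S X ^ 2 + (4 * B ^ 2) * T X ^ 2
        + 4 * B ^ 2 * b ^ 2) ∂(Measure.pi fun _ : Fin n => μ) := by
    refine integral_mono ((((hv.empMean.sub (BddMeas.const P)).pow 2).mul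
      ((hg.empMean.sub (BddMeas.const p)).pow 2)).integrable _)
      (((((((hS.pow 2).mul (hT.pow 2)).const_mul 4).add ((hS.pow 2).const_mul _)).add
        ((hT.pow 2).const_mul _)).add (BddMeas.const _)).integrable _) fun X => ?_
    have e1 : empMean v X - P = S X + B := by
      simp only [hSdef, hZdef, hBdef, hQ, ← empMean_sub_integral μ hn]
      ring
    have e2 : empMean g X - p = T X + b := by
      simp only [hTdef, hWdef, hbdef, hq, ← empMean_sub_integral μ hn]
      ring
    simp only [e1, e2]
    have h1 : (S X + B) ^ 2 ≤ 2 * (S X ^ 2 + B ^ 2) := by nlinarith [sq_nonneg (S X - B)]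
    have h2 : (T X + b) ^ 2 ≤ 2 * (T X ^ 2 + b ^ 2) := by nlinarith [sq_nonneg (T X - b)]
    calc (S X + B) ^ 2 * (T X + b) ^ 2 ≤ (2 * (S X ^ 2 + B ^ 2)) * (2 * (T X ^ 2 + b ^ 2)) :=
          mul_le_mul h1 h2 (sq_nonneg _) (by positivity)
      _ = _ := by ring
  refine step.trans ?_
  rw [integral_add (((((((hS.pow 2).mul (hT.pow 2)).const_mul 4).add
      ((hS.pow 2).const_mul _)).add ((hT.pow 2).const_mul _))).integrable _)
      ((BddMeas.const _).integrable _),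
    integral_add ((((((hS.pow 2).mul (hT.pow 2)).const_mul 4).add
      ((hS.pow 2).const_mul _))).integrable _) (((hT.pow 2).const_mul _).integrable _),
    integral_add (((((hS.pow 2).mul (hT.pow 2)).const_mul 4)).integrable _)
      (((hS.pow 2).const_mul _).integrable _)]
  simp only [integral_const_mul, integral_const, probReal_univ, smul_eq_mul, one_mul, eS, eT]
  have hST : ∫ X, S X ^ 2 * T X ^ 2 ∂(Measure.pi fun _ : Fin n => μ) ≤ 7 * c ^ 2 * τ ^ 2 * A := by
    have i1 : z * w ≤ A * (c * τ ^ 2) := mul_le_mul hzA hwB hw0 (hz0.trans hzA)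
    have i2 : A * (c * τ ^ 2) ≤ A * (c ^ 2 * τ ^ 2) := by
      refine mul_le_mul_of_nonneg_left ?_ (hz0.trans hzA)
      exact mul_le_mul_of_nonneg_right hcc (sq_nonneg _)
    have i3 : 4 * c ^ 2 * τ ^ 2 * z ≤ 4 * c ^ 2 * τ ^ 2 * A :=
      mul_le_mul_of_nonneg_left hzA (by positivity)
    linarith
  have j1 : b ^ 2 * z ≤ c ^ 2 * τ ^ 2 * A := mul_le_mul hb2 hzA hz0 (by positivity)
  have j2 : B ^ 2 * w ≤ B ^ 2 * (c ^ 2 * τ ^ 2) := by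
    refine mul_le_mul_of_nonneg_left (hwB.trans ?_) (sq_nonneg _)
    exact mul_le_mul_of_nonneg_right hcc (sq_nonneg _)
  have j3 : B ^ 2 * b ^ 2 ≤ B ^ 2 * (c ^ 2 * τ ^ 2) := mul_le_mul_of_nonneg_left hb2 (sq_nonneg _)
  have j4 : 0 ≤ B ^ 2 * (c ^ 2 * τ ^ 2) := by positivity
  have j5 : 0 ≤ c ^ 2 * τ ^ 2 * A := mul_nonneg (by positivity) (hz0.trans hzA)
  linarith

end EmpiricalMeans

section ScoreError

open Classical in
lemma norm_truncated_score_sub_sq_mul_le {d : ℕ} {p ρ : ℝ} (hp : 0 < p) (hρ : 0 < ρ) (f : ℝ)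
    (u P : E d) :
    ‖(if ρ ≤ f then f⁻¹ • u else 0) - p⁻¹ • P‖ ^ 2 * p ≤
      ‖u - P‖ ^ 2 * (4 / ρ + 2 / ρ ^ 3 * (f - p) ^ 2)
        + ‖p⁻¹ • P‖ ^ 2 * p * (if ρ ≤ f then 2 * (f - p) ^ 2 / f ^ 2 else 1) := by
  split_ifs with h
  · have hf : 0 < f := hρ.trans_le h
    have e : f⁻¹ • u - p⁻¹ • P = f⁻¹ • (u - P) + ((p - f) / f) • (p⁻¹ • P) := by
      rw [smul_sub, sub_div, sub_smul, smul_smul, smul_smul, div_self hf.ne', one_mul]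
      have : p / f * p⁻¹ = f⁻¹ := by field_simp
      rw [this]
      abel
    have h1 : ‖f⁻¹ • u - p⁻¹ • P‖ ^ 2 ≤
        2 * (‖u - P‖ ^ 2 / f ^ 2 + (f - p) ^ 2 / f ^ 2 * ‖p⁻¹ • P‖ ^ 2) := by
      rw [e]
      have n1 : ‖f⁻¹ • (u - P)‖ ^ 2 = ‖u - P‖ ^ 2 / f ^ 2 := by
        rw [norm_smul, mul_pow, Real.norm_eq_abs, sq_abs]
        field_simp
      have n2 : ‖((p - f) / f) • (p⁻¹ • P)‖ ^ 2 = (f - p) ^ 2 / f ^ 2 * ‖p⁻¹ • P‖ ^ 2 := by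
        rw [norm_smul, mul_pow, Real.norm_eq_abs, sq_abs, div_pow]
        ring
      rw [← n1, ← n2]
      have := pow_le_pow_left₀ (norm_nonneg _)
        (norm_add_le (f⁻¹ • (u - P)) (((p - f) / f) • (p⁻¹ • P))) 2
      nlinarith [sq_nonneg (‖f⁻¹ • (u - P)‖ - ‖((p - f) / f) • (p⁻¹ • P)‖)]
    have h2 : p / f ^ 2 ≤ 2 / ρ + 1 / ρ ^ 3 * (f - p) ^ 2 := by
      have a1 : p ≤ f + ρ + (f - p) ^ 2 / ρ := by
        have : 0 ≤ (ρ + (f - p) + (f - p) ^ 2 / ρ) := by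
          have : ρ + (f - p) + (f - p) ^ 2 / ρ = (ρ ^ 2 + ρ * (f - p) + (f - p) ^ 2) / ρ := by
            field_simp
          rw [this]
          refine div_nonneg ?_ hρ.le
          nlinarith [sq_nonneg (ρ + (f - p)), sq_nonneg ρ, sq_nonneg (f - p)]
        have h0 : 0 ≤ (f - p) ^ 2 / ρ := by positivity
        rcases le_total p f with h3 | h3
        · linarith
        · have : p - f ≤ ρ + (f - p) ^ 2 / ρ := by linarith
          linarith
      have a2 : (f + ρ + (f - p) ^ 2 / ρ) / f ^ 2 = 1 / f + ρ / f ^ 2 + (f - p) ^ 2 / ρ / f ^ 2 := by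
        field_simp
      have a3 : 1 / f ≤ 1 / ρ := one_div_le_one_div_of_le hρ h
      have hsq : ρ ^ 2 ≤ f ^ 2 := pow_le_pow_left₀ hρ.le h 2
      have a4 : ρ / f ^ 2 ≤ 1 / ρ := by
        rw [div_le_div_iff₀ (by positivity) hρ]
        linarith
      have a5 : (f - p) ^ 2 / ρ / f ^ 2 ≤ (f - p) ^ 2 / ρ / ρ ^ 2 :=
        div_le_div_of_nonneg_left (by positivity) (by positivity) hsq
      have a6 : (f - p) ^ 2 / ρ / ρ ^ 2 = 1 / ρ ^ 3 * (f - p) ^ 2 := by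
        field_simp
      have a7 : 2 / ρ = 1 / ρ + 1 / ρ := by ring
      calc p / f ^ 2 ≤ (f + ρ + (f - p) ^ 2 / ρ) / f ^ 2 := by gcongr
        _ ≤ _ := by rw [a2, a7, ← a6]; linarith
    have h3 : ‖u - P‖ ^ 2 * (p / f ^ 2) ≤ ‖u - P‖ ^ 2 * (2 / ρ + 1 / ρ ^ 3 * (f - p) ^ 2) :=
      mul_le_mul_of_nonneg_left h2 (sq_nonneg _)
    calc ‖f⁻¹ • u - p⁻¹ • P‖ ^ 2 * p ≤
        2 * (‖u - P‖ ^ 2 / f ^ 2 + (f - p) ^ 2 / f ^ 2 * ‖p⁻¹ • P‖ ^ 2) * p := by gcongr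
      _ = 2 * (‖u - P‖ ^ 2 * (p / f ^ 2))
          + ‖p⁻¹ • P‖ ^ 2 * p * (2 * (f - p) ^ 2 / f ^ 2) := by ring
      _ ≤ 2 * (‖u - P‖ ^ 2 * (2 / ρ + 1 / ρ ^ 3 * (f - p) ^ 2))
          + ‖p⁻¹ • P‖ ^ 2 * p * (2 * (f - p) ^ 2 / f ^ 2) := by linarith
      _ = _ := by ring
  · rw [zero_sub, norm_neg]
    have : 0 ≤ ‖u - P‖ ^ 2 * (4 / ρ + 2 / ρ ^ 3 * (f - p) ^ 2) := by positivity
    linarith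

open Classical in
lemma truncation_weight_le {ρ : ℝ} (hρ : 0 < ρ) (f p : ℝ) :
    (if ρ ≤ f then 2 * (f - p) ^ 2 / f ^ 2 else 1) ≤ 1 + 2 / ρ ^ 2 * (f - p) ^ 2 := by
  split_ifs with h
  · have hsq : ρ ^ 2 ≤ f ^ 2 := pow_le_pow_left₀ hρ.le h 2
    have : 2 * (f - p) ^ 2 / f ^ 2 ≤ 2 * (f - p) ^ 2 / ρ ^ 2 :=
      div_le_div_of_nonneg_left (by positivity) (by positivity) hsq
    have e : 2 / ρ ^ 2 * (f - p) ^ 2 = 2 * (f - p) ^ 2 / ρ ^ 2 := by ring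
    linarith
  · have : 0 ≤ 2 / ρ ^ 2 * (f - p) ^ 2 := by positivity
    linarith

open Classical in
lemma truncation_weight_le' {ρ p : ℝ} (hρ : 0 < ρ) (hp : 0 < p) (f : ℝ) :
    (if ρ ≤ f then 2 * (f - p) ^ 2 / f ^ 2 else 1) ≤
      (2 * ρ ^ 2 + 4 * (f - p) ^ 2 + 4 / ρ ^ 2 * ((f - p) ^ 2 * (f - p) ^ 2)) / p ^ 2 := by
  rw [le_div_iff₀ (by positivity)]
  split_ifs with h
  · have hf : 0 < f := hρ.trans_le h
    have hsq : ρ ^ 2 ≤ f ^ 2 := pow_le_pow_left₀ hρ.le h 2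
    have h1 : p ^ 2 ≤ 2 * f ^ 2 + 2 * (f - p) ^ 2 := by nlinarith [sq_nonneg (f + (f - p))]
    have h2 : 4 * (f - p) ^ 2 * (f - p) ^ 2 / f ^ 2 ≤ 4 * (f - p) ^ 2 * (f - p) ^ 2 / ρ ^ 2 :=
      div_le_div_of_nonneg_left (by positivity) (by positivity) hsq
    calc 2 * (f - p) ^ 2 / f ^ 2 * p ^ 2
        ≤ 2 * (f - p) ^ 2 / f ^ 2 * (2 * f ^ 2 + 2 * (f - p) ^ 2) := by gcongr
      _ = 4 * (f - p) ^ 2 + 4 * (f - p) ^ 2 * (f - p) ^ 2 / f ^ 2 := by field_simp; ring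
      _ ≤ 4 * (f - p) ^ 2 + 4 * (f - p) ^ 2 * (f - p) ^ 2 / ρ ^ 2 := by linarith
      _ = 4 * (f - p) ^ 2 + 4 / ρ ^ 2 * ((f - p) ^ 2 * (f - p) ^ 2) := by ring
      _ ≤ _ := by nlinarith [sq_nonneg ρ]
  · push Not at h
    have h0 : 0 ≤ 4 / ρ ^ 2 * ((f - p) ^ 2 * (f - p) ^ 2) := by positivity
    rcases le_total p ρ with h1 | h1
    · nlinarith [sq_nonneg (f - p)]
    · have : p ^ 2 ≤ 2 * ρ ^ 2 + 2 * (p - ρ) ^ 2 := by nlinarith [sq_nonneg (ρ - (p - ρ))]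
      have h3 : (p - ρ) ^ 2 ≤ (p - f) ^ 2 := pow_le_pow_left₀ (by linarith) (by linarith) 2
      have h4 : (p - f) ^ 2 = (f - p) ^ 2 := by ring
      nlinarith [sq_nonneg (f - p)]

open Classical in
/-- Pointwise risk bound for a truncated plug-in score, in terms of the bias and the variance of the
numerator and of the denominator. -/
theorem exists_lintegral_truncated_score_le {Ω : Type*} [MeasurableSpace Ω] {c r : ℝ} (hc : 1 ≤ c)
    (hr : 0 < r) :
    ∃ C : ℝ, 0 < C ∧ ∀ (d n : ℕ) (μ : Measure Ω) [IsProbabilityMeasure μ] (g : Ω → ℝ)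
      (v : Fin d → Ω → ℝ) (u : (Fin n → Ω) → E d) (P : E d) (p τ : ℝ), 1 ≤ n → BddMeas g →
      (∀ i, BddMeas (v i)) → (∀ X i, u X i = empMean (v i) X) → 0 < p → 0 < τ →
      (∀ y, |g y| ≤ n * (c * τ)) → (n : ℝ)⁻¹ * ∫ y, g y ^ 2 ∂μ ≤ c * τ ^ 2 →
      |∫ y, g y ∂μ - p| ≤ c * τ →
      ∫⁻ X, ENNReal.ofReal (‖(if r * τ ≤ empMean g X then (empMean g X)⁻¹ • u X else 0)
          - p⁻¹ • P‖ ^ 2 * p) ∂(Measure.pi fun _ : Fin n => μ) ≤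
        ENNReal.ofReal (C * (τ⁻¹ * ∑ i, ((n : ℝ)⁻¹ * ∫ y, v i y ^ 2 ∂μ
          + (∫ y, v i y ∂μ - P i) ^ 2) + ‖p⁻¹ • P‖ ^ 2 * min p τ)) := by
  set C₁ : ℝ := 4 / r + 72 * c ^ 2 / r ^ 3 with hC₁
  set C₂ : ℝ := 1 + 2 / r ^ 2 * (36 * c ^ 2 * (2 * c ^ 2)) with hC₂
  set C₃ : ℝ := 2 * r ^ 2 + 4 * (2 * c ^ 2) + 4 / r ^ 2 * (36 * c ^ 2 * (2 * c ^ 2)) with hC₃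
  have hc0 : 0 < c := by linarith
  have p1 : 0 < C₁ := by positivity
  have p2 : 0 < C₂ := by positivity
  have p3 : 0 < C₃ := by positivity
  refine ⟨C₁ + C₂ + C₃, by positivity, ?_⟩
  intro d n μ _ g v u P p τ hn hg hv hu hp hτ hgb hg2 hb
  have hρ : 0 < r * τ := by positivity
  set m := Measure.pi fun _ : Fin n => μ with hm
  have hD : BddMeas (fun X : Fin n → Ω => empMean g X - p) := hg.empMean.sub (BddMeas.const p)
  have hS : ∀ i, BddMeas (fun X : Fin n → Ω => empMean (v i) X - P i) := fun i =>
    (hv i).empMean.sub (BddMeas.const _)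
  set N : (Fin n → Ω) → ℝ := fun X => ∑ i, ((4 / (r * τ)) * (empMean (v i) X - P i) ^ 2
    + (2 / (r * τ) ^ 3) * ((empMean (v i) X - P i) ^ 2 * (empMean g X - p) ^ 2)) with hN
  have hNb : BddMeas N := BddMeas.sum _ fun i => (((hS i).pow 2).const_mul _).add
    ((((hS i).pow 2).mul (hD.pow 2)).const_mul _)
  have hNe : ∀ X, ‖u X - P‖ ^ 2 * (4 / (r * τ) + 2 / (r * τ) ^ 3 * (empMean g X - p) ^ 2) = N X := by
    intro X
    rw [EuclideanSpace.norm_sq_eq, Finset.sum_mul]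
    refine Finset.sum_congr rfl fun i _ => ?_
    simp only [PiLp.sub_apply, hu, Real.norm_eq_abs, sq_abs]
    ring
  set A : Fin d → ℝ := fun i => (n : ℝ)⁻¹ * ∫ y, v i y ^ 2 ∂μ + (∫ y, v i y ∂μ - P i) ^ 2 with hA
  have hA0 : ∀ i, 0 ≤ A i := fun i => add_nonneg (mul_nonneg (by positivity)
    (integral_nonneg fun _ => sq_nonneg _)) (sq_nonneg _)
  have hNint : ∫ X, N X ∂m ≤ C₁ * (τ⁻¹ * ∑ i, A i) := by
    rw [integral_finsetSum _ fun i _ => ((((hS i).pow 2).const_mul _).add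
      ((((hS i).pow 2).mul (hD.pow 2)).const_mul _)).integrable m, Finset.mul_sum, Finset.mul_sum]
    refine Finset.sum_le_sum fun i _ => ?_
    rw [integral_add ((((hS i).pow 2).const_mul _).integrable m)
      (((((hS i).pow 2).mul (hD.pow 2)).const_mul _).integrable m), integral_const_mul,
      integral_const_mul]
    have h1 := integral_empMean_sub_sq_le μ hn (hv i) (P i)
    have h2 := integral_empMean_sub_sq_mul_le μ hn hg (hv i) hc hτ hgb hg2 hb (P i)
    calc _ ≤ 4 / (r * τ) * A i + 2 / (r * τ) ^ 3 * (36 * c ^ 2 * τ ^ 2 * A i) := by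
          gcongr
      _ = C₁ * (τ⁻¹ * A i) := by
          rw [hC₁]
          field_simp
          ring
  have hD2 : ∫ X, (empMean g X - p) ^ 2 ∂m ≤ 2 * c ^ 2 * τ ^ 2 := by
    have h1 := integral_empMean_sub_sq_le μ hn hg p
    have h2 : (∫ y, g y ∂μ - p) ^ 2 ≤ (c * τ) ^ 2 := by
      rw [← sq_abs]
      exact pow_le_pow_left₀ (abs_nonneg _) hb 2
    have h3 : c * τ ^ 2 ≤ c ^ 2 * τ ^ 2 := mul_le_mul_of_nonneg_right (by nlinarith) (sq_nonneg _)
    calc _ ≤ c * τ ^ 2 + (c * τ) ^ 2 := h1.trans (add_le_add hg2 h2)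
      _ ≤ _ := by rw [mul_pow]; linarith
  have hD4 : ∫ X, (empMean g X - p) ^ 2 * (empMean g X - p) ^ 2 ∂m ≤
      36 * c ^ 2 * (2 * c ^ 2) * τ ^ 4 := by
    have h1 := integral_empMean_sub_sq_mul_le μ hn hg hg hc hτ hgb hg2 hb p
    have h2 : (∫ y, g y ∂μ - p) ^ 2 ≤ (c * τ) ^ 2 := by
      rw [← sq_abs]
      exact pow_le_pow_left₀ (abs_nonneg _) hb 2
    have h3 : c * τ ^ 2 ≤ c ^ 2 * τ ^ 2 := mul_le_mul_of_nonneg_right (by nlinarith) (sq_nonneg _)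
    have h4 : (n : ℝ)⁻¹ * ∫ y, g y ^ 2 ∂μ + (∫ y, g y ∂μ - p) ^ 2 ≤ 2 * c ^ 2 * τ ^ 2 := by
      rw [mul_pow] at h2
      linarith
    calc _ ≤ 36 * c ^ 2 * τ ^ 2 * (2 * c ^ 2 * τ ^ 2) := h1.trans (by gcongr)
      _ = _ := by ring
  have key : ∀ F : (Fin n → Ω) → ℝ, BddMeas F → (∀ X,
      (if r * τ ≤ empMean g X then 2 * (empMean g X - p) ^ 2 / empMean g X ^ 2 else 1) ≤ F X) →
      ∫⁻ X, ENNReal.ofReal (‖(if r * τ ≤ empMean g X then (empMean g X)⁻¹ • u X else 0)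
          - p⁻¹ • P‖ ^ 2 * p) ∂m ≤
        ENNReal.ofReal (C₁ * (τ⁻¹ * ∑ i, A i) + ‖p⁻¹ • P‖ ^ 2 * p * ∫ X, F X ∂m) := by
    intro F hF hFle
    have hFa := hF.const_mul (‖p⁻¹ • P‖ ^ 2 * p)
    calc _ ≤ ∫⁻ X, ENNReal.ofReal (N X + ‖p⁻¹ • P‖ ^ 2 * p * F X) ∂m := by
          refine lintegral_mono fun X => ENNReal.ofReal_le_ofReal ?_
          refine (norm_truncated_score_sub_sq_mul_le hp hρ _ _ _).trans ?_
          rw [hNe]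
          gcongr
          exact hFle X
      _ = ENNReal.ofReal (∫ X, (N X + ‖p⁻¹ • P‖ ^ 2 * p * F X) ∂m) := by
          rw [ofReal_integral_eq_lintegral_ofReal ((hNb.add hFa).integrable m)]
          refine ae_of_all _ fun X => add_nonneg ?_ (mul_nonneg (by positivity) ?_)
          · rw [← hNe]; positivity
          · refine le_trans ?_ (hFle X)
            split_ifs <;> positivity
      _ ≤ _ := by
          refine ENNReal.ofReal_le_ofReal ?_
          rw [integral_add (hNb.integrable m) (hFa.integrable m), integral_const_mul]
          gcongr
  have hS0 : 0 ≤ τ⁻¹ * ∑ i, A i := mul_nonneg (by positivity) (Finset.sum_nonneg fun i _ => hA0 i)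
  have ha : 0 ≤ ‖p⁻¹ • P‖ ^ 2 := sq_nonneg _
  have hfin : ∀ x y : ℝ, 0 ≤ y → x ≤ (C₂ + C₃) * y → C₁ * (τ⁻¹ * ∑ i, A i) + ‖p⁻¹ • P‖ ^ 2 * x ≤
      (C₁ + C₂ + C₃) * (τ⁻¹ * ∑ i, A i + ‖p⁻¹ • P‖ ^ 2 * y) := by
    intro x y hy hxy
    have a1 := mul_le_mul_of_nonneg_left hxy ha
    have a2 : 0 ≤ (C₂ + C₃) * (τ⁻¹ * ∑ i, A i) := by positivity
    have a3 : 0 ≤ C₁ * (‖p⁻¹ • P‖ ^ 2 * y) := by positivity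
    linarith
  rcases le_total p τ with hpτ | hpτ
  · rw [min_eq_left hpτ]
    refine (key (fun X => 1 + 2 / (r * τ) ^ 2 * (empMean g X - p) ^ 2)
      ((BddMeas.const 1).add ((hD.pow 2).const_mul _)) fun X => truncation_weight_le hρ _ _).trans ?_
    refine ENNReal.ofReal_le_ofReal ?_
    rw [integral_add ((BddMeas.const 1).integrable m) (((hD.pow 2).const_mul _).integrable m),
      integral_const_mul, mul_assoc]
    refine hfin _ _ hp.le ?_
    rw [mul_comm]
    refine mul_le_mul_of_nonneg_right ?_ hp.le
    have h1 : 2 / (r * τ) ^ 2 * ∫ X, (empMean g X - p) ^ 2 ∂m ≤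
        2 / (r * τ) ^ 2 * (2 * c ^ 2 * τ ^ 2) := by gcongr
    have h2 : 2 / (r * τ) ^ 2 * (2 * c ^ 2 * τ ^ 2) = 2 / r ^ 2 * (1 * (2 * c ^ 2)) := by
      field_simp
    have h3 : 2 / r ^ 2 * (1 * (2 * c ^ 2)) ≤ 2 / r ^ 2 * (36 * c ^ 2 * (2 * c ^ 2)) := by
      gcongr
      nlinarith
    simp only [integral_const, probReal_univ, smul_eq_mul]
    rw [h2] at h1
    rw [hC₂]
    linarith
  · rw [min_eq_right hpτ]
    refine (key (fun X => (p ^ 2)⁻¹ * (2 * (r * τ) ^ 2 + 4 * (empMean g X - p) ^ 2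
      + 4 / (r * τ) ^ 2 * ((empMean g X - p) ^ 2 * (empMean g X - p) ^ 2)))
      ((((BddMeas.const _).add ((hD.pow 2).const_mul _)).add
        (((hD.pow 2).mul (hD.pow 2)).const_mul _)).const_mul _) fun X => ?_).trans ?_
    · refine (truncation_weight_le' hρ hp _).trans_eq ?_
      rw [div_eq_inv_mul]
    refine ENNReal.ofReal_le_ofReal ?_
    rw [integral_const_mul, integral_add (((BddMeas.const _).add
        ((hD.pow 2).const_mul _)).integrable m) ((((hD.pow 2).mul (hD.pow 2)).const_mul _).integrable m),
      integral_add ((BddMeas.const _).integrable m) (((hD.pow 2).const_mul _).integrable m),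
      integral_const_mul, integral_const_mul, mul_assoc]
    refine hfin _ _ hτ.le ?_
    simp only [integral_const, integral_const_mul, probReal_univ, smul_eq_mul, one_mul]
    have h1 : 2 * (r * τ) ^ 2 + 4 * ∫ X, (empMean g X - p) ^ 2 ∂m
        + 4 / (r * τ) ^ 2 * ∫ X, (empMean g X - p) ^ 2 * (empMean g X - p) ^ 2 ∂m ≤
        C₃ * τ ^ 2 := by
      calc _ ≤ 2 * (r * τ) ^ 2 + 4 * (2 * c ^ 2 * τ ^ 2)
            + 4 / (r * τ) ^ 2 * (36 * c ^ 2 * (2 * c ^ 2) * τ ^ 4) := by gcongr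
        _ = _ := by
            rw [hC₃]
            field_simp
    calc _ ≤ p * ((p ^ 2)⁻¹ * (C₃ * τ ^ 2)) := by gcongr
      _ = C₃ * τ * (τ / p) := by field_simp
      _ ≤ C₃ * τ * 1 := by
          gcongr
          exact (div_le_one hp).2 hpτ
      _ ≤ _ := by nlinarith

end ScoreError

section Gaussian

variable {d : ℕ} {t : ℝ}

lemma gaussianDensity_pos (ht : 0 < t) (x : E d) : 0 < gaussianDensity d t x := by
  unfold gaussianDensity
  positivity

lemma continuous_gaussianDensity : Continuous (gaussianDensity d t) := by
  unfold gaussianDensity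
  fun_prop

lemma gaussianDensity_le (ht : 0 < t) (x : E d) :
    gaussianDensity d t x ≤ gaussianDensity d t 0 := by
  unfold gaussianDensity
  gcongr
  simp

lemma gaussianDensity_eq (x : E d) :
    gaussianDensity d t x =
      1 / (2 * Real.pi * t) ^ ((d : ℝ) / 2) * Real.exp (-(1 / (2 * t)) * ‖x‖ ^ 2) := by
  unfold gaussianDensity
  congr 2
  ring

lemma integral_gaussianDensity (ht : 0 < t) : ∫ x, gaussianDensity d t x = 1 := by
  simp_rw [gaussianDensity_eq]
  rw [integral_const_mul, GaussianFourier.integral_rexp_neg_mul_sq_norm (by positivity)]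
  have : Real.pi / (1 / (2 * t)) = 2 * Real.pi * t := by field_simp
  rw [this, finrank_euclideanSpace_fin]
  exact one_div_mul_cancel (by positivity)

lemma integrable_gaussianDensity (ht : 0 < t) : Integrable (gaussianDensity d t) := by
  by_contra h
  have := integral_gaussianDensity (d := d) ht
  rw [integral_undef h] at this
  exact zero_ne_one this

lemma gaussianDensity_eq_two_mul (ht : 0 < t) (x : E d) :
    gaussianDensity d t x =
      2 ^ ((d : ℝ) / 2) * (Real.exp (-(‖x‖ ^ 2 / (4 * t))) * gaussianDensity d (2 * t) x) := by
  unfold gaussianDensity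
  have h1 : (2 * Real.pi * (2 * t)) ^ ((d : ℝ) / 2) =
      2 ^ ((d : ℝ) / 2) * (2 * Real.pi * t) ^ ((d : ℝ) / 2) := by
    rw [← Real.mul_rpow (by positivity) (by positivity)]
    ring_nf
  have h2 : Real.exp (-‖x‖ ^ 2 / (2 * t)) =
      Real.exp (-(‖x‖ ^ 2 / (4 * t))) * Real.exp (-‖x‖ ^ 2 / (2 * (2 * t))) := by
    rw [← Real.exp_add]
    congr 1
    field_simp
    ring
  rw [h1, h2]
  have : (0 : ℝ) < 2 ^ ((d : ℝ) / 2) := by positivity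
  field_simp

/-- Polynomial weights are absorbed by doubling the variance, uniformly for bounded variances. -/
lemma exists_rpow_mul_gaussianDensity_le (d : ℕ) {q T : ℝ} (hq : 0 < q) (hT : 0 < T) :
    ∃ C : ℝ, 0 < C ∧ ∀ t, 0 < t → t ≤ T → ∀ x : E d,
      (1 + ‖x‖ ^ 2) ^ q * gaussianDensity d t x ≤ C * gaussianDensity d (2 * t) x := by
  set b : ℝ := 1 / (4 * T * q) with hb
  have hb0 : 0 < b := by positivity
  set m : ℝ := 1 + 1 / b with hm
  refine ⟨2 ^ ((d : ℝ) / 2) * m ^ q, by positivity, fun t ht htT x => ?_⟩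
  have h1 : 1 + ‖x‖ ^ 2 ≤ m * Real.exp (b * ‖x‖ ^ 2) := by
    have h := Real.add_one_le_exp (b * ‖x‖ ^ 2)
    calc 1 + ‖x‖ ^ 2 ≤ m * (b * ‖x‖ ^ 2 + 1) := by
          have : m * (b * ‖x‖ ^ 2 + 1) = b * ‖x‖ ^ 2 + 1 + ‖x‖ ^ 2 + 1 / b := by
            rw [hm]
            field_simp
            ring
          rw [this]
          have h2 : 0 < 1 / b := by positivity
          have h3 : 0 ≤ b * ‖x‖ ^ 2 := by positivity
          linarith
      _ ≤ _ := by gcongr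
  have h2 : (1 + ‖x‖ ^ 2) ^ q ≤ m ^ q * Real.exp (‖x‖ ^ 2 / (4 * t)) := by
    calc (1 + ‖x‖ ^ 2) ^ q ≤ (m * Real.exp (b * ‖x‖ ^ 2)) ^ q :=
          Real.rpow_le_rpow (by positivity) h1 hq.le
      _ = m ^ q * Real.exp (‖x‖ ^ 2 / (4 * T)) := by
          rw [Real.mul_rpow (by positivity) (by positivity), ← Real.exp_mul]
          congr 2
          rw [hb]
          field_simp
      _ ≤ _ := by gcongr
  have hg := gaussianDensity_pos (d := d) (t := 2 * t) (by positivity) x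
  calc (1 + ‖x‖ ^ 2) ^ q * gaussianDensity d t x
      ≤ m ^ q * Real.exp (‖x‖ ^ 2 / (4 * t)) * gaussianDensity d t x :=
        mul_le_mul_of_nonneg_right h2 (gaussianDensity_pos ht x).le
    _ = 2 ^ ((d : ℝ) / 2) * m ^ q *
        (Real.exp (‖x‖ ^ 2 / (4 * t)) * Real.exp (-(‖x‖ ^ 2 / (4 * t)))) *
          gaussianDensity d (2 * t) x := by
        rw [gaussianDensity_eq_two_mul ht]
        ring
    _ = _ := by rw [← Real.exp_add, add_neg_cancel, Real.exp_zero, mul_one]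

/-- The partial derivative `∂ᵢ φ_t` of the Gaussian density. -/
def gaussianPartial (d : ℕ) (t : ℝ) (i : Fin d) (x : E d) : ℝ :=
  -(x i / t) * gaussianDensity d t x

lemma continuous_gaussianPartial (i : Fin d) : Continuous (gaussianPartial d t i) := by
  have := continuous_gaussianDensity (d := d) (t := t)
  unfold gaussianPartial
  fun_prop

lemma exists_abs_gaussianPartial_le (ht : 0 < t) :
    ∃ C : ℝ, 0 < C ∧ ∀ (i : Fin d) (x : E d), |gaussianPartial d t i x| ≤
      C * gaussianDensity d (2 * t) x := by
  obtain ⟨C, hC, h⟩ := exists_rpow_mul_gaussianDensity_le d (q := 1) (T := t) one_pos ht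
  refine ⟨C / t, by positivity, fun i x => ?_⟩
  have h1 := h t ht le_rfl x
  rw [Real.rpow_one] at h1
  have h2 : |x i| ≤ 1 + ‖x‖ ^ 2 := by
    have := PiLp.norm_apply_le x i
    rw [Real.norm_eq_abs] at this
    nlinarith [sq_nonneg (‖x‖ - 1)]
  rw [gaussianPartial, abs_mul, abs_neg, abs_div, abs_of_pos ht, abs_of_pos (gaussianDensity_pos ht x)]
  calc |x i| / t * gaussianDensity d t x ≤ (1 + ‖x‖ ^ 2) / t * gaussianDensity d t x := by
        have := (gaussianDensity_pos ht x).le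
        gcongr
    _ = (1 + ‖x‖ ^ 2) * gaussianDensity d t x / t := by ring
    _ ≤ C * gaussianDensity d (2 * t) x / t := by gcongr
    _ = _ := by ring

lemma integrable_gaussianPartial (ht : 0 < t) (i : Fin d) : Integrable (gaussianPartial d t i) := by
  obtain ⟨C, hC, h⟩ := exists_abs_gaussianPartial_le (d := d) ht
  refine ((integrable_gaussianDensity (d := d) (t := 2 * t) (by positivity)).const_mul C).mono'
    (continuous_gaussianPartial i).aestronglyMeasurable (ae_of_all _ (h i))

lemma exists_forall_abs_gaussianPartial_le (ht : 0 < t) :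
    ∃ C : ℝ, 0 < C ∧ ∀ (i : Fin d) (x : E d), |gaussianPartial d t i x| ≤ C := by
  obtain ⟨C, hC, h⟩ := exists_abs_gaussianPartial_le (d := d) ht
  have h0 := gaussianDensity_pos (d := d) (t := 2 * t) (by positivity) 0
  exact ⟨C * gaussianDensity d (2 * t) 0, by positivity, fun i x => (h i x).trans
    (by gcongr; exact gaussianDensity_le (by positivity) x)⟩

/-- The gradient of the Gaussian density. -/
def gaussianGrad (d : ℕ) (t : ℝ) (x : E d) : E d := WithLp.toLp 2 fun i => gaussianPartial d t i x

lemma gaussianGrad_eq (x : E d) : gaussianGrad d t x = (-(gaussianDensity d t x / t)) • x := by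
  ext i
  simp [gaussianGrad, gaussianPartial]
  ring

lemma hasGradientAt_gaussianDensity (x : E d) :
    HasGradientAt (gaussianDensity d t) (gaussianGrad d t x) x := by
  rw [hasGradientAt_iff_hasFDerivAt]
  have h1 : HasFDerivAt (fun y : E d => ‖y‖ ^ 2) (2 • innerSL ℝ x) x :=
    (hasStrictFDerivAt_norm_sq x).hasFDerivAt
  have h2 := ((h1.const_mul (-(1 / (2 * t)))).exp).const_mul (1 / (2 * Real.pi * t) ^ ((d : ℝ) / 2))
  have e : gaussianDensity d t = fun x => 1 / (2 * Real.pi * t) ^ ((d : ℝ) / 2) *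
      Real.exp (-(1 / (2 * t)) * ‖x‖ ^ 2) := funext gaussianDensity_eq
  rw [gaussianGrad_eq, e]
  refine h2.congr_fderiv ?_
  ext v
  simp [InnerProductSpace.toDual_apply_apply]
  ring

lemma continuous_gaussianGrad : Continuous (gaussianGrad d t) := by
  have h := continuous_gaussianDensity (d := d) (t := t)
  have : gaussianGrad d t = fun x => (-(gaussianDensity d t x / t)) • x := funext gaussianGrad_eq
  rw [this]
  fun_prop

lemma norm_gaussianGrad_le {C : ℝ} (hC : ∀ (i : Fin d) (x : E d), |gaussianPartial d t i x| ≤ C)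
    (x : E d) : ‖gaussianGrad d t x‖ ≤ d * C := by
  have h : ‖gaussianGrad d t x‖ ≤ ∑ i, |gaussianPartial d t i x| := by
    conv_lhs => rw [← (EuclideanSpace.basisFun (Fin d) ℝ).sum_repr (gaussianGrad d t x)]
    refine (norm_sum_le _ _).trans (Finset.sum_le_sum fun i _ => ?_)
    rw [norm_smul]
    simp [gaussianGrad]
  refine h.trans ((Finset.sum_le_sum fun i _ => hC i x).trans ?_)
  simp

/-- The convolution `f * ∂ᵢφ_t`. -/
def smoothPartial (t : ℝ) (f : E d → ℝ) (i : Fin d) (x : E d) : ℝ :=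
  ∫ y, f y * gaussianPartial d t i (x - y)

/-- The gradient of `f * φ_t`. -/
def smoothGrad (t : ℝ) (f : E d → ℝ) (x : E d) : E d := WithLp.toLp 2 fun i => smoothPartial t f i x

lemma integrable_mul_gaussianDensity {f : E d → ℝ} (ht : 0 < t) (hf : Integrable f) (x : E d) :
    Integrable fun y => f y * gaussianDensity d t (x - y) := by
  refine hf.mul_bdd (c := gaussianDensity d t 0) ?_ (ae_of_all _ fun y => ?_)
  · exact (continuous_gaussianDensity.comp (by fun_prop)).aestronglyMeasurable
  · rw [Real.norm_eq_abs, abs_of_pos (gaussianDensity_pos ht _)]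
    exact gaussianDensity_le ht _

lemma integrable_mul_gaussianPartial {f : E d → ℝ} (ht : 0 < t) (hf : Integrable f) (i : Fin d)
    (x : E d) : Integrable fun y => f y * gaussianPartial d t i (x - y) := by
  obtain ⟨C, hC, h⟩ := exists_forall_abs_gaussianPartial_le (d := d) ht
  refine hf.mul_bdd (c := C) ?_ (ae_of_all _ fun y => h i _)
  exact ((continuous_gaussianPartial i).comp (by fun_prop)).aestronglyMeasurable

lemma hasGradientAt_gaussianSmooth {f : E d → ℝ} (ht : 0 < t) (hf : Integrable f) (x : E d) :
    HasGradientAt (gaussianSmooth t f) (smoothGrad t f x) x := by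
  obtain ⟨C, hC, h⟩ := exists_forall_abs_gaussianPartial_le (d := d) ht
  rw [hasGradientAt_iff_hasFDerivAt]
  set F' : E d → E d → (E d →L[ℝ] ℝ) := fun x y =>
    f y • InnerProductSpace.toDual ℝ (E d) (gaussianGrad d t (x - y)) with hF'
  have hcont : ∀ x, Continuous fun y => InnerProductSpace.toDual ℝ (E d) (gaussianGrad d t (x - y)) :=
    fun x => (LinearIsometryEquiv.continuous _).comp (continuous_gaussianGrad.comp (by fun_prop))
  have hmeas : AEStronglyMeasurable (F' x) := hf.aestronglyMeasurable.smul
    (hcont x).aestronglyMeasurable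
  have hbound : ∀ x y, ‖F' x y‖ ≤ ‖f y‖ * (d * C) := fun x y => by
    rw [hF', norm_smul, LinearIsometryEquiv.norm_map]
    gcongr
    exact norm_gaussianGrad_le h _
  have key := hasFDerivAt_integral_of_dominated_of_fderiv_le (𝕜 := ℝ) (μ := volume)
    (F := fun x y => f y * gaussianDensity d t (x - y)) (F' := F') (x₀ := x) (s := Set.univ)
    (bound := fun y => ‖f y‖ * (d * C)) Filter.univ_mem
    (Filter.Eventually.of_forall fun x => (integrable_mul_gaussianDensity ht hf x).aestronglyMeasurable)
    (integrable_mul_gaussianDensity ht hf x) hmeas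
    (ae_of_all _ fun y x _ => hbound x y) (hf.norm.mul_const _)
    (ae_of_all _ fun y x _ => by
      have h1 := (hasGradientAt_gaussianDensity (t := t) (x - y)).hasFDerivAt.comp x
        ((hasFDerivAt_id x).sub_const y)
      exact h1.const_mul (f y))
  refine key.congr_fderiv ?_
  have hint : Integrable (F' x) := (hf.norm.mul_const (d * C)).mono' hmeas
    (ae_of_all _ fun y => hbound x y)
  refine ContinuousLinearMap.coe_injective ?_
  refine (EuclideanSpace.basisFun (Fin d) ℝ).toBasis.ext fun i => ?_
  simp only [OrthonormalBasis.coe_toBasis, ContinuousLinearMap.coe_coe]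
  rw [ContinuousLinearMap.integral_apply hint]
  simp [hF', InnerProductSpace.toDual_apply_apply, smoothGrad, smoothPartial, gaussianGrad,
    EuclideanSpace.inner_single_right]

lemma gradient_gaussianSmooth {f : E d → ℝ} (ht : 0 < t) (hf : Integrable f) (x : E d) :
    gradient (gaussianSmooth t f) x = smoothGrad t f x :=
  (hasGradientAt_gaussianSmooth ht hf x).gradient

lemma continuous_gaussianSmooth {f : E d → ℝ} (ht : 0 < t) (hf : Integrable f) :
    Continuous (gaussianSmooth t f) :=
  continuous_iff_continuousAt.2 fun x =>
    (hasGradientAt_gaussianSmooth ht hf x).hasFDerivAt.continuousAt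

lemma continuous_smoothPartial {f : E d → ℝ} (ht : 0 < t) (hf : Integrable f) (i : Fin d) :
    Continuous (smoothPartial t f i) := by
  obtain ⟨C, hC, h⟩ := exists_forall_abs_gaussianPartial_le (d := d) ht
  refine continuous_of_dominated (bound := fun y => ‖f y‖ * C)
    (fun x => (integrable_mul_gaussianPartial ht hf i x).aestronglyMeasurable)
    (fun x => ae_of_all _ fun y => ?_) (hf.norm.mul_const _) (ae_of_all _ fun y => ?_)
  · rw [norm_mul]
    gcongr
    exact h i _
  · exact continuous_const.mul ((continuous_gaussianPartial i).comp (by fun_prop))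

lemma exists_abs_smoothPartial_le {f : E d → ℝ} (ht : 0 < t) (hf : Integrable f) (i : Fin d) :
    ∃ C : ℝ, ∀ x, |smoothPartial t f i x| ≤ C := by
  obtain ⟨C, hC, h⟩ := exists_forall_abs_gaussianPartial_le (d := d) ht
  refine ⟨∫ y, ‖f y‖ * C, fun x => ?_⟩
  rw [smoothPartial, ← Real.norm_eq_abs]
  refine (norm_integral_le_integral_norm _).trans ?_
  refine integral_mono (integrable_mul_gaussianPartial ht hf i x).norm (hf.norm.mul_const _)
    fun y => ?_
  simp only [norm_mul]
  gcongr
  exact h i _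

lemma gaussianSmooth_pos {f : E d → ℝ} (ht : 0 < t) (hf : IsDensity f) (x : E d) :
    0 < gaussianSmooth t f x := by
  obtain ⟨hi, h0, h1⟩ := hf
  have hnn : ∀ y, 0 ≤ f y * gaussianDensity d t (x - y) := fun y =>
    mul_nonneg (h0 y) (gaussianDensity_pos ht _).le
  refine lt_of_le_of_ne (integral_nonneg hnn) fun h => ?_
  have h2 := (integral_eq_zero_iff_of_nonneg hnn (integrable_mul_gaussianDensity ht hi x)).1 h.symm
  have h3 : f =ᵐ[volume] 0 := h2.mono fun y hy => by
    simpa [(gaussianDensity_pos ht (x - y)).ne'] using hy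
  rw [integral_congr_ae h3] at h1
  simp at h1

lemma score_gaussianSmooth {f : E d → ℝ} (ht : 0 < t) (hf : IsDensity f) (x : E d) :
    score (gaussianSmooth t f) x = (gaussianSmooth t f x)⁻¹ • smoothGrad t f x := by
  have h := (hasGradientAt_gaussianSmooth ht hf.1 x).hasFDerivAt.log (gaussianSmooth_pos ht hf x).ne'
  refine HasGradientAt.gradient ?_
  rw [hasGradientAt_iff_hasFDerivAt]
  refine h.congr_fderiv ?_
  simp

end Gaussian

section Taylor

variable {d : ℕ}

lemma sum_smul_single (u : E d) : ∑ i, u i • EuclideanSpace.single i (1 : ℝ) = u := by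
  have := (EuclideanSpace.basisFun (Fin d) ℝ).sum_repr u
  simpa using this

lemma multilinear_diag_eq_sum {j : ℕ} (A : ContinuousMultilinearMap ℝ (fun _ : Fin j => E d) ℝ)
    (u : E d) : A (fun _ => u) =
      ∑ r : Fin j → Fin d, (∏ k, u (r k)) * A fun k => EuclideanSpace.single (r k) 1 := by
  have h := A.map_sum (fun (_ : Fin j) (i : Fin d) => u i • EuclideanSpace.single i (1 : ℝ))
  simp only [sum_smul_single] at h
  rw [h]
  refine Finset.sum_congr rfl fun r _ => ?_
  rw [A.map_smul_univ (fun k => u (r k)) fun k => EuclideanSpace.single (r k) 1, smul_eq_mul]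

lemma iteratedDeriv_comp_add_smul {f : E d → ℝ} {m : ℕ} (hf : ContDiff ℝ m f) (y v : E d) :
    ∀ k ≤ m, ∀ s : ℝ, iteratedDeriv k (fun s : ℝ => f (y + s • v)) s =
      iteratedFDeriv ℝ k f (y + s • v) fun _ => v := by
  intro k
  induction k with
  | zero => intro _ s; simp
  | succ k ih =>
    intro hk s
    have e : iteratedDeriv k (fun s : ℝ => f (y + s • v)) =
        fun s => iteratedFDeriv ℝ k f (y + s • v) fun _ => v := funext (ih (by omega))
    rw [iteratedDeriv_succ, e, iteratedFDeriv_succ_apply_left]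
    have h1 : DifferentiableAt ℝ (iteratedFDeriv ℝ k f) (y + s • v) :=
      (hf.differentiable_iteratedFDeriv (by exact_mod_cast hk)) _
    have h2 : HasDerivAt (fun s : ℝ => y + s • v) v s := by
      simpa using ((hasDerivAt_id s).smul_const v).const_add y
    have h3 := h1.hasFDerivAt.comp_hasDerivAt s h2
    have h4 := ((ContinuousMultilinearMap.apply ℝ (fun _ : Fin k => E d) ℝ
      fun _ => v).hasFDerivAt (x := iteratedFDeriv ℝ k f (y + s • v))).comp_hasDerivAt s h3
    exact h4.deriv

/-- Taylor's theorem with Lagrange remainder along a segment. -/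
lemma exists_taylor_segment {f : E d → ℝ} {m : ℕ} (hf : ContDiff ℝ (m + 1 : ℕ) f) (y v : E d) :
    ∃ θ ∈ Set.Ioo (0 : ℝ) 1, f (y + v) =
      ∑ k ∈ Finset.range (m + 1), (k.factorial : ℝ)⁻¹ * iteratedFDeriv ℝ k f y (fun _ => v)
        + (iteratedFDeriv ℝ (m + 1) f (y + θ • v) fun _ => v) / ((m + 1).factorial : ℝ) := by
  set g : ℝ → ℝ := fun s => f (y + s • v) with hg
  have hgc : ContDiff ℝ (m + 1 : ℕ) g := hf.comp (by fun_prop)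
  obtain ⟨θ, hθ, h⟩ := taylor_mean_remainder_lagrange_iteratedDeriv (f := g) (x := 1) (x₀ := 0)
    (n := m) zero_ne_one (by exact_mod_cast hgc.contDiffOn)
  have hθ' : θ ∈ Set.Ioo (0 : ℝ) 1 := by
    simpa [Set.uIoo_of_lt (zero_lt_one (α := ℝ))] using hθ
  refine ⟨θ, hθ', ?_⟩
  rw [taylor_within_apply, iteratedDeriv_comp_add_smul hf y v (m + 1) le_rfl] at h
  have e : ∀ k ∈ Finset.range (m + 1), ((k.factorial : ℝ)⁻¹ * (1 - 0) ^ k) •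
      iteratedDerivWithin k g (Set.uIcc 0 1) 0 =
      (k.factorial : ℝ)⁻¹ * iteratedFDeriv ℝ k f y (fun _ => v) := by
    intro k hk
    have hk' : k ≤ m + 1 := (Finset.mem_range.1 hk).le
    rw [iteratedDerivWithin_eq_iteratedDeriv (uniqueDiffOn_uIcc zero_ne_one)
      ((hgc.of_le (by exact_mod_cast hk')).contDiffAt) (by simp),
      iteratedDeriv_comp_add_smul hf y v k hk']
    simp
  rw [Finset.sum_congr rfl e] at h
  simp only [hg, one_smul, sub_zero, one_pow, mul_one] at h
  linarith

lemma abs_prod_coord_le {j : ℕ} (v : E d) (r : Fin j → Fin d) : |∏ k, v (r k)| ≤ ‖v‖ ^ j := by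
  rw [Finset.abs_prod]
  calc _ ≤ ∏ _k : Fin j, ‖v‖ := Finset.prod_le_prod (fun _ _ => abs_nonneg _) fun k _ =>
        PiLp.norm_apply_le v (r k)
    _ = _ := by simp

lemma abs_sub_taylor_le {f : E d → ℝ} {β L : ℝ} (hβ : 1 ≤ ⌊β⌋₊) (hf : HolderClass β L f)
    (y v : E d) :
    |f (y + v) - ∑ k ∈ Finset.range (⌊β⌋₊ + 1),
        (k.factorial : ℝ)⁻¹ * iteratedFDeriv ℝ k f y (fun _ => v)| ≤
      (d : ℝ) ^ ⌊β⌋₊ * L * ‖v‖ ^ β := by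
  obtain ⟨-, hcd, hH⟩ := hf
  have hfl : (⌊β⌋₊ : ℝ) ≤ β := Nat.floor_le (by
    by_contra h
    rw [Nat.floor_of_nonpos (by linarith)] at hβ
    omega)
  rcases eq_or_ne v 0 with rfl | hv
  · have h0 : ∀ k ∈ Finset.range (⌊β⌋₊ + 1), k ≠ 0 →
        (k.factorial : ℝ)⁻¹ * iteratedFDeriv ℝ k f y (fun _ => (0 : E d)) = 0 := by
      intro k _ hk
      have : Nonempty (Fin k) := ⟨⟨0, Nat.pos_of_ne_zero hk⟩⟩
      rw [(iteratedFDeriv ℝ k f y).map_coord_zero (Classical.arbitrary _) rfl, mul_zero]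
    rw [Finset.sum_eq_single_of_mem 0 (by simp) h0]
    simp only [add_zero, Nat.factorial_zero, Nat.cast_one, inv_one, one_mul,
      iteratedFDeriv_zero_apply, sub_self, abs_zero, norm_zero]
    rw [Real.zero_rpow (by have : (1 : ℝ) ≤ ⌊β⌋₊ := by exact_mod_cast hβ
                           linarith)]
    simp
  obtain ⟨m, hm⟩ : ∃ m, ⌊β⌋₊ = m + 1 := ⟨⌊β⌋₊ - 1, by omega⟩
  set l := ⌊β⌋₊ with hl
  obtain ⟨θ, hθ, h⟩ := exists_taylor_segment (m := m) (by rw [← hm]; exact hcd) y v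
  have hnv : 0 < ‖v‖ := norm_pos_iff.2 hv
  have hfac : (1 : ℝ) ≤ (l.factorial : ℝ) := by exact_mod_cast l.factorial_pos
  have e : f (y + v) - ∑ k ∈ Finset.range (l + 1),
      (k.factorial : ℝ)⁻¹ * iteratedFDeriv ℝ k f y (fun _ => v) =
      (l.factorial : ℝ)⁻¹ * ((iteratedFDeriv ℝ l f (y + θ • v) fun _ => v)
        - iteratedFDeriv ℝ l f y fun _ => v) := by
    rw [Finset.sum_range_succ, h, ← hm]
    ring
  have hL : 0 ≤ L * ‖v‖ ^ (β - l) := by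
    rcases Nat.eq_zero_or_pos d with hd | hd
    · exact absurd (by subst hd; exact Subsingleton.elim v 0) hv
    · have := hH (fun _ => ⟨0, hd⟩) (y + v) y
      simp only [add_sub_cancel_left] at this
      exact (abs_nonneg _).trans this
  have hd : |(iteratedFDeriv ℝ l f (y + θ • v) fun _ => v) - iteratedFDeriv ℝ l f y fun _ => v| ≤
      (d : ℝ) ^ l * L * ‖v‖ ^ β := by
    rw [multilinear_diag_eq_sum, multilinear_diag_eq_sum, ← Finset.sum_sub_distrib]
    calc _ ≤ ∑ r : Fin l → Fin d, ‖v‖ ^ l * (L * ‖v‖ ^ (β - l)) := by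
          refine (Finset.abs_sum_le_sum_abs _ _).trans (Finset.sum_le_sum fun r _ => ?_)
          rw [← mul_sub, abs_mul]
          refine mul_le_mul (abs_prod_coord_le v r) ?_ (abs_nonneg _) (by positivity)
          refine (hH r _ _).trans ?_
          have hL0 : 0 ≤ L := nonneg_of_mul_nonneg_left hL (Real.rpow_pos_of_pos hnv _)
          refine mul_le_mul_of_nonneg_left (Real.rpow_le_rpow (norm_nonneg _) ?_ (by linarith)) hL0
          rw [add_sub_cancel_left, norm_smul, Real.norm_eq_abs, abs_of_pos hθ.1]
          nlinarith [hθ.2]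
      _ = (d : ℝ) ^ l * L * (‖v‖ ^ l * ‖v‖ ^ (β - l)) := by
          simp
          ring
      _ = _ := by
          rw [← Real.rpow_natCast ‖v‖ l, ← Real.rpow_add hnv]
          congr 2
          ring
  rw [e, abs_mul, abs_of_pos (by positivity)]
  calc _ ≤ 1 * ((d : ℝ) ^ l * L * ‖v‖ ^ β) :=
        mul_le_mul (inv_le_one_of_one_le₀ hfac) hd (abs_nonneg _) zero_le_one
    _ = _ := one_mul _

end Taylor

section Kernel

variable {d : ℕ} {l : ℕ} {K : E d → ℝ}

lemma norm_le_of_abs_le_one {u : E d} (h : ∀ i, u i ∈ Set.Icc (-1 : ℝ) 1) : ‖u‖ ≤ d := by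
  conv_lhs => rw [← sum_smul_single u]
  refine (norm_sum_le _ _).trans ?_
  calc _ ≤ ∑ _i : Fin d, (1 : ℝ) := Finset.sum_le_sum fun i _ => by
        rw [norm_smul]
        simpa using abs_le.2 (h i)
    _ = _ := by simp

namespace IsKernel

lemma norm_le_of_ne_zero (hK : IsKernel l K) {u : E d} (hu : K u ≠ 0) : ‖u‖ ≤ d :=
  norm_le_of_abs_le_one (hK.support_subset u hu)

lemma integrable (hK : IsKernel l K) : Integrable K := by
  have hs : Function.support K ⊆ Metric.closedBall (0 : E d) d := fun u hu => by
    simpa using hK.norm_le_of_ne_zero hu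
  rw [← integrableOn_iff_integrable_of_support_subset hs]
  have : IsFiniteMeasure (volume.restrict (Metric.closedBall (0 : E d) d)) :=
    ⟨by simpa using measure_closedBall_lt_top⟩
  exact (hK.memLp_two.restrict _).integrable (by norm_num)

lemma exists_ae_bound (hK : IsKernel l K) : ∃ B : ℝ, 0 < B ∧ ∀ᵐ u, |K u| ≤ B := by
  have h := hK.bounded.2
  rw [eLpNorm_exponent_top] at h
  refine ⟨(eLpNormEssSup K volume).toReal + 1, by positivity, ?_⟩
  filter_upwards [enorm_ae_le_eLpNormEssSup K volume] with u hu
  have := ENNReal.toReal_mono h.ne hu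
  rw [toReal_enorm, Real.norm_eq_abs] at this
  linarith

lemma integrable_mul (hK : IsKernel l K) {F : Type*} [NormedAddCommGroup F] [NormedSpace ℝ F]
    {f : E d → F} (hf : Continuous f) :
    Integrable fun u => K u • f u := by
  obtain ⟨C, hC⟩ := (isCompact_closedBall (0 : E d) d).exists_bound_of_continuousOn hf.continuousOn
  refine (hK.integrable.norm.mul_const C).mono'
    (hK.integrable.aestronglyMeasurable.smul hf.aestronglyMeasurable) (ae_of_all _ fun u => ?_)
  rw [norm_smul]
  by_cases h : K u = 0
  · simp [h]
  · exact mul_le_mul_of_nonneg_left (hC u (by simpa using hK.norm_le_of_ne_zero h)) (norm_nonneg _)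

lemma prod_coord_eq_monomial {j : ℕ} (r : Fin j → Fin d) (u : E d) :
    ∏ k, u (r k) = monomial (fun i => (Finset.univ.filter fun k => r k = i).card) u := by
  unfold monomial
  have h := Finset.prod_fiberwise_of_maps_to (s := Finset.univ) (t := Finset.univ) (g := r)
    (fun i _ => Finset.mem_univ (r i)) fun k => u (r k)
  rw [← h]
  refine Finset.prod_congr rfl fun i _ => ?_
  rw [Finset.prod_congr rfl (g := fun _ => u i), Finset.prod_const]
  intro k hk
  rw [(Finset.mem_filter.1 hk).2]

lemma integral_multilinear_diag_eq_zero (hK : IsKernel l K) {j : ℕ} (hj1 : 1 ≤ j) (hjl : j ≤ l)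
    (A : ContinuousMultilinearMap ℝ (fun _ : Fin j => E d) ℝ) :
    ∫ u, K u * A (fun _ => u) = 0 := by
  simp_rw [multilinear_diag_eq_sum, Finset.mul_sum]
  rw [integral_finsetSum]
  · refine Finset.sum_eq_zero fun r _ => ?_
    have hc : ∑ i, (Finset.univ.filter fun k => r k = i).card = j := by
      rw [← Finset.card_eq_sum_card_fiberwise (f := r) (fun _ _ => Finset.mem_coe.2 (Finset.mem_univ _))]
      simp
    have h := hK.moments (fun i => (Finset.univ.filter fun k => r k = i).card)
      (by rw [hc]; exact hj1) (by rw [hc]; exact hjl)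
    have e : ∀ u : E d, K u * ((∏ k, u (r k)) * A fun k => EuclideanSpace.single (r k) 1) =
        (A fun k => EuclideanSpace.single (r k) 1) *
          (monomial (fun i => (Finset.univ.filter fun k => r k = i).card) u * K u) := fun u => by
      rw [prod_coord_eq_monomial]
      ring
    simp_rw [e]
    rw [integral_const_mul, h, mul_zero]
  · intro r _
    exact hK.integrable_mul (f := fun u : E d => (∏ k, u (r k)) *
      A fun k => EuclideanSpace.single (r k) 1) (by fun_prop)

lemma integral_mul_taylor (hK : IsKernel l K) (f : E d → ℝ) (y : E d) (h : ℝ) :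
    ∫ u, K u * ∑ k ∈ Finset.range (l + 1),
      (k.factorial : ℝ)⁻¹ * iteratedFDeriv ℝ k f y (fun _ => h • u) = f y := by
  have e : ∀ (k : ℕ) (u : E d), (k.factorial : ℝ)⁻¹ * iteratedFDeriv ℝ k f y (fun _ => h • u) =
      ((k.factorial : ℝ)⁻¹ * h ^ k) * iteratedFDeriv ℝ k f y (fun _ => u) := fun k u => by
    rw [(iteratedFDeriv ℝ k f y).map_smul_univ (fun _ => h) fun _ => u]
    simp
    ring
  simp_rw [e, Finset.mul_sum]
  have hint : ∀ k : ℕ, Integrable fun u : E d =>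
      K u * (((k.factorial : ℝ)⁻¹ * h ^ k) * iteratedFDeriv ℝ k f y (fun _ => u)) := fun k =>
    hK.integrable_mul (f := fun u : E d =>
      ((k.factorial : ℝ)⁻¹ * h ^ k) * iteratedFDeriv ℝ k f y (fun _ => u))
      (continuous_const.mul ((iteratedFDeriv ℝ k f y).cont.comp (by fun_prop)))
  rw [integral_finsetSum _ fun k _ => hint k]
  have e2 : ∀ k : ℕ, ∫ u, K u * (((k.factorial : ℝ)⁻¹ * h ^ k) *
      iteratedFDeriv ℝ k f y (fun _ => u)) = ((k.factorial : ℝ)⁻¹ * h ^ k) *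
        ∫ u, K u * iteratedFDeriv ℝ k f y (fun _ => u) := fun k => by
    rw [← integral_const_mul]
    exact integral_congr_ae (ae_of_all _ fun u => by simp only; ring)
  simp_rw [e2]
  rw [Finset.sum_eq_single_of_mem 0 (by simp)]
  · simp [integral_mul_const, hK.integral_eq_one]
  · intro k hk hk0
    rw [hK.integral_multilinear_diag_eq_zero (Nat.pos_of_ne_zero hk0)
      (by have := Finset.mem_range.1 hk; omega), mul_zero]

end IsKernel

lemma HolderClass.continuous {β L : ℝ} {f : E d → ℝ} (hf : HolderClass β L f) : Continuous f :=
  hf.2.1.continuous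

/-- The bias of kernel smoothing of order `⌊β⌋` on the Hölder class. -/
lemma abs_integral_kernel_mul_sub_le {β L : ℝ} (hβ : 1 ≤ ⌊β⌋₊) (hK : IsKernel ⌊β⌋₊ K)
    {f : E d → ℝ} (hf : HolderClass β L f) (hL : 0 ≤ L) {h : ℝ} (hh : 0 < h) (y : E d) :
    |(∫ u, K u * f (y - h • u)) - f y| ≤
      (d : ℝ) ^ ⌊β⌋₊ * L * (d : ℝ) ^ β * (∫ u, |K u|) * h ^ β := by
  have hβ0 : 0 ≤ β := by
    by_contra hc
    rw [Nat.floor_of_nonpos (by linarith)] at hβ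
    omega
  set S : E d → ℝ := fun u => ∑ k ∈ Finset.range (⌊β⌋₊ + 1),
      (k.factorial : ℝ)⁻¹ * iteratedFDeriv ℝ k f y (fun _ => (-h) • u) with hS
  have hSc : Continuous S := by
    refine continuous_finsetSum _ fun k _ => continuous_const.mul ?_
    exact (iteratedFDeriv ℝ k f y).cont.comp (by fun_prop)
  have hfc : Continuous fun u : E d => f (y - h • u) := hf.continuous.comp (by fun_prop)
  have i1 : Integrable fun u => K u * f (y - h • u) := hK.integrable_mul hfc
  have i2 : Integrable fun u => K u * S u := hK.integrable_mul hSc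
  have e : (∫ u, K u * f (y - h • u)) - f y = ∫ u, K u * (f (y - h • u) - S u) := by
    rw [← hK.integral_mul_taylor f y (-h), ← integral_sub i1 i2]
    simp_rw [mul_sub]
  rw [e, ← Real.norm_eq_abs]
  refine (norm_integral_le_integral_norm _).trans ?_
  have hb : ∀ u, ‖K u * (f (y - h • u) - S u)‖ ≤
      (d : ℝ) ^ ⌊β⌋₊ * L * (d : ℝ) ^ β * h ^ β * |K u| := by
    intro u
    rw [norm_mul, Real.norm_eq_abs, Real.norm_eq_abs]
    by_cases hu : K u = 0
    · simp [hu]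
    · have h1 := abs_sub_taylor_le hβ hf y ((-h) • u)
      have h2 : y + (-h) • u = y - h • u := by rw [neg_smul, sub_eq_add_neg]
      rw [h2] at h1
      have h3 : ‖(-h) • u‖ ^ β ≤ (d : ℝ) ^ β * h ^ β := by
        rw [norm_smul, norm_neg, Real.norm_eq_abs, abs_of_pos hh,
          Real.mul_rpow hh.le (norm_nonneg _), mul_comm]
        gcongr
        exact hK.norm_le_of_ne_zero hu
      have h4 : |f (y - h • u) - S u| ≤ (d : ℝ) ^ ⌊β⌋₊ * L * ((d : ℝ) ^ β * h ^ β) :=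
        h1.trans (mul_le_mul_of_nonneg_left h3 (by positivity))
      calc _ ≤ |K u| * ((d : ℝ) ^ ⌊β⌋₊ * L * ((d : ℝ) ^ β * h ^ β)) := by gcongr
        _ = _ := by ring
  calc _ ≤ ∫ u, (d : ℝ) ^ ⌊β⌋₊ * L * (d : ℝ) ^ β * h ^ β * |K u| :=
        integral_mono (hK.integrable_mul (hfc.sub hSc)).norm (hK.integrable.abs.const_mul _) hb
    _ = _ := by
      rw [integral_const_mul]
      ring

end Kernel

section ScaledKernel

variable {d : ℕ} {l : ℕ} {K : E d → ℝ} {h t : ℝ}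

/-- The rescaled kernel `h^{-d} K(·/h)`. -/
def scaledKernel (K : E d → ℝ) (h : ℝ) (u : E d) : ℝ := (h ^ d)⁻¹ * K (h⁻¹ • u)

lemma IsKernel.integrable_scaledKernel (hK : IsKernel l K) (hh : 0 < h) :
    Integrable (scaledKernel K h) :=
  (hK.integrable.comp_smul (inv_ne_zero hh.ne')).const_mul _

lemma integral_scaledKernel_smul {F : Type*} [NormedAddCommGroup F] [NormedSpace ℝ F]
    (hh : 0 < h) (f : E d → F) :
    ∫ u, scaledKernel K h u • f u = ∫ u, K u • f (h • u) := by
  have h1 := Measure.integral_comp_inv_smul_of_nonneg volume (fun u => K u • f (h • u)) hh.le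
  simp only [smul_inv_smul₀ hh.ne', finrank_euclideanSpace_fin] at h1
  unfold scaledKernel
  simp_rw [mul_smul]
  rw [integral_smul, h1, inv_smul_smul₀ (by positivity)]

lemma gaussianSmooth_scaledKernel (hh : 0 < h) (z : E d) :
    gaussianSmooth t (scaledKernel K h) z = ∫ u, K u * gaussianDensity d t (z - h • u) :=
  integral_scaledKernel_smul hh fun u => gaussianDensity d t (z - u)

lemma smoothPartial_scaledKernel (hh : 0 < h) (i : Fin d) (z : E d) :
    smoothPartial t (scaledKernel K h) i z = ∫ u, K u * gaussianPartial d t i (z - h • u) :=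
  integral_scaledKernel_smul hh fun u => gaussianPartial d t i (z - u)

lemma integrable_gaussianDensity_sub_smul (ht : 0 < t) (hh : 0 < h) (z : E d) :
    Integrable fun u => gaussianDensity d t (z - h • u) :=
  ((integrable_gaussianDensity ht).comp_sub_left z).comp_smul hh.ne'

lemma integral_gaussianDensity_sub_smul (ht : 0 < t) (hh : 0 < h) (z : E d) :
    ∫ u, gaussianDensity d t (z - h • u) = (h ^ d)⁻¹ := by
  have h1 := Measure.integral_comp_smul_of_nonneg volume (fun u => gaussianDensity d t (z - u)) h
    (hR := hh.le)
  rw [h1, integral_sub_left_eq_self (fun u => gaussianDensity d t u), integral_gaussianDensity ht]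
  simp

lemma abs_gaussianSmooth_scaledKernel_le {B : ℝ}
    (hB : ∀ᵐ u, |K u| ≤ B) (ht : 0 < t) (hh : 0 < h) (z : E d) :
    |gaussianSmooth t (scaledKernel K h) z| ≤ B * (h ^ d)⁻¹ := by
  rw [gaussianSmooth_scaledKernel hh, ← integral_gaussianDensity_sub_smul ht hh z,
    ← integral_const_mul, ← Real.norm_eq_abs]
  refine norm_integral_le_of_norm_le
    ((integrable_gaussianDensity_sub_smul ht hh z).const_mul B) ?_
  filter_upwards [hB] with u hu
  rw [norm_mul, Real.norm_eq_abs, Real.norm_eq_abs, abs_of_pos (gaussianDensity_pos ht _)]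
  exact mul_le_mul_of_nonneg_right hu (gaussianDensity_pos ht _).le

lemma ofReal_sq_integral_mul_le {α : Type*} [MeasurableSpace α] {μ : Measure α} {J w : α → ℝ}
    (hJ : AEStronglyMeasurable J μ) (hw : AEStronglyMeasurable w μ) (hw0 : ∀ x, 0 ≤ w x) :
    ENNReal.ofReal ((∫ x, J x * w x ∂μ) ^ 2) ≤
      (∫⁻ x, ENNReal.ofReal (J x ^ 2 * w x) ∂μ) * ∫⁻ x, ENNReal.ofReal (w x) ∂μ := by
  have h1 : ENNReal.ofReal |∫ x, J x * w x ∂μ| ≤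
      (∫⁻ x, ENNReal.ofReal (J x ^ 2 * w x) ∂μ) ^ (1 / 2 : ℝ) *
        (∫⁻ x, ENNReal.ofReal (w x) ∂μ) ^ (1 / 2 : ℝ) := by
    refine le_trans ?_ (ENNReal.lintegral_mul_norm_pow_le
      ((hJ.aemeasurable.pow_const 2).mul hw.aemeasurable).ennreal_ofReal
      hw.aemeasurable.ennreal_ofReal (by norm_num) (by norm_num) (by norm_num))
    rw [← Real.norm_eq_abs, ofReal_norm]
    refine (enorm_integral_le_lintegral_enorm _).trans (lintegral_mono fun x => ?_)
    simp only [Pi.mul_apply]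
    rw [ENNReal.ofReal_rpow_of_nonneg (mul_nonneg (sq_nonneg _) (hw0 x)) (by norm_num),
      ENNReal.ofReal_rpow_of_nonneg (hw0 x) (by norm_num), ← ENNReal.ofReal_mul
      (Real.rpow_nonneg (mul_nonneg (sq_nonneg _) (hw0 x)) _), ← ofReal_norm]
    refine ENNReal.ofReal_le_ofReal (le_of_eq ?_)
    rw [norm_mul, Real.norm_eq_abs, Real.norm_eq_abs, abs_of_nonneg (hw0 x),
      Real.mul_rpow (sq_nonneg _) (hw0 x), ← Real.sqrt_eq_rpow, ← Real.sqrt_eq_rpow, mul_assoc,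
      Real.mul_self_sqrt (hw0 x), Real.sqrt_sq_eq_abs]
  rw [← sq_abs, ENNReal.ofReal_pow (abs_nonneg _)]
  refine (pow_le_pow_left₀ zero_le h1 2).trans_eq ?_
  rw [mul_pow, ← ENNReal.rpow_mul_natCast, ← ENNReal.rpow_mul_natCast]
  norm_num

lemma lintegral_gaussianDensity_sub (ht : 0 < t) (v : E d) :
    ∫⁻ z, ENNReal.ofReal (gaussianDensity d t (z - v)) = 1 := by
  rw [← ofReal_integral_eq_lintegral_ofReal ((integrable_gaussianDensity ht).comp_sub_right v)
    (ae_of_all _ fun z => (gaussianDensity_pos ht _).le),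
    integral_sub_right_eq_self (fun u => gaussianDensity d t u), integral_gaussianDensity ht,
    ENNReal.ofReal_one]

/-- Young's inequality for `L²` functions smoothed by a rescaled Gaussian. -/
lemma lintegral_sq_gaussian_average_le (ht : 0 < t) (hh : 0 < h) {J : E d → ℝ}
    (hJ : AEStronglyMeasurable J) :
    ∫⁻ z : E d, ENNReal.ofReal ((∫ u, J u * gaussianDensity d t (z - h • u)) ^ 2) ≤
      ENNReal.ofReal (h ^ d)⁻¹ * ∫⁻ u, ENNReal.ofReal (J u ^ 2) := by
  have hm : Continuous fun p : E d × E d => gaussianDensity d t (p.1 - h • p.2) :=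
    continuous_gaussianDensity.comp (by fun_prop)
  calc _ ≤ ∫⁻ z : E d, (∫⁻ u, ENNReal.ofReal (J u ^ 2 * gaussianDensity d t (z - h • u))) *
          ENNReal.ofReal (h ^ d)⁻¹ := by
        refine lintegral_mono fun z => ?_
        refine (ofReal_sq_integral_mul_le hJ
          (continuous_gaussianDensity.comp (by fun_prop)).aestronglyMeasurable
          fun u => (gaussianDensity_pos ht _).le).trans_eq ?_
        simp only [Function.comp_apply]
        rw [← ofReal_integral_eq_lintegral_ofReal (integrable_gaussianDensity_sub_smul ht hh z)
          (ae_of_all _ fun z => (gaussianDensity_pos ht _).le),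
          integral_gaussianDensity_sub_smul ht hh]
    _ = ENNReal.ofReal (h ^ d)⁻¹ *
        ∫⁻ z : E d, ∫⁻ u, ENNReal.ofReal (J u ^ 2 * gaussianDensity d t (z - h • u)) := by
        rw [lintegral_mul_const' _ _ ENNReal.ofReal_ne_top, mul_comm]
    _ = ENNReal.ofReal (h ^ d)⁻¹ *
        ∫⁻ u, ∫⁻ z : E d, ENNReal.ofReal (J u ^ 2 * gaussianDensity d t (z - h • u)) := by
        rw [lintegral_lintegral_swap]
        exact ((hJ.comp_snd.aemeasurable.pow_const 2).mul hm.aemeasurable).ennreal_ofReal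
    _ = _ := by
        congr 1
        refine lintegral_congr fun u => ?_
        simp_rw [ENNReal.ofReal_mul (sq_nonneg (J u))]
        rw [lintegral_const_mul' _ _ ENNReal.ofReal_ne_top, lintegral_gaussianDensity_sub ht, mul_one]

lemma lintegral_sq_gaussianSmooth_scaledKernel_le (hK : IsKernel l K) (ht : 0 < t) (hh : 0 < h) :
    ∫⁻ z, ENNReal.ofReal (gaussianSmooth t (scaledKernel K h) z ^ 2) ≤
      ENNReal.ofReal (h ^ d)⁻¹ * ∫⁻ u, ENNReal.ofReal (K u ^ 2) := by
  simp_rw [gaussianSmooth_scaledKernel hh]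
  exact lintegral_sq_gaussian_average_le ht hh hK.integrable.aestronglyMeasurable

lemma fderiv_gaussianDensity_sub_smul (i : Fin d) (z u : E d) :
    fderiv ℝ (fun u => gaussianDensity d t (z - h • u)) u (EuclideanSpace.single i 1) =
      -(h * gaussianPartial d t i (z - h • u)) := by
  have h1 : HasFDerivAt (fun u : E d => z - h • u) (-(h • ContinuousLinearMap.id ℝ (E d))) u := by
    simpa using ((hasFDerivAt_id u).const_smul h).const_sub z
  have h2 := ((hasGradientAt_gaussianDensity (t := t) (z - h • u)).hasFDerivAt.comp u h1).fderiv
  have e : (gaussianDensity d t ∘ fun u : E d => z - h • u) =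
    fun u => gaussianDensity d t (z - h • u) := rfl
  rw [e] at h2
  rw [h2]
  simp [InnerProductSpace.toDual_apply_apply, gaussianGrad, EuclideanSpace.inner_single_right]

lemma contDiff_gaussianDensity : ContDiff ℝ ∞ (gaussianDensity d t) := by
  have e : gaussianDensity d t = fun x => 1 / (2 * Real.pi * t) ^ ((d : ℝ) / 2) *
      Real.exp (-(1 / (2 * t)) * ‖x‖ ^ 2) := funext gaussianDensity_eq
  rw [e]
  exact contDiff_const.mul (contDiff_const.mul (contDiff_norm_sq ℝ)).exp

lemma exists_smoothPartial_scaledKernel_eq (hK : IsKernel l K) {W : E d → E d}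
    (hW : HasWeakGradient K W) :
    ∃ χ : E d → ℝ, Continuous χ ∧ (∀ u, |χ u| ≤ 1) ∧ ∀ h t, 0 < h → ∀ (i : Fin d) (z : E d),
      smoothPartial t (scaledKernel K h) i z =
        ∫ u, (h⁻¹ * (W u i * χ u)) * gaussianDensity d t (z - h • u) := by
  let b : ContDiffBump (0 : E d) := ⟨d + 1, d + 2, by positivity, by linarith⟩
  refine ⟨b, b.continuous, fun u => ?_, fun h t hh i z => ?_⟩
  · rw [abs_of_nonneg b.nonneg]
    exact b.le_one
  rw [smoothPartial_scaledKernel hh]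
  have hθ : ContDiff ℝ ∞ fun u : E d => gaussianDensity d t (z - h • u) :=
    contDiff_gaussianDensity.comp (by fun_prop)
  have key := hW.2.2 (fun u => b u * gaussianDensity d t (z - h • u))
    (b.contDiff.mul hθ) (b.hasCompactSupport.mul_right) i
  have e1 : ∀ u, K u * fderiv ℝ (fun u => b u * gaussianDensity d t (z - h • u)) u
      (EuclideanSpace.single i 1) = (-h) * (K u * gaussianPartial d t i (z - h • u)) := by
    intro u
    by_cases hu : K u = 0
    · simp [hu]
    · have hball : u ∈ Metric.ball (0 : E d) b.rIn := by
        have := hK.norm_le_of_ne_zero hu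
        simp only [Metric.mem_ball, dist_zero_right]
        change ‖u‖ < (d : ℝ) + 1
        linarith
      have hev : (fun u => b u * gaussianDensity d t (z - h • u)) =ᶠ[nhds u]
          fun u => gaussianDensity d t (z - h • u) := by
        filter_upwards [Metric.isOpen_ball.mem_nhds hball] with y hy
        rw [b.one_of_mem_closedBall (Metric.ball_subset_closedBall hy), one_mul]
      rw [hev.fderiv_eq, fderiv_gaussianDensity_sub_smul]
      ring
  simp_rw [e1] at key
  rw [integral_const_mul] at key
  have e2 : ∀ u, (h⁻¹ * (W u i * b u)) * gaussianDensity d t (z - h • u) =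
      h⁻¹ * (W u i * (b u * gaussianDensity d t (z - h • u))) := fun u => by ring
  simp_rw [e2]
  rw [integral_const_mul, eq_inv_mul_iff_mul_eq₀ hh.ne']
  linarith

lemma lintegral_sq_smoothPartial_scaledKernel_le (hK : IsKernel l K) {W : E d → E d}
    (hW : HasWeakGradient K W) (ht : 0 < t) (hh : 0 < h) (i : Fin d) :
    ∫⁻ z, ENNReal.ofReal (smoothPartial t (scaledKernel K h) i z ^ 2) ≤
      ENNReal.ofReal ((h ^ d)⁻¹ * (h ^ 2)⁻¹) * ∫⁻ u, ENNReal.ofReal (‖W u‖ ^ 2) := by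
  obtain ⟨χ, hχc, hχ, he⟩ := exists_smoothPartial_scaledKernel_eq hK hW
  simp_rw [he h t hh i]
  have hWm : AEStronglyMeasurable (fun u => W u i) := by
    exact (EuclideanSpace.proj (𝕜 := ℝ) i).continuous.comp_aestronglyMeasurable
      hW.2.1.aestronglyMeasurable
  refine (lintegral_sq_gaussian_average_le ht hh
    ((hWm.mul hχc.aestronglyMeasurable).const_mul h⁻¹)).trans ?_
  rw [ENNReal.ofReal_mul (by positivity), mul_assoc]
  gcongr
  rw [← lintegral_const_mul' _ _ ENNReal.ofReal_ne_top]
  refine lintegral_mono fun u => ?_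
  rw [← ENNReal.ofReal_mul (by positivity)]
  refine ENNReal.ofReal_le_ofReal ?_
  simp only [Pi.mul_apply]
  rw [mul_pow, mul_pow, inv_pow]
  gcongr
  have h1 : W u i ^ 2 ≤ ‖W u‖ ^ 2 := by
    rw [← sq_abs]
    exact pow_le_pow_left₀ (abs_nonneg _) (PiLp.norm_apply_le (W u) i) 2
  have h2 : χ u ^ 2 ≤ 1 := by
    rw [← sq_abs]
    exact pow_le_one₀ (abs_nonneg _) (hχ u)
  calc W u i ^ 2 * χ u ^ 2 ≤ ‖W u‖ ^ 2 * 1 := by gcongr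
    _ = _ := mul_one _

end ScaledKernel

section Bias

variable {d : ℕ} {l : ℕ} {K : E d → ℝ} {h t : ℝ} {p : E d → ℝ}

lemma gaussianSmooth_eq_integral_sub (x : E d) :
    gaussianSmooth t p x = ∫ v, gaussianDensity d t v * p (x - v) := by
  rw [gaussianSmooth, ← integral_sub_left_eq_self (fun y => p y * gaussianDensity d t (x - y)) _ x]
  simp_rw [sub_sub_cancel]
  simp_rw [mul_comm]

lemma integral_mul_gaussianSmooth_scaledKernel (hK : IsKernel l K) (ht : 0 < t) (hh : 0 < h)
    (hp : Integrable p) (hpc : Continuous p) {C₂ : ℝ} (hpb : ∀ x, |p x| ≤ C₂) (x : E d) :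
    ∫ y, p y * gaussianSmooth t (scaledKernel K h) (x - y) =
      ∫ v, gaussianDensity d t v * ∫ u, K u * p (x - v - h • u) := by
  simp_rw [gaussianSmooth_scaledKernel hh, ← integral_const_mul]
  rw [integral_integral_swap]
  · have e : ∀ u, ∫ y, p y * (K u * gaussianDensity d t (x - y - h • u)) =
        ∫ v, gaussianDensity d t v * (K u * p (x - v - h • u)) := by
      intro u
      have h1 := gaussianSmooth_eq_integral_sub (t := t) (p := p) (x - h • u)
      rw [gaussianSmooth] at h1
      calc _ = K u * ∫ y, p y * gaussianDensity d t (x - h • u - y) := by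
            rw [← integral_const_mul]
            refine integral_congr_ae (ae_of_all _ fun y => ?_)
            simp only
            rw [sub_right_comm]
            ring
        _ = _ := by
            rw [h1, ← integral_const_mul]
            refine integral_congr_ae (ae_of_all _ fun y => ?_)
            simp only
            rw [sub_right_comm]
            ring
    simp_rw [e]
    rw [integral_integral_swap]
    have hi := hK.integrable.mul_prod (integrable_gaussianDensity (d := d) ht)
    have hb := hi.mul_bdd (c := C₂) (g := fun z : E d × E d => p (x - z.2 - h • z.1))
      (hpc.comp (by fun_prop)).aestronglyMeasurable (ae_of_all _ fun z => hpb _)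
    refine hb.congr (ae_of_all _ fun z => ?_)
    simp only [Function.uncurry]
    ring
  · have hi := hp.mul_prod hK.integrable
    have hb := hi.mul_bdd (c := gaussianDensity d t 0)
      (g := fun z : E d × E d => gaussianDensity d t (x - z.1 - h • z.2))
      (continuous_gaussianDensity.comp (by fun_prop)).aestronglyMeasurable (ae_of_all _ fun z => by
        rw [Real.norm_eq_abs, abs_of_pos (gaussianDensity_pos ht _)]
        exact gaussianDensity_le ht _)
    refine hb.congr (ae_of_all _ fun z => ?_)
    simp only [Function.uncurry]
    ring

/-- The smoothed kernel estimator has uniform bias of order `h^β`, uniformly in `t`. -/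
lemma abs_integral_mul_gaussianSmooth_scaledKernel_sub_le {β L : ℝ} (hβ : 1 ≤ ⌊β⌋₊)
    (hK : IsKernel ⌊β⌋₊ K) (hp : Integrable p) (hf : HolderClass β L p) (hL : 0 ≤ L)
    (ht : 0 < t) (hh : 0 < h) {C₂ : ℝ} (hpb : ∀ x, |p x| ≤ C₂) (x : E d) :
    |(∫ y, p y * gaussianSmooth t (scaledKernel K h) (x - y)) - gaussianSmooth t p x| ≤
      (d : ℝ) ^ ⌊β⌋₊ * L * (d : ℝ) ^ β * (∫ u, |K u|) * h ^ β := by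
  rw [integral_mul_gaussianSmooth_scaledKernel hK ht hh hp hf.continuous hpb,
    gaussianSmooth_eq_integral_sub]
  set A := (d : ℝ) ^ ⌊β⌋₊ * L * (d : ℝ) ^ β * (∫ u, |K u|) * h ^ β with hA
  have hpt : ∀ v, |(∫ u, K u * p (x - v - h • u)) - p (x - v)| ≤ A := fun v =>
    abs_integral_kernel_mul_sub_le hβ hK hf hL hh (x - v)
  have hφ := integrable_gaussianDensity (d := d) ht
  have i2 : Integrable fun v => gaussianDensity d t v * p (x - v) :=
    hφ.mul_bdd (hf.continuous.comp (by fun_prop)).aestronglyMeasurable (ae_of_all _ fun v => hpb _)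
  have hcont : Continuous fun v => ∫ u, K u * p (x - v - h • u) := by
    refine continuous_of_dominated (bound := fun u => |K u| * C₂) (fun v => ?_)
      (fun v => ae_of_all _ fun u => ?_) (hK.integrable.abs.mul_const _) (ae_of_all _ fun u => ?_)
    · exact hK.integrable.aestronglyMeasurable.mul
        (hf.continuous.comp (by fun_prop)).aestronglyMeasurable
    · rw [norm_mul]
      exact mul_le_mul_of_nonneg_left (hpb _) (norm_nonneg _)
    · exact continuous_const.mul (hf.continuous.comp (by fun_prop))
  have i3 : Integrable fun v => gaussianDensity d t v *
      ((∫ u, K u * p (x - v - h • u)) - p (x - v)) :=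
    hφ.mul_bdd (hcont.sub (hf.continuous.comp (by fun_prop))).aestronglyMeasurable
      (ae_of_all _ hpt)
  have i1 : Integrable fun v => gaussianDensity d t v * ∫ u, K u * p (x - v - h • u) := by
    refine (i3.add i2).congr (ae_of_all _ fun v => ?_)
    simp only [Pi.add_apply]
    ring
  rw [← integral_sub i1 i2]
  simp_rw [← mul_sub]
  rw [← Real.norm_eq_abs]
  refine (norm_integral_le_of_norm_le (hφ.mul_const A) (ae_of_all _ fun v => ?_)).trans_eq ?_
  · rw [norm_mul, Real.norm_eq_abs, Real.norm_eq_abs, abs_of_pos (gaussianDensity_pos ht _)]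
    exact mul_le_mul_of_nonneg_left (hpt v) (gaussianDensity_pos ht _).le
  · rw [integral_mul_const, integral_gaussianDensity ht, one_mul]

end Bias

section Fourier

open scoped FourierTransform

variable {d : ℕ}

/-- The complexification of a real function. -/
def toComplex (f : E d → ℝ) (x : E d) : ℂ := (f x : ℂ)

lemma Integrable.toComplex {f : E d → ℝ} (hf : Integrable f) : Integrable (toComplex f) := hf.ofReal

lemma fourier_toComplex (f : E d → ℝ) (w : E d) :
    𝓕 (toComplex f) w = fourierTransform f ((2 * Real.pi) • w) := by
  rw [Real.fourier_eq', fourierTransform]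
  refine integral_congr_ae (ae_of_all _ fun v => ?_)
  simp only [toComplex, smul_eq_mul, real_inner_smul_left, real_inner_comm w v]
  rw [mul_comm]
  congr 2
  push_cast
  ring

lemma norm_fourierTransform_le (f : E d → ℝ) (w : E d) : ‖fourierTransform f w‖ ≤ ∫ x, |f x| := by
  refine (norm_integral_le_integral_norm _).trans_eq ?_
  refine integral_congr_ae (ae_of_all _ fun x => ?_)
  simp only [norm_mul, Complex.norm_real, Real.norm_eq_abs]
  rw [Complex.norm_exp]
  simp

/-- Plancherel's identity for continuous integrable functions with integrable Fourier transform. -/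
lemma lintegral_norm_sq_fourier {f : E d → ℂ} (hc : Continuous f) (hf : Integrable f)
    (hf' : Integrable (𝓕 f)) :
    ∫⁻ x, ENNReal.ofReal (‖f x‖ ^ 2) = ∫⁻ w, ENNReal.ofReal (‖𝓕 f w‖ ^ 2) := by
  have hinv := hc.fourierInv_fourier_eq hf hf'
  have key : ∫ w, inner ℂ (𝓕 f w) (𝓕 f w) = ∫ x, inner ℂ (f x) (𝓕⁻ (𝓕 f) x) := by
    have := VectorFourier.integral_sesq_fourierIntegral_eq_neg_flip (innerSL ℂ (E := ℂ))
      (μ := (volume : Measure (E d))) (ν := (volume : Measure (E d))) (L := innerₗ (E d))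
      Real.continuous_fourierChar continuous_inner hf hf'
    simp only [flip_innerₗ, innerSL_apply_apply] at this
    exact this
  rw [hinv] at key
  have hbf : ∀ x, ‖f x‖ ≤ ∫ w, ‖𝓕 f w‖ := by
    intro x
    conv_lhs => rw [← hinv]
    rw [Real.fourierInv_eq]
    refine (norm_integral_le_integral_norm _).trans_eq ?_
    simp
  have hbF : ∀ w, ‖𝓕 f w‖ ≤ ∫ x, ‖f x‖ := by
    intro w
    rw [Real.fourier_eq]
    refine (norm_integral_le_integral_norm _).trans_eq ?_
    simp
  have i1 : Integrable fun x => ‖f x‖ ^ 2 := by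
    simp_rw [sq]
    exact hf.norm.mul_bdd hf.norm.aestronglyMeasurable (ae_of_all _ fun x => by simpa using hbf x)
  have i2 : Integrable fun w => ‖𝓕 f w‖ ^ 2 := by
    simp_rw [sq]
    exact hf'.norm.mul_bdd hf'.norm.aestronglyMeasurable (ae_of_all _ fun x => by simpa using hbF x)
  rw [← ofReal_integral_eq_lintegral_ofReal i1 (ae_of_all _ fun x => sq_nonneg _),
    ← ofReal_integral_eq_lintegral_ofReal i2 (ae_of_all _ fun x => sq_nonneg _)]
  congr 1
  simp only [inner_self_eq_norm_sq_to_K] at key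
  have e1 := integral_ofReal (𝕜 := ℂ) (f := fun w => ‖𝓕 f w‖ ^ 2) (μ := volume)
  have e2 := integral_ofReal (𝕜 := ℂ) (f := fun w => ‖f w‖ ^ 2) (μ := volume)
  push_cast at e1 e2
  have h3 := e2.symm.trans (key.symm.trans e1)
  exact_mod_cast h3

/-- Convolution of real functions. -/
def realConv (f g : E d → ℝ) (x : E d) : ℝ := ∫ y, f y * g (x - y)

lemma realConv_integrable {f g : E d → ℝ} (hf : Integrable f) (hg : Integrable g) :
    Integrable (realConv f g) :=
  hf.integrable_convolution (ContinuousLinearMap.mul ℝ ℝ) hg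

lemma fourier_realConv {f g : E d → ℝ} (hf : Integrable f) (hg : Integrable g) (w : E d) :
    𝓕 (toComplex (realConv f g)) w = 𝓕 (toComplex f) w * 𝓕 (toComplex g) w := by
  have h := Real.fourier_mul_convolution_eq (Integrable.toComplex hf) (Integrable.toComplex hg) w
  rw [← h]
  have e : toComplex (realConv f g) = MeasureTheory.convolution (toComplex f) (toComplex g)
      (ContinuousLinearMap.mul ℂ ℂ) volume := by
    funext x
    simp only [toComplex, realConv, MeasureTheory.convolution, ContinuousLinearMap.mul_apply']
    rw [← integral_complex_ofReal]
    push_cast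
    rfl
  rw [e]

lemma fourierTransform_realConv {f g : E d → ℝ} (hf : Integrable f) (hg : Integrable g) (w : E d) :
    fourierTransform (realConv f g) w = fourierTransform f w * fourierTransform g w := by
  have h := fourier_realConv hf hg ((2 * Real.pi)⁻¹ • w)
  simpa only [fourier_toComplex, smul_inv_smul₀ Real.two_pi_pos.ne'] using h

lemma norm_fourierTransform_gaussianDensity {t : ℝ} (ht : 0 < t) (w : E d) :
    ‖fourierTransform (gaussianDensity d t) w‖ = Real.exp (-(t / 2) * ‖w‖ ^ 2) := by
  have hb : (0 : ℝ) < 1 / (2 * t) := by positivity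
  have h := fourier_gaussian_innerProductSpace (V := E d) (b := ((1 / (2 * t) : ℝ) : ℂ))
    (by rw [Complex.ofReal_re]; exact hb) ((2 * Real.pi)⁻¹ • w)
  have e : toComplex (gaussianDensity d t) = fun v => ((1 / (2 * Real.pi * t) ^ ((d : ℝ) / 2) : ℝ) : ℂ) •
      Complex.exp (-((1 / (2 * t) : ℝ) : ℂ) * ‖v‖ ^ 2) := by
    funext v
    rw [toComplex, gaussianDensity_eq]
    push_cast
    rfl
  have h2 := fourier_toComplex (gaussianDensity d t) ((2 * Real.pi)⁻¹ • w)
  rw [smul_inv_smul₀ Real.two_pi_pos.ne'] at h2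
  rw [← h2, e, Real.fourier_eq]
  simp_rw [smul_comm _ (((1 / (2 * Real.pi * t) ^ ((d : ℝ) / 2) : ℝ) : ℂ))]
  rw [integral_smul, ← Real.fourier_eq, h, norm_smul, norm_mul, Complex.norm_exp]
  have h3 : ((Real.pi : ℂ) / ((1 / (2 * t) : ℝ) : ℂ)) ^ ((Module.finrank ℝ (E d) : ℂ) / 2) =
      (((2 * Real.pi * t) ^ ((d : ℝ) / 2) : ℝ) : ℂ) := by
    rw [finrank_euclideanSpace_fin, Complex.ofReal_cpow (by positivity)]
    congr 1
    · push_cast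
      field_simp
    · push_cast
      rfl
  rw [h3, Complex.norm_real, Complex.norm_real, Real.norm_of_nonneg (by positivity),
    Real.norm_of_nonneg (by positivity), ← mul_assoc, one_div_mul_cancel (by positivity), one_mul]
  congr 1
  rw [norm_smul, Real.norm_of_nonneg (by positivity)]
  have : (-(Real.pi : ℂ) ^ 2 * ((((2 * Real.pi)⁻¹ * ‖w‖ : ℝ) : ℂ)) ^ 2 / ((1 / (2 * t) : ℝ) : ℂ)) =
      ((-Real.pi ^ 2 * ((2 * Real.pi)⁻¹ * ‖w‖) ^ 2 / (1 / (2 * t)) : ℝ) : ℂ) := by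
    push_cast
    rfl
  rw [this, Complex.ofReal_re]
  have := Real.pi_pos
  field_simp

lemma norm_fourierTransform_gaussianPartial {t : ℝ} (ht : 0 < t) (i : Fin d) (w : E d) :
    ‖fourierTransform (gaussianPartial d t i) w‖ = |w i| * Real.exp (-(t / 2) * ‖w‖ ^ 2) := by
  have hd : ∀ x, HasFDerivAt (toComplex (gaussianDensity d t))
      (Complex.ofRealCLM.comp (InnerProductSpace.toDual ℝ (E d) (gaussianGrad d t x))) x := fun x =>
    Complex.ofRealCLM.hasFDerivAt.comp x (hasGradientAt_gaussianDensity x).hasFDerivAt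
  have hfd : fderiv ℝ (toComplex (gaussianDensity d t)) = fun x =>
      Complex.ofRealCLM.comp (InnerProductSpace.toDual ℝ (E d) (gaussianGrad d t x)) :=
    funext fun x => (hd x).fderiv
  have hcont : Continuous fun x =>
      Complex.ofRealCLM.comp (InnerProductSpace.toDual ℝ (E d) (gaussianGrad d t x)) :=
    continuous_const.clm_comp ((LinearIsometryEquiv.continuous _).comp continuous_gaussianGrad)
  have hint : Integrable (fderiv ℝ (toComplex (gaussianDensity d t))) := by
    rw [hfd]
    refine (integrable_finsetSum Finset.univ fun i _ =>
      (integrable_gaussianPartial ht i).abs).mono' hcont.aestronglyMeasurable (ae_of_all _ fun x => ?_)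
    have h1 : ‖gaussianGrad d t x‖ ≤ ∑ i, |gaussianPartial d t i x| := by
      conv_lhs => rw [← sum_smul_single (gaussianGrad d t x)]
      refine (norm_sum_le _ _).trans (Finset.sum_le_sum fun i _ => ?_)
      rw [norm_smul]
      simp [gaussianGrad]
    refine (ContinuousLinearMap.opNorm_comp_le _ _).trans ?_
    rw [LinearIsometryEquiv.norm_map]
    simpa using h1
  have key := Real.fourier_fderiv (Integrable.toComplex (integrable_gaussianDensity (d := d) ht))
    (fun x => (hd x).differentiableAt) hint
  have k1 := congrArg (fun L : E d →L[ℝ] ℂ => L (EuclideanSpace.single i 1))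
    (congrFun key ((2 * Real.pi)⁻¹ • w))
  rw [Real.fourier_continuousLinearMap_apply hint] at k1
  have e1 : (fun x => fderiv ℝ (toComplex (gaussianDensity d t)) x (EuclideanSpace.single i 1)) =
      toComplex (gaussianPartial d t i) := by
    funext x
    rw [hfd]
    simp [toComplex, InnerProductSpace.toDual_apply_apply, gaussianGrad,
      EuclideanSpace.inner_single_right]
  rw [e1, fourier_toComplex, smul_inv_smul₀ Real.two_pi_pos.ne', VectorFourier.fourierSMulRight_apply,
    fourier_toComplex, smul_inv_smul₀ Real.two_pi_pos.ne'] at k1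
  rw [k1, norm_smul, norm_smul, norm_fourierTransform_gaussianDensity ht, ← mul_assoc]
  congr 1
  have := Real.pi_pos
  simp [abs_of_pos this]
  field_simp
  rw [innerSL_apply_apply]
  simp [EuclideanSpace.inner_single_right]

end Fourier

section KernelFourier

variable {d : ℕ} {l : ℕ} {K : E d → ℝ}

lemma IsKernel.integral_inner_pow_eq_zero (hK : IsKernel l K) {j : ℕ} (hj : 1 ≤ j) (hjl : j ≤ l)
    (w : E d) : ∫ u, K u * (inner ℝ w u) ^ j = 0 := by
  have := hK.integral_multilinear_diag_eq_zero hj hjl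
    ((ContinuousMultilinearMap.mkPiAlgebra ℝ (Fin j) ℝ).compContinuousLinearMap
      fun _ => innerSL ℝ w)
  simpa using this

lemma IsKernel.integral_cpow_eq_zero (hK : IsKernel l K) {j : ℕ} (hj : 1 ≤ j) (hjl : j ≤ l)
    (w : E d) : ∫ u, (K u : ℂ) * (-(Complex.I * ((inner ℝ w u : ℝ) : ℂ))) ^ j = 0 := by
  have h := congrArg (fun r : ℝ => (-Complex.I) ^ j * (r : ℂ)) (hK.integral_inner_pow_eq_zero hj hjl w)
  simp only [Complex.ofReal_zero, mul_zero] at h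
  rw [← integral_complex_ofReal, ← integral_const_mul] at h
  rw [← h]
  refine integral_congr_ae (ae_of_all _ fun u => ?_)
  simp only
  rw [← neg_mul, mul_pow]
  push_cast
  ring

/-- The Fourier transform of a kernel of order `⌊β⌋` is `1 + O(‖ω‖^{β-1})`. -/
lemma IsKernel.exists_norm_fourierTransform_sub_one_le {β : ℝ} (hβ : 1 < β)
    (hK : IsKernel ⌊β⌋₊ K) :
    ∃ C : ℝ, 0 < C ∧ ∀ w : E d, ‖fourierTransform K w - 1‖ ≤ C * ‖w‖ ^ (β - 1) := by
  set A : ℝ := ∫ u, |K u| with hA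
  have hA0 : 0 ≤ A := integral_nonneg fun _ => abs_nonneg _
  set m := ⌊β⌋₊ with hm
  have hm1 : 1 ≤ m := Nat.le_floor (by simpa using hβ.le)
  have hmβ : β - 1 ≤ m := by
    have := (Nat.lt_floor_add_one β).le
    linarith
  have hd0 : (0 : ℝ) ≤ d := d.cast_nonneg
  refine ⟨A + 1 + A * ((d : ℝ) ^ m * Real.exp d), by positivity, fun w => ?_⟩
  rcases le_total 1 ‖w‖ with hw | hw
  · have h1 : ‖fourierTransform K w - 1‖ ≤ A + 1 :=
      (norm_sub_le _ _).trans (by simpa using norm_fourierTransform_le K w)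
    have h2 : 1 ≤ ‖w‖ ^ (β - 1) := Real.one_le_rpow hw (by linarith)
    calc _ ≤ (A + 1) * 1 := by linarith
      _ ≤ _ := by
        have : 0 ≤ A * ((d : ℝ) ^ m * Real.exp d) := by positivity
        exact mul_le_mul (by linarith) h2 zero_le_one (by linarith)
  · set P : E d → ℂ := fun u => ∑ j ∈ Finset.range m,
      (-(Complex.I * ((inner ℝ w u : ℝ) : ℂ))) ^ j / (j.factorial : ℂ) with hP
    have hcont : Continuous fun u : E d => -(Complex.I * ((inner ℝ w u : ℝ) : ℂ)) := by fun_prop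
    have ij : ∀ j : ℕ, Integrable fun u : E d => (K u : ℂ) *
        ((-(Complex.I * ((inner ℝ w u : ℝ) : ℂ))) ^ j / (j.factorial : ℂ)) := fun j =>
      hK.integrable_mul (F := ℂ) (f := fun u : E d =>
        ((-(Complex.I * ((inner ℝ w u : ℝ) : ℂ))) ^ j / (j.factorial : ℂ))) (by fun_prop)
    have hPint : ∫ u, (K u : ℂ) * P u = 1 := by
      simp only [hP, Finset.mul_sum]
      rw [integral_finsetSum _ fun j _ => ij j, Finset.sum_eq_single_of_mem 0 (Finset.mem_range.2 hm1)]
      · simp only [pow_zero, Nat.factorial_zero, Nat.cast_one, div_one, mul_one]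
        rw [integral_complex_ofReal, hK.integral_eq_one, Complex.ofReal_one]
      · intro j hj hj0
        simp_rw [← mul_div_assoc]
        rw [integral_div, hK.integral_cpow_eq_zero (Nat.pos_of_ne_zero hj0)
          (Finset.mem_range.1 hj).le, zero_div]
    have iP : Integrable fun u => (K u : ℂ) * P u := by
      simp only [hP, Finset.mul_sum]
      exact integrable_finsetSum _ fun j _ => ij j
    have iE : Integrable fun u : E d =>
        (K u : ℂ) * Complex.exp (-(Complex.I * ((inner ℝ w u : ℝ) : ℂ))) :=
      hK.integrable_mul (F := ℂ)
        (f := fun u : E d => Complex.exp (-(Complex.I * ((inner ℝ w u : ℝ) : ℂ)))) (by fun_prop)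
    have e : fourierTransform K w - 1 = ∫ u, (K u : ℂ) *
        (Complex.exp (-(Complex.I * ((inner ℝ w u : ℝ) : ℂ))) - P u) := by
      rw [← hPint, fourierTransform, ← integral_sub iE iP]
      simp_rw [mul_sub]
    have hw' : ‖w‖ ^ (m : ℝ) ≤ ‖w‖ ^ (β - 1) :=
      Real.rpow_le_rpow_of_exponent_ge' (norm_nonneg _) hw (by linarith) hmβ
    rw [Real.rpow_natCast] at hw'
    rw [e]
    refine (norm_integral_le_of_norm_le (hK.integrable.abs.mul_const
      (((d : ℝ) ^ m * Real.exp d) * ‖w‖ ^ m)) (ae_of_all _ fun u => ?_)).trans ?_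
    · rw [norm_mul, Complex.norm_real, Real.norm_eq_abs]
      by_cases hu : K u = 0
      · simp [hu]
      · refine mul_le_mul_of_nonneg_left ?_ (abs_nonneg _)
        refine (Complex.norm_exp_sub_sum_le_norm_mul_exp _ m).trans ?_
        have h1 : ‖-(Complex.I * ((inner ℝ w u : ℝ) : ℂ))‖ ≤ d * ‖w‖ := by
          rw [norm_neg, norm_mul, Complex.norm_I, one_mul, Complex.norm_real]
          refine (norm_inner_le_norm w u).trans ?_
          rw [mul_comm]
          gcongr
          exact hK.norm_le_of_ne_zero hu
        have h2 : ‖-(Complex.I * ((inner ℝ w u : ℝ) : ℂ))‖ ≤ d :=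
          h1.trans (mul_le_of_le_one_right hd0 hw)
        calc _ ≤ (d * ‖w‖) ^ m * Real.exp d := by gcongr
          _ = _ := by ring
    · rw [integral_mul_const, ← hA]
      calc A * ((d : ℝ) ^ m * Real.exp d * ‖w‖ ^ m)
          ≤ A * ((d : ℝ) ^ m * Real.exp d * ‖w‖ ^ (β - 1)) := by gcongr
        _ ≤ _ := by
          have : 0 ≤ (A + 1) * ‖w‖ ^ (β - 1) := by positivity
          linarith

lemma fourierTransform_scaledKernel {h : ℝ} (hh : 0 < h) (w : E d) :
    fourierTransform (scaledKernel K h) w = fourierTransform K (h • w) := by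
  have := integral_scaledKernel_smul (K := K) hh
    fun x => Complex.exp (-(Complex.I * ((inner ℝ w x : ℝ) : ℂ)))
  simp only [Complex.real_smul, inner_smul_right] at this
  simp only [fourierTransform, real_inner_smul_left, this]

end KernelFourier

section GradientBias

open scoped FourierTransform

variable {d : ℕ} {K : E d → ℝ} {p : E d → ℝ} {h t β L : ℝ}

lemma continuous_fourier_toComplex {f : E d → ℝ} (hf : Integrable f) :
    Continuous (𝓕 (toComplex f)) :=
  VectorFourier.fourierIntegral_continuous Real.continuous_fourierChar continuous_inner
    (Integrable.toComplex hf)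

lemma continuous_fourierTransform {f : E d → ℝ} (hf : Integrable f) :
    Continuous (fourierTransform f) := by
  have h : fourierTransform f = fun w => 𝓕 (toComplex f) ((2 * Real.pi)⁻¹ • w) := by
    funext w
    rw [fourier_toComplex, smul_inv_smul₀ Real.two_pi_pos.ne']
  rw [h]
  exact (continuous_fourier_toComplex hf).comp (by fun_prop)

lemma fourierTransform_sub {f g : E d → ℝ} (hf : Integrable f) (hg : Integrable g) (w : E d) :
    fourierTransform (fun x => f x - g x) w = fourierTransform f w - fourierTransform g w := by
  have hb : ∀ {f : E d → ℝ}, Integrable f → Integrable fun x =>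
      (f x : ℂ) * Complex.exp (-(Complex.I * ((inner ℝ w x : ℝ) : ℂ))) := fun hf => by
    refine (Integrable.toComplex hf).mul_bdd (c := 1)
      (Continuous.aestronglyMeasurable (by fun_prop)) (ae_of_all _ fun x => ?_)
    rw [Complex.norm_exp]
    simp
  unfold fourierTransform
  rw [← integral_sub (hb hf) (hb hg)]
  refine integral_congr_ae (ae_of_all _ fun x => ?_)
  simp only
  push_cast
  ring

lemma lintegral_comp_smul {r : ℝ} (hr : 0 < r) (f : E d → ℝ≥0∞) :
    ∫⁻ x, f (r • x) = ENNReal.ofReal (r ^ d)⁻¹ * ∫⁻ x, f x := by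
  have e := (Homeomorph.smulOfNeZero (α := E d) r hr.ne').measurableEmbedding.lintegral_map
    (μ := volume) f
  have e2 : ⇑(Homeomorph.smulOfNeZero (α := E d) r hr.ne') = fun x => r • x := rfl
  rw [e2] at e
  rw [← e, Measure.map_addHaar_smul _ hr.ne', lintegral_smul_measure, finrank_euclideanSpace_fin,
    abs_of_pos (by positivity)]
  rfl

lemma continuous_realConv {f g : E d → ℝ} (hf : Integrable f) (hg : Continuous g) {C : ℝ}
    (hC : ∀ x, |g x| ≤ C) : Continuous (realConv f g) := by
  refine continuous_of_dominated (bound := fun y => |f y| * C) (fun x => ?_)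
    (fun x => ae_of_all _ fun y => ?_) (hf.abs.mul_const _) (ae_of_all _ fun y => ?_)
  · exact hf.aestronglyMeasurable.mul (hg.comp (by fun_prop)).aestronglyMeasurable
  · rw [norm_mul]
    exact mul_le_mul_of_nonneg_left (hC _) (norm_nonneg _)
  · exact continuous_const.mul (hg.comp (by fun_prop))

lemma integrable_abs_coord_mul_exp (ht : 0 < t) (i : Fin d) :
    Integrable fun w : E d => |w i| * Real.exp (-(t / 2) * ‖w‖ ^ 2) := by
  have ht' : (0 : ℝ) < 1 / t := by positivity
  have h := ((integrable_gaussianPartial (d := d) ht' i).abs).const_mul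
    ((1 / t) * (2 * Real.pi * (1 / t)) ^ ((d : ℝ) / 2))
  refine h.congr (ae_of_all _ fun w => ?_)
  have : (0 : ℝ) < (2 * Real.pi * (1 / t)) ^ ((d : ℝ) / 2) := by positivity
  have e : -(1 / (2 * (1 / t))) = -(t / 2) := by field_simp
  simp only
  rw [gaussianPartial, gaussianDensity_eq, abs_mul, abs_neg, abs_div, abs_of_pos ht', abs_mul,
    abs_of_pos (Real.exp_pos _), abs_of_pos (one_div_pos.2 this), e]
  field_simp

lemma norm_rpow_sq_le_sum (hβ : 0 < β) (w : E d) :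
    (‖w‖ ^ β) ^ 2 ≤ ((d : ℝ) ^ β) ^ 2 * ∑ j, (|w j| ^ β) ^ 2 := by
  rcases Nat.eq_zero_or_pos d with hd | hd
  · subst hd
    have hw : w = 0 := Subsingleton.elim _ _
    simp [hw, Real.zero_rpow hβ.ne']
  have : Nonempty (Fin d) := ⟨⟨0, hd⟩⟩
  obtain ⟨j, -, hj⟩ := Finset.exists_max_image Finset.univ (fun j => |w j|) Finset.univ_nonempty
  have h1 : ‖w‖ ≤ d * |w j| := by
    conv_lhs => rw [← sum_smul_single w]
    refine (norm_sum_le _ _).trans ?_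
    calc _ ≤ ∑ _i : Fin d, |w j| := Finset.sum_le_sum fun i hi => by
          rw [norm_smul]
          simpa using hj i hi
      _ = _ := by simp
  have h2 : ‖w‖ ^ β ≤ (d : ℝ) ^ β * |w j| ^ β := by
    rw [← Real.mul_rpow (by positivity) (abs_nonneg _)]
    exact Real.rpow_le_rpow (norm_nonneg _) h1 hβ.le
  calc (‖w‖ ^ β) ^ 2 ≤ ((d : ℝ) ^ β * |w j| ^ β) ^ 2 := by gcongr
    _ = ((d : ℝ) ^ β) ^ 2 * (|w j| ^ β) ^ 2 := by ring
    _ ≤ _ := by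
      gcongr
      exact Finset.single_le_sum (f := fun j => (|w j| ^ β) ^ 2) (fun _ _ => sq_nonneg _)
        (Finset.mem_univ j)

lemma SobolevClass.lintegral_norm_rpow_le (hβ : 0 < β) (hp : SobolevClass β L p) :
    ∫⁻ w, ENNReal.ofReal ((‖w‖ ^ β) ^ 2 * ‖fourierTransform p w‖ ^ 2) ≤
      ENNReal.ofReal (((d : ℝ) ^ β) ^ 2 * d * ((2 * Real.pi) ^ d * L ^ 2)) := by
  have hm : Continuous (fourierTransform p) := continuous_fourierTransform hp.1.1
  have hj : ∀ j : Fin d, ∫⁻ w : E d, ENNReal.ofReal ((|w j| ^ β) ^ 2 * ‖fourierTransform p w‖ ^ 2) ≤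
      ENNReal.ofReal ((2 * Real.pi) ^ d * L ^ 2) := by
    intro j
    have h := hp.2 (fun i => if i = j then β else 0) (fun i => by split_ifs <;> simp [hβ.le])
      (by simp)
    refine le_trans (le_of_eq (lintegral_congr fun w => ?_)) h
    congr 3
    rw [Finset.prod_eq_single j]
    · simp
    · intro b _ hb
      simp [hb]
    · simp
  calc _ ≤ ∫⁻ w : E d, ENNReal.ofReal (((d : ℝ) ^ β) ^ 2) *
        ∑ j, ENNReal.ofReal ((|w j| ^ β) ^ 2 * ‖fourierTransform p w‖ ^ 2) := by
        refine lintegral_mono fun w => ?_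
        rw [← ENNReal.ofReal_sum_of_nonneg fun _ _ => by positivity, ← Finset.sum_mul,
          ← ENNReal.ofReal_mul (by positivity), ← mul_assoc]
        refine ENNReal.ofReal_le_ofReal (mul_le_mul_of_nonneg_right ?_ (sq_nonneg _))
        exact norm_rpow_sq_le_sum hβ w
    _ = ENNReal.ofReal (((d : ℝ) ^ β) ^ 2) *
        ∑ j, ∫⁻ w : E d, ENNReal.ofReal ((|w j| ^ β) ^ 2 * ‖fourierTransform p w‖ ^ 2) := by
        rw [lintegral_const_mul' _ _ ENNReal.ofReal_ne_top, lintegral_finsetSum']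
        intro j _
        refine (AEMeasurable.mul (Measurable.aemeasurable ?_)
          (hm.norm.pow 2).aemeasurable).ennreal_ofReal
        exact ((EuclideanSpace.proj (𝕜 := ℝ) j).continuous.measurable.abs.pow_const β).pow_const 2
    _ ≤ ENNReal.ofReal (((d : ℝ) ^ β) ^ 2) *
        ∑ _j : Fin d, ENNReal.ofReal ((2 * Real.pi) ^ d * L ^ 2) := by
        gcongr with j
        exact hj j
    _ = _ := by
        rw [Finset.sum_const, Finset.card_univ, Fintype.card_fin, nsmul_eq_mul,
          ← ENNReal.ofReal_natCast, ← ENNReal.ofReal_mul (by positivity),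
          ← ENNReal.ofReal_mul (by positivity), mul_assoc]

/-- The gradient of the smoothed kernel estimator has `L²` bias of order `h^{β-1}`. -/
lemma exists_lintegral_gradient_bias_le (hβ : 1 < β) (L : ℝ) (hK : IsKernel ⌊β⌋₊ K) :
    ∃ C : ℝ, 0 ≤ C ∧ ∀ p : E d → ℝ, SobolevClass β L p → ∀ h t, 0 < h → 0 < t → ∀ i,
      ∫⁻ x, ENNReal.ofReal (((∫ y, p y * smoothPartial t (scaledKernel K h) i (x - y))
        - smoothPartial t p i x) ^ 2) ≤ ENNReal.ofReal (C * (h ^ (β - 1)) ^ 2) := by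
  obtain ⟨C, hC, hKF⟩ := hK.exists_norm_fourierTransform_sub_one_le hβ
  refine ⟨C ^ 2 * (((d : ℝ) ^ β) ^ 2 * d * L ^ 2), by positivity, fun p hp h t hh ht i => ?_⟩
  have hpi := hp.1.1
  have hKh := hK.integrable_scaledKernel hh
  have hψ := integrable_gaussianPartial (d := d) ht i
  have hD : Integrable (smoothPartial t (scaledKernel K h) i) := realConv_integrable hKh hψ
  set g : E d → ℝ := fun z => smoothPartial t (scaledKernel K h) i z - gaussianPartial d t i z
    with hg
  have hgi : Integrable g := hD.sub hψ
  have hgc : Continuous g := (continuous_smoothPartial ht hKh i).sub (continuous_gaussianPartial i)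
  obtain ⟨c₁, hc₁⟩ := exists_abs_smoothPartial_le ht hKh i
  obtain ⟨c₂, -, hc₂⟩ := exists_forall_abs_gaussianPartial_le (d := d) ht
  have hgb : ∀ x, |g x| ≤ c₁ + c₂ := fun x =>
    (abs_sub _ _).trans (add_le_add (hc₁ x) (hc₂ i x))
  have hB : ∀ x, (∫ y, p y * smoothPartial t (scaledKernel K h) i (x - y))
      - smoothPartial t p i x = realConv p g x := by
    intro x
    rw [smoothPartial.eq_def t p i x, ← integral_sub]
    · simp_rw [← mul_sub]
      rfl
    · exact hpi.mul_bdd (c := c₁) ((continuous_smoothPartial ht hKh i).comp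
        (by fun_prop)).aestronglyMeasurable (ae_of_all _ fun y => hc₁ _)
    · exact integrable_mul_gaussianPartial ht hpi i x
  have hFg : ∀ w, fourierTransform g w =
      (fourierTransform K (h • w) - 1) * fourierTransform (gaussianPartial d t i) w := by
    intro w
    rw [hg, fourierTransform_sub hD hψ]
    have : fourierTransform (smoothPartial t (scaledKernel K h) i) w =
        fourierTransform (scaledKernel K h) w * fourierTransform (gaussianPartial d t i) w :=
      fourierTransform_realConv hKh hψ w
    rw [this, fourierTransform_scaledKernel hh]
    ring
  have hnorm : ∀ w, ‖fourierTransform (realConv p g) w‖ = ‖fourierTransform p w‖ *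
      (‖fourierTransform K (h • w) - 1‖ * (|w i| * Real.exp (-(t / 2) * ‖w‖ ^ 2))) := by
    intro w
    rw [fourierTransform_realConv hpi hgi, hFg, norm_mul, norm_mul,
      norm_fourierTransform_gaussianPartial ht]
  have hBi : Integrable (realConv p g) := realConv_integrable hpi hgi
  have hFi : Integrable (𝓕 (toComplex (realConv p g))) := by
    have h1 := (((integrable_abs_coord_mul_exp ht i).comp_smul
      Real.two_pi_pos.ne').const_mul ((∫ u, |K u|) + 1)).const_mul (∫ x, |p x|)
    refine h1.mono' (continuous_fourier_toComplex hBi).aestronglyMeasurable (ae_of_all _ fun w => ?_)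
    rw [fourier_toComplex, hnorm]
    have h2 : ‖fourierTransform K (h • (2 * Real.pi) • w) - 1‖ ≤ (∫ u, |K u|) + 1 :=
      (norm_sub_le _ _).trans (by simpa using norm_fourierTransform_le K _)
    have h3 := norm_fourierTransform_le p ((2 * Real.pi) • w)
    gcongr
  have hBc : Continuous (toComplex (realConv p g)) :=
    Complex.continuous_ofReal.comp (continuous_realConv hpi hgc hgb)
  have hpl := lintegral_norm_sq_fourier hBc (Integrable.toComplex hBi) hFi
  simp_rw [hB]
  have e0 : ∀ x, ENNReal.ofReal (realConv p g x ^ 2) =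
      ENNReal.ofReal (‖toComplex (realConv p g) x‖ ^ 2) := fun x => by
    rw [toComplex, Complex.norm_real, Real.norm_eq_abs, sq_abs]
  simp_rw [e0]
  rw [hpl]
  simp_rw [fourier_toComplex]
  rw [lintegral_comp_smul Real.two_pi_pos fun w =>
    ENNReal.ofReal (‖fourierTransform (realConv p g) w‖ ^ 2)]
  have hpt : ∀ w, ‖fourierTransform (realConv p g) w‖ ^ 2 ≤
      (C * h ^ (β - 1)) ^ 2 * ((‖w‖ ^ β) ^ 2 * ‖fourierTransform p w‖ ^ 2) := by
    intro w
    have h1 : ‖fourierTransform K (h • w) - 1‖ * (|w i| * Real.exp (-(t / 2) * ‖w‖ ^ 2)) ≤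
        C * h ^ (β - 1) * ‖w‖ ^ β := by
      have h2 := hKF (h • w)
      rw [norm_smul, Real.norm_of_nonneg hh.le, Real.mul_rpow hh.le (norm_nonneg _)] at h2
      have h3 : |w i| * Real.exp (-(t / 2) * ‖w‖ ^ 2) ≤ ‖w‖ := by
        have h4 : Real.exp (-(t / 2) * ‖w‖ ^ 2) ≤ 1 := Real.exp_le_one_iff.2 (by
          have : 0 ≤ (t / 2) * ‖w‖ ^ 2 := by positivity
          linarith)
        have h5 : |w i| ≤ ‖w‖ := PiLp.norm_apply_le w i
        calc _ ≤ ‖w‖ * 1 := by gcongr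
          _ = _ := mul_one _
      calc _ ≤ C * (h ^ (β - 1) * ‖w‖ ^ (β - 1)) * ‖w‖ := by gcongr
        _ = C * h ^ (β - 1) * (‖w‖ ^ (β - 1) * ‖w‖) := by ring
        _ = _ := by
          rw [← Real.rpow_add_one' (norm_nonneg _) (by linarith), sub_add_cancel]
    rw [hnorm]
    calc _ ≤ (‖fourierTransform p w‖ * (C * h ^ (β - 1) * ‖w‖ ^ β)) ^ 2 := by gcongr
      _ = _ := by ring
  calc _ ≤ ENNReal.ofReal ((2 * Real.pi) ^ d)⁻¹ * ∫⁻ w, ENNReal.ofReal ((C * h ^ (β - 1)) ^ 2) *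
        ENNReal.ofReal ((‖w‖ ^ β) ^ 2 * ‖fourierTransform p w‖ ^ 2) := by
        gcongr with w
        rw [← ENNReal.ofReal_mul (by positivity)]
        exact ENNReal.ofReal_le_ofReal (hpt w)
    _ ≤ ENNReal.ofReal ((2 * Real.pi) ^ d)⁻¹ * (ENNReal.ofReal ((C * h ^ (β - 1)) ^ 2) *
        ENNReal.ofReal (((d : ℝ) ^ β) ^ 2 * d * ((2 * Real.pi) ^ d * L ^ 2))) := by
        rw [lintegral_const_mul' _ _ ENNReal.ofReal_ne_top]
        gcongr
        exact hp.lintegral_norm_rpow_le (by linarith)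
    _ = _ := by
        rw [← ENNReal.ofReal_mul (by positivity), ← ENNReal.ofReal_mul (by positivity)]
        congr 1
        have := Real.two_pi_pos
        field_simp

end GradientBias

section Score

variable {d : ℕ} {p : E d → ℝ} {t k M : ℝ}

lemma measurable_score (p : E d → ℝ) : Measurable (score p) :=
  (LinearIsometryEquiv.continuous _).measurable.comp (measurable_fderiv ℝ _)

lemma fderiv_single_eq_score_mul (hp : Differentiable ℝ p) (hp0 : ∀ x, 0 ≤ p x) (i : Fin d)
    (y : E d) : fderiv ℝ p y (EuclideanSpace.single i 1) = score p y i * p y := by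
  rcases (hp0 y).eq_or_lt with h | h
  · have hmin : IsLocalMin p y := Filter.Eventually.of_forall fun x => by rw [← h]; exact hp0 x
    rw [hmin.fderiv_eq_zero, ← h]
    simp
  · have hg : HasGradientAt (fun y => Real.log (p y)) (score p y) y :=
      DifferentiableAt.hasGradientAt ((hp y).log h.ne')
    have h1 := ((hp y).hasFDerivAt.log h.ne').fderiv
    have h2 := hg.hasFDerivAt.fderiv
    have h3 := congrArg (fun L : E d →L[ℝ] ℝ => L (EuclideanSpace.single i 1)) (h1.symm.trans h2)
    simp only [_root_.smul_apply, smul_eq_mul,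
      InnerProductSpace.toDual_apply_apply, EuclideanSpace.inner_single_right] at h3
    simp only [one_mul, RCLike.conj_to_real] at h3
    rw [← h3]
    field_simp

lemma norm_score_mul_le (hp0 : ∀ x, 0 ≤ p x) (hk : 1 ≤ k) (y : E d) :
    ‖score p y‖ * p y ≤ p y + ‖score p y‖ ^ (2 * k) * p y := by
  have h : ‖score p y‖ ≤ 1 + ‖score p y‖ ^ (2 * k) := by
    rcases le_total ‖score p y‖ 1 with h | h
    · have : 0 ≤ ‖score p y‖ ^ (2 * k) := by positivity
      linarith
    · have : ‖score p y‖ ^ (1 : ℝ) ≤ ‖score p y‖ ^ (2 * k) :=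
        Real.rpow_le_rpow_of_exponent_le h (by linarith)
      rw [Real.rpow_one] at this
      linarith
  calc _ ≤ (1 + ‖score p y‖ ^ (2 * k)) * p y := mul_le_mul_of_nonneg_right h (hp0 y)
    _ = _ := by ring

lemma integrable_fderiv_single (hp : IsDensity p) (hpc : ContDiff ℝ 1 p) (hk : 1 ≤ k)
    (hM : ScoreMomentBound k M p) (i : Fin d) :
    Integrable fun y => fderiv ℝ p y (EuclideanSpace.single i 1) := by
  have hc : Continuous fun y => fderiv ℝ p y (EuclideanSpace.single i 1) :=
    (hpc.continuous_fderiv one_ne_zero).clm_apply continuous_const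
  refine ⟨hc.aestronglyMeasurable, ?_⟩
  have hle : ∫⁻ y, ‖fderiv ℝ p y (EuclideanSpace.single i 1)‖ₑ ≤
      ∫⁻ y, (ENNReal.ofReal (p y) + ENNReal.ofReal (‖score p y‖ ^ (2 * k) * p y)) := by
    refine lintegral_mono fun y => ?_
    rw [← ENNReal.ofReal_add (hp.2.1 y) (mul_nonneg (by positivity) (hp.2.1 y)), ← ofReal_norm]
    refine ENNReal.ofReal_le_ofReal (le_trans ?_ (norm_score_mul_le hp.2.1 hk y))
    rw [fderiv_single_eq_score_mul (hpc.differentiable one_ne_zero) hp.2.1, norm_mul,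
      Real.norm_of_nonneg (hp.2.1 y)]
    exact mul_le_mul_of_nonneg_right (PiLp.norm_apply_le (score p y) i) (hp.2.1 y)
  refine hle.trans_lt ?_
  rw [lintegral_add_left' hpc.continuous.aemeasurable.ennreal_ofReal]
  refine ENNReal.add_lt_top.2 ⟨?_, hM.trans_lt ENNReal.ofReal_lt_top⟩
  rw [← ofReal_integral_eq_lintegral_ofReal hp.1 (ae_of_all _ hp.2.1)]
  exact ENNReal.ofReal_lt_top

lemma smoothPartial_eq_integral_score (ht : 0 < t) (hp : IsDensity p) (hpc : ContDiff ℝ 1 p)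
    (hk : 1 ≤ k) (hM : ScoreMomentBound k M p) (i : Fin d) (x : E d) :
    smoothPartial t p i x = ∫ y, score p y i * (p y * gaussianDensity d t (x - y)) := by
  have hfd : ∀ y : E d, fderiv ℝ (fun u => gaussianDensity d t (x - u)) y
      (EuclideanSpace.single i 1) = -gaussianPartial d t i (x - y) := by
    intro y
    have := fderiv_gaussianDensity_sub_smul (h := 1) (t := t) i x y
    simpa only [one_smul, one_mul] using this
  have hφb : ∀ y : E d, ‖gaussianDensity d t (x - y)‖ ≤ gaussianDensity d t 0 := fun y => by
    rw [Real.norm_of_nonneg (gaussianDensity_pos ht _).le]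
    exact gaussianDensity_le ht _
  have hφc : Continuous fun y : E d => gaussianDensity d t (x - y) :=
    continuous_gaussianDensity.comp (by fun_prop)
  have key := integral_mul_fderiv_eq_neg_fderiv_mul_of_integrable (μ := (volume : Measure (E d)))
    (f := p) (g := fun u => gaussianDensity d t (x - u)) (v := EuclideanSpace.single i 1)
    ((integrable_fderiv_single hp hpc hk hM i).mul_bdd hφc.aestronglyMeasurable (ae_of_all _ hφb))
    (by
      simp_rw [hfd, mul_neg]
      exact (integrable_mul_gaussianPartial ht hp.1 i x).neg)
    (integrable_mul_gaussianDensity ht hp.1 x)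
    (fun y _ => hpc.differentiable one_ne_zero y)
    (fun y _ => (contDiff_gaussianDensity.comp
      (contDiff_const.sub contDiff_id)).differentiable (by simp) y)
  simp_rw [hfd, mul_neg] at key
  rw [integral_neg, neg_inj] at key
  rw [smoothPartial, key]
  refine integral_congr_ae (ae_of_all _ fun y => ?_)
  simp only
  rw [fderiv_single_eq_score_mul (hpc.differentiable one_ne_zero) hp.2.1]
  ring

lemma ofReal_norm_smoothGrad_sq_le (ht : 0 < t) (hp : IsDensity p) (hpc : ContDiff ℝ 1 p)
    (hk : 1 ≤ k) (hM : ScoreMomentBound k M p) (x : E d) :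
    ENNReal.ofReal (‖smoothGrad t p x‖ ^ 2) ≤
      (∫⁻ y, ENNReal.ofReal (‖score p y‖ ^ 2 * (p y * gaussianDensity d t (x - y)))) *
        ENNReal.ofReal (gaussianSmooth t p x) := by
  have hw0 : ∀ y, 0 ≤ p y * gaussianDensity d t (x - y) := fun y =>
    mul_nonneg (hp.2.1 y) (gaussianDensity_pos ht _).le
  have hwi := integrable_mul_gaussianDensity ht hp.1 x
  have hw : ∫⁻ y, ENNReal.ofReal (p y * gaussianDensity d t (x - y)) =
      ENNReal.ofReal (gaussianSmooth t p x) := by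
    rw [← ofReal_integral_eq_lintegral_ofReal hwi (ae_of_all _ hw0)]
    rfl
  have hsm : ∀ i, Measurable fun y => score p y i := fun i =>
    (EuclideanSpace.proj (𝕜 := ℝ) i).continuous.measurable.comp (measurable_score p)
  rw [EuclideanSpace.norm_sq_eq, ENNReal.ofReal_sum_of_nonneg fun _ _ => sq_nonneg _]
  calc _ ≤ ∑ i, (∫⁻ y, ENNReal.ofReal (score p y i ^ 2 * (p y * gaussianDensity d t (x - y)))) *
        ENNReal.ofReal (gaussianSmooth t p x) := by
        refine Finset.sum_le_sum fun i _ => ?_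
        rw [← hw, Real.norm_eq_abs, sq_abs]
        refine le_trans (le_of_eq ?_) (ofReal_sq_integral_mul_le
          (hsm i).aestronglyMeasurable hwi.aestronglyMeasurable hw0)
        rw [← smoothPartial_eq_integral_score ht hp hpc hk hM]
        rfl
    _ = _ := by
        rw [← Finset.sum_mul, ← lintegral_finsetSum']
        · congr 1
          refine lintegral_congr fun y => ?_
          rw [EuclideanSpace.norm_sq_eq, Finset.sum_mul, ENNReal.ofReal_sum_of_nonneg]
          · simp_rw [Real.norm_eq_abs, sq_abs]
          · exact fun i _ => mul_nonneg (sq_nonneg _) (hw0 y)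
        · intro i _
          exact (((hsm i).pow_const 2).aemeasurable.mul hwi.aemeasurable).ennreal_ofReal

/-- Weighted score bound: Jensen's inequality for the score of `p * φ_t`, then Hölder. -/
lemma lintegral_score_sq_mul_min_le (ht : 0 < t) (hp : IsDensity p) (hpc : ContDiff ℝ 1 p)
    (hk : 1 ≤ k) (hM : ScoreMomentBound k M p) {τ : ℝ} (hτ : 0 < τ) :
    ∫⁻ x, ENNReal.ofReal (‖score (gaussianSmooth t p) x‖ ^ 2 * min (gaussianSmooth t p x) τ) ≤
      ENNReal.ofReal M ^ (1 / k) *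
        (∫⁻ x, ENNReal.ofReal (min (gaussianSmooth t p x) τ)) ^ (1 - 1 / k) := by
  have hk0 : 0 < k := by linarith
  have hk1 : 1 / k ≤ 1 := (div_le_one hk0).2 hk
  set f : E d → ℝ := gaussianSmooth t p with hf
  have hfpos : ∀ x, 0 < f x := gaussianSmooth_pos ht hp
  have hfc : Continuous f := continuous_gaussianSmooth ht hp.1
  set w : E d → ℝ := fun x => min (f x) τ / f x with hw
  have hw0 : ∀ x, 0 < w x := fun x => div_pos (lt_min (hfpos x) hτ) (hfpos x)
  have hw1 : ∀ x, w x ≤ 1 := fun x => (div_le_one (hfpos x)).2 (min_le_left _ _)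
  have hwc : Continuous w := (hfc.min continuous_const).div hfc fun x => (hfpos x).ne'
  have hp0 := hp.2.1
  have hφ : Measurable fun z : E d × E d => gaussianDensity d t (z.1 - z.2) :=
    (continuous_gaussianDensity.comp (by fun_prop)).measurable
  have hpm : Measurable fun z : E d × E d => p z.2 := hpc.continuous.measurable.comp measurable_snd
  have hs : Measurable fun z : E d × E d => ‖score p z.2‖ :=
    ((measurable_score p).comp measurable_snd).norm
  set F : E d × E d → ℝ≥0∞ := fun z => ENNReal.ofReal
    (‖score p z.2‖ ^ (2 * k) * p z.2 * gaussianDensity d t (z.1 - z.2)) with hF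
  set G : E d × E d → ℝ≥0∞ := fun z => ENNReal.ofReal
    (w z.1 * (p z.2 * gaussianDensity d t (z.1 - z.2))) with hG
  have hFm : Measurable F := (((hs.pow_const _).mul hpm).mul hφ).ennreal_ofReal
  have hGm : Measurable G :=
    ((hwc.measurable.comp measurable_fst).mul (hpm.mul hφ)).ennreal_ofReal
  have hFG : ∀ x y, ENNReal.ofReal (w x * (‖score p y‖ ^ 2 * (p y * gaussianDensity d t (x - y)))) ≤
      F (x, y) ^ (1 / k) * G (x, y) ^ (1 - 1 / k) := by
    intro x y
    have hφ0 := (gaussianDensity_pos (d := d) ht (x - y)).le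
    set m := p y * gaussianDensity d t (x - y) with hm
    have hm0 : 0 ≤ m := mul_nonneg (hp0 y) hφ0
    simp only [hF, hG]
    rw [mul_assoc, ← hm, ENNReal.ofReal_rpow_of_nonneg (mul_nonneg (by positivity) hm0)
      (by positivity), ENNReal.ofReal_rpow_of_nonneg (mul_nonneg (hw0 x).le hm0) (by linarith),
      ← ENNReal.ofReal_mul (Real.rpow_nonneg (mul_nonneg (by positivity) hm0) _)]
    refine ENNReal.ofReal_le_ofReal ?_
    rw [Real.mul_rpow (by positivity) hm0, Real.mul_rpow (hw0 x).le hm0,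
      ← Real.rpow_mul (norm_nonneg _)]
    have e1 : 2 * k * (1 / k) = 2 := by field_simp
    have e2 : m ^ (1 / k) * m ^ (1 - 1 / k) = m := by
      rw [← Real.rpow_add' hm0 (by norm_num)]
      norm_num
    have e3 : w x ≤ w x ^ (1 - 1 / k) := by
      have := Real.rpow_le_rpow_of_exponent_ge (hw0 x) (hw1 x)
        (show 1 - 1 / k ≤ 1 by have : 0 < 1 / k := by positivity
                               linarith)
      rwa [Real.rpow_one] at this
    rw [e1, Real.rpow_two]
    calc w x * (‖score p y‖ ^ 2 * m) ≤ w x ^ (1 - 1 / k) * (‖score p y‖ ^ 2 * m) := by gcongr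
      _ = w x ^ (1 - 1 / k) * (‖score p y‖ ^ 2 * (m ^ (1 / k) * m ^ (1 - 1 / k))) := by rw [e2]
      _ = _ := by ring
  have hpt : ∀ x, ENNReal.ofReal (‖score f x‖ ^ 2 * min (f x) τ) ≤
      ∫⁻ y, F (x, y) ^ (1 / k) * G (x, y) ^ (1 - 1 / k) := by
    intro x
    have h1 := ofReal_norm_smoothGrad_sq_le ht hp hpc hk hM x
    rw [← hf] at h1
    have h2 : ‖score f x‖ ^ 2 * min (f x) τ = w x * (f x)⁻¹ * ‖smoothGrad t p x‖ ^ 2 := by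
      rw [hf, score_gaussianSmooth ht hp, ← hf, norm_smul, norm_inv,
        Real.norm_of_nonneg (hfpos x).le, hw]
      have := (hfpos x).ne'
      field_simp
    rw [h2, ENNReal.ofReal_mul (mul_nonneg (hw0 x).le (inv_nonneg.2 (hfpos x).le))]
    calc _ ≤ ENNReal.ofReal (w x * (f x)⁻¹) *
          ((∫⁻ y, ENNReal.ofReal (‖score p y‖ ^ 2 * (p y * gaussianDensity d t (x - y)))) *
            ENNReal.ofReal (f x)) := by gcongr
      _ = ENNReal.ofReal (w x) *
          ∫⁻ y, ENNReal.ofReal (‖score p y‖ ^ 2 * (p y * gaussianDensity d t (x - y))) := by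
          rw [mul_comm (∫⁻ y, _), ← mul_assoc, ← ENNReal.ofReal_mul
            (mul_nonneg (hw0 x).le (inv_nonneg.2 (hfpos x).le)),
            inv_mul_cancel_right₀ (hfpos x).ne']
      _ = ∫⁻ y, ENNReal.ofReal (w x * (‖score p y‖ ^ 2 * (p y * gaussianDensity d t (x - y)))) := by
          rw [← lintegral_const_mul' _ _ ENNReal.ofReal_ne_top]
          simp_rw [← ENNReal.ofReal_mul (hw0 x).le]
      _ ≤ _ := lintegral_mono fun y => hFG x y
  have hFint : ∫⁻ z, F z ∂((volume : Measure (E d)).prod volume) ≤ ENNReal.ofReal M := by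
    rw [lintegral_prod_symm _ hFm.aemeasurable]
    refine le_trans (le_of_eq (lintegral_congr fun y => ?_)) hM
    simp only [hF]
    simp_rw [ENNReal.ofReal_mul (mul_nonneg (by positivity : 0 ≤ ‖score p y‖ ^ (2 * k)) (hp0 y))]
    rw [lintegral_const_mul' _ _ ENNReal.ofReal_ne_top, lintegral_gaussianDensity_sub ht, mul_one]
  have hGint : ∫⁻ z, G z ∂((volume : Measure (E d)).prod volume) =
      ∫⁻ x, ENNReal.ofReal (min (f x) τ) := by
    rw [lintegral_prod _ hGm.aemeasurable]
    refine lintegral_congr fun x => ?_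
    simp only [hG]
    simp_rw [ENNReal.ofReal_mul (hw0 x).le]
    rw [lintegral_const_mul' _ _ ENNReal.ofReal_ne_top, ← ofReal_integral_eq_lintegral_ofReal
      (integrable_mul_gaussianDensity ht hp.1 x) (ae_of_all _ fun y =>
        mul_nonneg (hp0 y) (gaussianDensity_pos ht _).le), ← ENNReal.ofReal_mul (hw0 x).le]
    congr 1
    change w x * f x = _
    rw [hw]
    exact div_mul_cancel₀ _ (hfpos x).ne'
  calc _ ≤ ∫⁻ x, ∫⁻ y, F (x, y) ^ (1 / k) * G (x, y) ^ (1 - 1 / k) := lintegral_mono hpt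
    _ = ∫⁻ z, F z ^ (1 / k) * G z ^ (1 - 1 / k) ∂((volume : Measure (E d)).prod volume) := by
      exact (lintegral_prod (fun z => F z ^ (1 / k) * G z ^ (1 - 1 / k))
        ((hFm.pow_const _).mul (hGm.pow_const _)).aemeasurable).symm
    _ ≤ (∫⁻ z, F z ∂((volume : Measure (E d)).prod volume)) ^ (1 / k) *
        (∫⁻ z, G z ∂((volume : Measure (E d)).prod volume)) ^ (1 - 1 / k) :=
      ENNReal.lintegral_mul_norm_pow_le hFm.aemeasurable hGm.aemeasurable (by positivity)
        (by linarith) (by ring)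
    _ ≤ _ := by
      rw [hGint]
      gcongr

end Score

section Tail

variable {d : ℕ}

lemma one_add_norm_sq_le (x y : E d) :
    1 + ‖x‖ ^ 2 ≤ 2 * ((1 + ‖y‖ ^ 2) * (1 + ‖x - y‖ ^ 2)) := by
  have h : ‖x‖ ≤ ‖x - y‖ + ‖y‖ := by simpa using norm_add_le (x - y) y
  have h2 : ‖x‖ ^ 2 ≤ (‖x - y‖ + ‖y‖) ^ 2 := pow_le_pow_left₀ (norm_nonneg _) h 2
  nlinarith [sq_nonneg (‖x - y‖ - ‖y‖), mul_nonneg (sq_nonneg ‖y‖) (sq_nonneg ‖x - y‖)]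

/-- Gaussian smoothing preserves polynomial tails, uniformly for bounded variances. -/
lemma exists_gaussianSmooth_tail (d : ℕ) {γ C₂ T : ℝ} (hγ : 0 < γ) (hC₂ : 0 < C₂) (hT : 0 < T) :
    ∃ C : ℝ, 0 < C ∧ ∀ p : E d → ℝ, IsDensity p → PolynomialTail γ C₂ p → ∀ t, 0 < t → t ≤ T →
      PolynomialTail γ C (gaussianSmooth t p) := by
  set q : ℝ := (1 + γ + (d : ℝ)) / 2 with hq
  have hq0 : 0 < q := by positivity
  obtain ⟨A, hA, hAb⟩ := exists_rpow_mul_gaussianDensity_le d hq0 hT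
  refine ⟨C₂ * 2 ^ q * A, by positivity, fun p hp hpt t ht htT x => ?_⟩
  rw [← hq, le_div_iff₀ (by positivity), gaussianSmooth, ← integral_mul_const]
  have hi : Integrable fun y => C₂ * 2 ^ q * A * gaussianDensity d (2 * t) (x - y) :=
    ((integrable_gaussianDensity (d := d) (t := 2 * t) (by positivity)).comp_sub_left x).const_mul _
  refine (integral_mono ((integrable_mul_gaussianDensity ht hp.1 x).mul_const _) hi
    fun y => ?_).trans_eq ?_
  · have h1 := hpt y
    rw [← hq, le_div_iff₀ (by positivity)] at h1
    have h2 : (1 + ‖x‖ ^ 2) ^ q ≤ 2 ^ q * ((1 + ‖y‖ ^ 2) ^ q * (1 + ‖x - y‖ ^ 2) ^ q) := by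
      rw [← Real.mul_rpow (by positivity) (by positivity),
        ← Real.mul_rpow (by positivity) (by positivity)]
      exact Real.rpow_le_rpow (by positivity) (one_add_norm_sq_le x y) hq0.le
    have hφ := (gaussianDensity_pos (d := d) ht (x - y)).le
    have hpy := hp.2.1 y
    calc p y * gaussianDensity d t (x - y) * (1 + ‖x‖ ^ 2) ^ q
        ≤ p y * gaussianDensity d t (x - y) *
          (2 ^ q * ((1 + ‖y‖ ^ 2) ^ q * (1 + ‖x - y‖ ^ 2) ^ q)) := by gcongr
      _ = (p y * (1 + ‖y‖ ^ 2) ^ q) * 2 ^ q *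
          ((1 + ‖x - y‖ ^ 2) ^ q * gaussianDensity d t (x - y)) := by ring
      _ ≤ C₂ * 2 ^ q * (A * gaussianDensity d (2 * t) (x - y)) := by
          have := hAb t ht htT (x - y)
          gcongr
      _ = _ := by ring
  · rw [integral_const_mul, integral_sub_left_eq_self (fun y => gaussianDensity d (2 * t) y),
      integral_gaussianDensity (by positivity), mul_one]

/-- A function with polynomial tails, truncated at level `ε`, has integral
`O(ε^{(γ+1)/(d+γ+1)})`. -/
lemma exists_lintegral_min_le (d : ℕ) {γ C₂ : ℝ} (hγ : 0 < γ) (hC₂ : 0 < C₂) :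
    ∃ C : ℝ, 0 < C ∧ ∀ f : E d → ℝ, PolynomialTail γ C₂ f → ∀ ε, 0 < ε →
      ∫⁻ x, ENNReal.ofReal (min (f x) ε) ≤
        ENNReal.ofReal (C * ε ^ ((γ + 1) / ((d : ℝ) + γ + 1))) := by
  set q : ℝ := (1 + γ + (d : ℝ)) / 2 with hq
  have hq0 : 0 < q := by positivity
  have hI : Integrable fun x : E d => (1 + ‖x‖ ^ 2) ^ (-q) := by
    have := integrable_rpow_neg_one_add_norm_sq (E := E d) (μ := volume) (r := 1 + γ + d)
      (by rw [finrank_euclideanSpace_fin]; linarith)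
    refine this.congr (ae_of_all _ fun x => ?_)
    simp only [hq]
    congr 1
    ring
  set I := ∫ x : E d, (1 + ‖x‖ ^ 2) ^ (-q) with hIdef
  have hI0 : 0 ≤ I := integral_nonneg fun x => by positivity
  refine ⟨2 ^ q * (1 + C₂) * (I + 1), by positivity, fun f hf ε hε => ?_⟩
  set r : ℝ := ε ^ (1 / (2 * q)) with hr
  have hr0 : 0 < r := by positivity
  have hrq : (r ^ 2) ^ q = ε := by
    rw [hr, ← Real.rpow_natCast, ← Real.rpow_mul hε.le, ← Real.rpow_mul hε.le]
    have : 1 / (2 * q) * ((2 : ℕ) : ℝ) * q = 1 := by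
      push_cast
      field_simp
    rw [this, Real.rpow_one]
  have hpt : ∀ x, min (f x) ε ≤ ε * (2 ^ q * (1 + C₂)) * (1 + ‖r • x‖ ^ 2) ^ (-q) := by
    intro x
    rw [Real.rpow_neg (by positivity), ← div_eq_mul_inv, le_div_iff₀ (by positivity), norm_smul,
      Real.norm_of_nonneg hr0.le, mul_pow]
    have h2q : (0 : ℝ) < 2 ^ q := by positivity
    rcases le_total (r ^ 2 * ‖x‖ ^ 2) 1 with h | h
    · have h1 : (1 + r ^ 2 * ‖x‖ ^ 2) ^ q ≤ 2 ^ q :=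
        Real.rpow_le_rpow (by positivity) (by linarith) hq0.le
      calc min (f x) ε * (1 + r ^ 2 * ‖x‖ ^ 2) ^ q ≤ ε * (1 + r ^ 2 * ‖x‖ ^ 2) ^ q :=
            mul_le_mul_of_nonneg_right (min_le_right _ _) (by positivity)
        _ ≤ ε * 2 ^ q := by gcongr
        _ ≤ ε * (2 ^ q * (1 + C₂)) := by
            gcongr
            nlinarith
    · have h1 : (1 + r ^ 2 * ‖x‖ ^ 2) ^ q ≤ 2 ^ q * (ε * (1 + ‖x‖ ^ 2) ^ q) := by
        calc (1 + r ^ 2 * ‖x‖ ^ 2) ^ q ≤ (2 * (r ^ 2 * (1 + ‖x‖ ^ 2))) ^ q :=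
              Real.rpow_le_rpow (by positivity) (by nlinarith [sq_nonneg r]) hq0.le
          _ = _ := by
              rw [Real.mul_rpow (by positivity) (by positivity),
                Real.mul_rpow (by positivity) (by positivity), hrq]
      have h2 := hf x
      rw [← hq, le_div_iff₀ (by positivity)] at h2
      rcases le_total (f x) 0 with h0 | h0
      · have : min (f x) ε * (1 + r ^ 2 * ‖x‖ ^ 2) ^ q ≤ 0 :=
          mul_nonpos_of_nonpos_of_nonneg ((min_le_left _ _).trans h0) (by positivity)
        exact this.trans (by positivity)
      · calc min (f x) ε * (1 + r ^ 2 * ‖x‖ ^ 2) ^ q ≤ f x * (2 ^ q * (ε * (1 + ‖x‖ ^ 2) ^ q)) :=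
              mul_le_mul (min_le_left _ _) h1 (by positivity) h0
          _ = ε * 2 ^ q * (f x * (1 + ‖x‖ ^ 2) ^ q) := by ring
          _ ≤ ε * 2 ^ q * C₂ := by gcongr
          _ ≤ ε * (2 ^ q * (1 + C₂)) := by
              have : 0 < ε * 2 ^ q := by positivity
              nlinarith
  calc _ ≤ ∫⁻ x, ENNReal.ofReal (ε * (2 ^ q * (1 + C₂))) *
        ENNReal.ofReal ((1 + ‖r • x‖ ^ 2) ^ (-q)) := by
        refine lintegral_mono fun x => ?_
        rw [← ENNReal.ofReal_mul (by positivity)]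
        exact ENNReal.ofReal_le_ofReal (hpt x)
    _ = ENNReal.ofReal (ε * (2 ^ q * (1 + C₂)) * ((r ^ d)⁻¹ * I)) := by
        rw [lintegral_const_mul' _ _ ENNReal.ofReal_ne_top,
          lintegral_comp_smul hr0 fun x => ENNReal.ofReal ((1 + ‖x‖ ^ 2) ^ (-q)),
          ← ofReal_integral_eq_lintegral_ofReal hI (ae_of_all _ fun x => by positivity),
          ← ENNReal.ofReal_mul (by positivity), ← ENNReal.ofReal_mul (by positivity)]
    _ ≤ _ := by
        refine ENNReal.ofReal_le_ofReal ?_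
        have e : ε * (r ^ d)⁻¹ = ε ^ ((γ + 1) / ((d : ℝ) + γ + 1)) := by
          rw [hr, ← Real.rpow_natCast, ← Real.rpow_mul hε.le, ← Real.rpow_neg hε.le]
          nth_rewrite 1 [← Real.rpow_one ε]
          rw [← Real.rpow_add hε]
          congr 1
          have : (0 : ℝ) < (d : ℝ) + γ + 1 := by positivity
          rw [hq]
          field_simp
          ring
        calc ε * (2 ^ q * (1 + C₂)) * ((r ^ d)⁻¹ * I) =
            2 ^ q * (1 + C₂) * I * (ε * (r ^ d)⁻¹) := by ring
          _ ≤ 2 ^ q * (1 + C₂) * (I + 1) * (ε * (r ^ d)⁻¹) := by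
            gcongr
            linarith
          _ = _ := by rw [e]

end Tail

section Estimator

variable {d n l : ℕ} {K : E d → ℝ} {h t : ℝ} {p : E d → ℝ}

/-- The probability measure with density `p`. -/
def densityMeasure (p : E d → ℝ) : Measure (E d) :=
  (volume : Measure (E d)).withDensity fun x => ENNReal.ofReal (p x)

lemma IsDensity.isProbabilityMeasure (hp : IsDensity p) :
    IsProbabilityMeasure (densityMeasure p) := by
  refine ⟨?_⟩
  rw [densityMeasure, withDensity_apply _ MeasurableSet.univ, Measure.restrict_univ,
    ← ofReal_integral_eq_lintegral_ofReal hp.1 (ae_of_all _ hp.2.1), hp.2.2, ENNReal.ofReal_one]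

lemma integral_densityMeasure (hp : IsDensity p) (f : E d → ℝ) :
    ∫ y, f y ∂(densityMeasure p) = ∫ y, p y * f y := by
  rw [densityMeasure, integral_withDensity_eq_integral_toReal_smul₀
    hp.1.aestronglyMeasurable.aemeasurable.ennreal_ofReal (ae_of_all _ fun _ => ENNReal.ofReal_lt_top)]
  simp_rw [ENNReal.toReal_ofReal (hp.2.1 _), smul_eq_mul]

lemma kde_eq (X : Fin n → E d) (y : E d) :
    kde K h X y = (n : ℝ)⁻¹ * ∑ i, scaledKernel K h (y - X i) := by
  simp only [kde, scaledKernel, ← Finset.mul_sum, ← mul_assoc]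
  rw [one_div, mul_inv]

lemma integrable_kde (hK : IsKernel l K) (hh : 0 < h) (X : Fin n → E d) :
    Integrable (kde K h X) := by
  have e : kde K h X = fun y => (n : ℝ)⁻¹ * ∑ i, scaledKernel K h (y - X i) := funext (kde_eq X)
  rw [e]
  exact (integrable_finsetSum _ fun i _ =>
    (hK.integrable_scaledKernel hh).comp_sub_right (X i)).const_mul _

lemma integral_kde_mul (X : Fin n → E d) {ψ : E d → ℝ}
    (hψ : ∀ z, Integrable fun y => scaledKernel K h y * ψ (z - y)) (x : E d) :
    ∫ y, kde K h X y * ψ (x - y) =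
      empMean (fun y => ∫ u, scaledKernel K h u * ψ (x - y - u)) X := by
  have hi : ∀ i, Integrable fun y => scaledKernel K h (y - X i) * ψ (x - y) := fun i => by
    refine ((hψ (x - X i)).comp_sub_right (X i)).congr (ae_of_all _ fun y => ?_)
    simp only
    rw [sub_sub_sub_cancel_right]
  simp_rw [kde_eq, mul_assoc, Finset.sum_mul]
  rw [integral_const_mul, integral_finsetSum _ fun i _ => hi i, empMean]
  congr 1
  refine Finset.sum_congr rfl fun i _ => ?_
  rw [← integral_sub_right_eq_self (fun u => scaledKernel K h u * ψ (x - X i - u)) (X i)]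
  refine integral_congr_ae (ae_of_all _ fun y => ?_)
  simp only
  rw [sub_sub_sub_cancel_right]

lemma densityEstimator_eq (hK : IsKernel l K) (hh : 0 < h) (ht : 0 < t) (X : Fin n → E d)
    (x : E d) : densityEstimator K h t X x =
      empMean (fun y => gaussianSmooth t (scaledKernel K h) (x - y)) X :=
  integral_kde_mul X (fun z => integrable_mul_gaussianDensity ht (hK.integrable_scaledKernel hh) z) x

lemma gradient_densityEstimator (hK : IsKernel l K) (hh : 0 < h) (ht : 0 < t) (X : Fin n → E d)
    (x : E d) : gradient (densityEstimator K h t X) x = smoothGrad t (kde K h X) x :=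
  gradient_gaussianSmooth ht (integrable_kde hK hh X) x

lemma smoothGrad_kde_apply (hK : IsKernel l K) (hh : 0 < h) (ht : 0 < t) (X : Fin n → E d)
    (x : E d) (i : Fin d) : smoothGrad t (kde K h X) x i =
      empMean (fun y => smoothPartial t (scaledKernel K h) i (x - y)) X :=
  integral_kde_mul X
    (fun z => integrable_mul_gaussianPartial ht (hK.integrable_scaledKernel hh) i z) x

lemma measurable_scoreEstimator (hK : IsKernel l K) (hh : 0 < h) (ht : 0 < t) (ρ : ℝ) :
    Measurable fun z : (Fin n → E d) × E d => scoreEstimator K h ρ t z.1 z.2 := by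
  have hKh := hK.integrable_scaledKernel hh
  have hG := continuous_gaussianSmooth ht hKh
  have h1 : Measurable fun z : (Fin n → E d) × E d => densityEstimator K h t z.1 z.2 := by
    simp_rw [densityEstimator_eq hK hh ht, empMean]
    refine Continuous.measurable (continuous_const.mul (continuous_finsetSum _ fun i _ => ?_))
    exact hG.comp (by fun_prop)
  have h2 : Measurable fun z : (Fin n → E d) × E d =>
      gradient (densityEstimator K h t z.1) z.2 := by
    simp_rw [gradient_densityEstimator hK hh ht]
    have e : (fun z : (Fin n → E d) × E d => smoothGrad t (kde K h z.1) z.2) =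
        fun z => WithLp.toLp 2 fun i => (n : ℝ)⁻¹ *
          ∑ j, smoothPartial t (scaledKernel K h) i (z.2 - z.1 j) := by
      funext z
      ext i
      exact smoothGrad_kde_apply hK hh ht z.1 z.2 i
    rw [e]
    refine Continuous.measurable ?_
    refine (PiLp.continuous_toLp 2 _).comp (continuous_pi fun i => continuous_const.mul
      (continuous_finsetSum _ fun j _ => ?_))
    exact (continuous_smoothPartial ht hKh i).comp (by fun_prop)
  unfold scoreEstimator
  exact Measurable.ite (measurableSet_le measurable_const h1) (h1.inv.smul h2) measurable_const

lemma lintegral_realConv_le (hp : IsDensity p) (hpc : Continuous p) {g : E d → ℝ}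
    (hg : Continuous g) (hg0 : ∀ x, 0 ≤ g x) {C : ℝ} (hC : ∀ x, |g x| ≤ C) :
    ∫⁻ x, ENNReal.ofReal (realConv p g x) ≤ ∫⁻ x, ENNReal.ofReal (g x) := by
  have hm : Measurable fun z : E d × E d => ENNReal.ofReal (p z.2 * g (z.1 - z.2)) :=
    ((hpc.comp continuous_snd).mul (hg.comp (by fun_prop))).measurable.ennreal_ofReal
  calc _ = ∫⁻ x, ∫⁻ y, ENNReal.ofReal (p y * g (x - y)) := by
        refine lintegral_congr fun x => ?_
        rw [realConv, ofReal_integral_eq_lintegral_ofReal]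
        · exact hp.1.mul_bdd (c := C) (hg.comp (by fun_prop)).aestronglyMeasurable
            (ae_of_all _ fun y => hC _)
        · exact ae_of_all _ fun y => mul_nonneg (hp.2.1 y) (hg0 _)
    _ = ∫⁻ y, ∫⁻ x, ENNReal.ofReal (p y * g (x - y)) :=
        lintegral_lintegral_swap hm.aemeasurable
    _ = ∫⁻ y, ENNReal.ofReal (p y) * ∫⁻ x, ENNReal.ofReal (g x) := by
        refine lintegral_congr fun y => ?_
        simp_rw [ENNReal.ofReal_mul (hp.2.1 y)]
        rw [lintegral_const_mul' _ _ ENNReal.ofReal_ne_top,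
          lintegral_sub_right_eq_self (fun x => ENNReal.ofReal (g x)) y]
    _ ≤ _ := by
        rw [lintegral_mul_const _ hpc.measurable.ennreal_ofReal,
          ← ofReal_integral_eq_lintegral_ofReal hp.1 (ae_of_all _ hp.2.1), hp.2.2,
          ENNReal.ofReal_one, one_mul]

lemma PolynomialTail.le {γ C₂ : ℝ} (hγ : 0 < γ) (hC₂ : 0 < C₂) (hp : PolynomialTail γ C₂ p)
    (x : E d) : p x ≤ C₂ := by
  refine (hp x).trans (div_le_self hC₂.le (Real.one_le_rpow ?_ (by positivity)))
  have := sq_nonneg ‖x‖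
  linarith

end Estimator

section Risk

variable {d : ℕ} {K : E d → ℝ} {β L : ℝ}

set_option maxHeartbeats 1000000 in
/-- Risk bound in terms of a bandwidth `h` for which `n h^{2β+d}` is bounded below. -/
theorem exists_risk_le (hβ : 2 < β) (hL : 0 < L) (hK : IsKernel ⌊β⌋₊ K) {r γ C₂ k M T A b : ℝ}
    (hr : 0 < r) (hγ : 0 < γ) (hC₂ : 0 < C₂) (hk : 1 ≤ k) (hT : 0 < T)
    (hA : 0 < A) (hb : 0 < b) :
    ∃ C : ℝ, 0 < C ∧ ∀ p : E d → ℝ, PolynomialTail γ C₂ p → SobolevClass β L p →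
      HolderClass β L p → ScoreMomentBound k M p → ∀ n : ℕ, 1 ≤ n → ∀ h : ℝ, 0 < h → h ≤ b →
      A ≤ n * (h ^ d * (h ^ β) ^ 2) → ∀ t, 0 < t → t ≤ T →
      risk K h (r * h ^ β) t p n ≤
        ENNReal.ofReal (C * (h ^ (β - 2) +
          ((h ^ β) ^ ((γ + 1) / ((d : ℝ) + γ + 1))) ^ (1 - 1 / k))) := by
  have hβ1 : 1 ≤ ⌊β⌋₊ := Nat.le_floor (by simpa using (by linarith : (1 : ℝ) ≤ β))
  have hk0 : 0 < k := by linarith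
  have hk1 : 1 / k ≤ 1 := (div_le_one hk0).2 hk
  obtain ⟨B, hB, hKB⟩ := hK.exists_ae_bound
  obtain ⟨W, hW, hW2⟩ := hK.gradient_memLp_two
  obtain ⟨CG, hCG, hgrad⟩ := exists_lintegral_gradient_bias_le (β := β) (by linarith) L hK
  obtain ⟨CT, hCT, htail⟩ := exists_gaussianSmooth_tail d hγ hC₂ hT
  obtain ⟨C₃, hC₃, hmin⟩ := exists_lintegral_min_le d hγ hCT
  set SK : ℝ := ∫ u, K u ^ 2 with hSK
  set SW : ℝ := ∫ u, ‖W u‖ ^ 2 with hSW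
  have hSK0 : 0 ≤ SK := integral_nonneg fun _ => sq_nonneg _
  have hSW0 : 0 ≤ SW := integral_nonneg fun _ => sq_nonneg _
  have hSKe : ∫⁻ u, ENNReal.ofReal (K u ^ 2) = ENNReal.ofReal SK :=
    (ofReal_integral_eq_lintegral_ofReal hK.memLp_two.integrable_sq
      (ae_of_all _ fun _ => sq_nonneg _)).symm
  have hSWe : ∫⁻ u, ENNReal.ofReal (‖W u‖ ^ 2) = ENNReal.ofReal SW :=
    (ofReal_integral_eq_lintegral_ofReal (hW2.integrable_norm_pow two_ne_zero)
      (ae_of_all _ fun _ => sq_nonneg _)).symm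
  set Cb : ℝ := (d : ℝ) ^ ⌊β⌋₊ * L * (d : ℝ) ^ β * (∫ u, |K u|) with hCb
  have hCb0 : 0 ≤ Cb := mul_nonneg (by positivity) (integral_nonneg fun _ => abs_nonneg _)
  set c : ℝ := 1 + B * A⁻¹ * b ^ β + C₂ * SK * A⁻¹ + Cb with hc
  have c1 : 0 ≤ B * A⁻¹ * b ^ β := by positivity
  have c2 : 0 ≤ C₂ * SK * A⁻¹ := by positivity
  obtain ⟨C, hC, hcore⟩ := exists_lintegral_truncated_score_le (Ω := E d) (c := c) (r := r)
    (by linarith) hr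
  set D₁ : ℝ := d * (A⁻¹ * SW + CG) with hD₁
  have hD₁0 : 0 ≤ D₁ := by positivity
  set D₂ : ℝ := (max M 0) ^ (1 / k) * C₃ ^ (1 - 1 / k) with hD₂
  have hD₂0 : 0 ≤ D₂ := by positivity
  refine ⟨C * (D₁ + D₂ + 1), by positivity, fun p hpt hps hph hpM n hn h hh hhb hnA t ht htT => ?_⟩
  have hp := hps.1
  have hpc : Continuous p := hph.continuous
  have hpc1 : ContDiff ℝ 1 p := hph.2.1.of_le (by exact_mod_cast hβ1)
  have hn' : (0 : ℝ) < n := by positivity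
  have hpb : ∀ x, |p x| ≤ C₂ := fun x => by
    rw [abs_of_nonneg (hp.2.1 x)]
    exact hpt.le hγ hC₂ x
  set τ : ℝ := h ^ β with hτ
  have hτ0 : 0 < τ := by positivity
  have hτb : τ ≤ b ^ β := Real.rpow_le_rpow hh.le hhb (by linarith)
  have hnh : (n : ℝ)⁻¹ * (h ^ d)⁻¹ ≤ A⁻¹ * τ ^ 2 := by
    rw [← mul_inv, inv_mul_eq_div, inv_eq_one_div, div_le_div_iff₀ (by positivity) hA]
    linarith
  set f : E d → ℝ := gaussianSmooth t p with hf
  have hfpos : ∀ x, 0 < f x := gaussianSmooth_pos ht hp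
  have hfc : Continuous f := continuous_gaussianSmooth ht hp.1
  set G : E d → ℝ := gaussianSmooth t (scaledKernel K h) with hG
  set D : Fin d → E d → ℝ := fun i => smoothPartial t (scaledKernel K h) i with hD
  have hKh := hK.integrable_scaledKernel hh
  have hGc : Continuous G := continuous_gaussianSmooth ht hKh
  have hGb : ∀ z, |G z| ≤ B * (h ^ d)⁻¹ := abs_gaussianSmooth_scaledKernel_le hKB ht hh
  have hDc : ∀ i, Continuous (D i) := continuous_smoothPartial ht hKh
  choose CD hDb using exists_abs_smoothPartial_le (t := t) ht hKh
  have hμ : IsProbabilityMeasure (densityMeasure p) := hp.isProbabilityMeasure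
  have hG2 : ∀ x, ∫ y, G (x - y) ^ 2 ∂(densityMeasure p) ≤ C₂ * ((h ^ d)⁻¹ * SK) := by
    intro x
    rw [integral_densityMeasure hp]
    have h1 := lintegral_sq_gaussianSmooth_scaledKernel_le hK ht hh
    rw [hSKe, ← ENNReal.ofReal_mul (by positivity)] at h1
    have h2 : Integrable fun z => G z ^ 2 := by
      refine ⟨(hGc.pow 2).aestronglyMeasurable, ?_⟩
      refine lt_of_le_of_lt (le_trans (lintegral_mono fun z => ?_) h1) ENNReal.ofReal_lt_top
      rw [← ofReal_norm, Real.norm_of_nonneg (sq_nonneg _)]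
    have h3 : ∫ z, G z ^ 2 ≤ (h ^ d)⁻¹ * SK := by
      rw [← ofReal_integral_eq_lintegral_ofReal h2 (ae_of_all _ fun _ => sq_nonneg _)] at h1
      exact (ENNReal.ofReal_le_ofReal_iff (by positivity)).1 h1
    have h4 : Integrable fun y => G (x - y) ^ 2 := h2.comp_sub_left x
    have h5 : Integrable fun y => p y * G (x - y) ^ 2 :=
      (h4.mul_bdd (c := C₂) hpc.aestronglyMeasurable (ae_of_all _ hpb)).congr
        (ae_of_all _ fun y => mul_comm _ _)
    calc _ ≤ ∫ y, C₂ * G (x - y) ^ 2 := by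
          refine integral_mono h5 (h4.const_mul _) fun y => ?_
          exact mul_le_mul_of_nonneg_right ((le_abs_self _).trans (hpb y)) (sq_nonneg _)
      _ = C₂ * ∫ z, G z ^ 2 := by
          rw [integral_const_mul, integral_sub_left_eq_self (fun y => G y ^ 2)]
      _ ≤ _ := by gcongr
  set V : Fin d → E d → ℝ := fun i => realConv p fun z => D i z ^ 2 with hV
  set Q : Fin d → E d → ℝ := fun i x => (∫ y, p y * D i (x - y)) - smoothPartial t p i x with hQ
  have hpoint : ∀ x, ∫⁻ X, ENNReal.ofReal (‖scoreEstimator K h (r * τ) t X x - score f x‖ ^ 2 * f x)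
      ∂(sampleLaw p n) ≤ ENNReal.ofReal (C * (τ⁻¹ * ∑ i, ((n : ℝ)⁻¹ * V i x + Q i x ^ 2)
        + ‖score f x‖ ^ 2 * min (f x) τ)) := by
    intro x
    have key := hcore d n (densityMeasure p) (fun y => G (x - y)) (fun i y => D i (x - y))
      (fun X => smoothGrad t (kde K h X) x) (smoothGrad t p x) (f x) τ hn
      ⟨(hGc.comp (by fun_prop)).measurable, _, fun y => hGb _⟩
      (fun i => ⟨((hDc i).comp (by fun_prop)).measurable, _, fun y => hDb i _⟩)
      (fun X i => smoothGrad_kde_apply hK hh ht X x i) (hfpos x) hτ0 ?_ ?_ ?_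
    · simp only [integral_densityMeasure hp] at key
      have e1 : ∀ X : Fin n → E d, scoreEstimator K h (r * τ) t X x =
          if r * τ ≤ empMean (fun y => G (x - y)) X then
            (empMean (fun y => G (x - y)) X)⁻¹ • smoothGrad t (kde K h X) x else 0 := by
        intro X
        rw [scoreEstimator, densityEstimator_eq hK hh ht, gradient_densityEstimator hK hh ht]
      have e2 : score f x = (f x)⁻¹ • smoothGrad t p x := score_gaussianSmooth ht hp x
      simp_rw [e1, e2]
      exact key
    · intro y
      refine (hGb _).trans ?_
      have h1 : (h ^ d)⁻¹ ≤ n * (A⁻¹ * τ ^ 2) := by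
        rwa [inv_mul_le_iff₀ hn'] at hnh
      calc B * (h ^ d)⁻¹ ≤ B * (n * (A⁻¹ * τ ^ 2)) := by gcongr
        _ = n * ((B * A⁻¹ * τ) * τ) := by ring
        _ ≤ n * ((B * A⁻¹ * b ^ β) * τ) := by gcongr
        _ ≤ n * (c * τ) := by
          gcongr
          linarith
    · calc _ ≤ (n : ℝ)⁻¹ * (C₂ * ((h ^ d)⁻¹ * SK)) := by
            gcongr
            exact hG2 x
        _ = C₂ * SK * ((n : ℝ)⁻¹ * (h ^ d)⁻¹) := by ring
        _ ≤ C₂ * SK * (A⁻¹ * τ ^ 2) := by gcongr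
        _ = C₂ * SK * A⁻¹ * τ ^ 2 := by ring
        _ ≤ _ := by
          gcongr
          linarith
    · rw [integral_densityMeasure hp]
      refine (abs_integral_mul_gaussianSmooth_scaledKernel_sub_le hβ1 hK hp.1 hph hL.le ht hh
        hpb x).trans ?_
      rw [← hCb, ← hτ]
      gcongr
      linarith
  have hVc : ∀ i, Continuous (V i) := fun i =>
    continuous_realConv hp.1 ((hDc i).pow 2) (C := CD i ^ 2) fun z => by
      rw [abs_pow]
      exact pow_le_pow_left₀ (abs_nonneg _) (hDb i z) 2
  have hV0 : ∀ i x, 0 ≤ V i x := fun i x =>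
    integral_nonneg fun y => mul_nonneg (hp.2.1 y) (sq_nonneg _)
  have hQc : ∀ i, Continuous (Q i) := fun i =>
    (continuous_realConv hp.1 (hDc i) (hDb i)).sub (continuous_smoothPartial ht hp.1 i)
  have hVint : ∀ i, ∫⁻ x, ENNReal.ofReal (V i x) ≤ ENNReal.ofReal ((h ^ d)⁻¹ * (h ^ 2)⁻¹ * SW) := by
    intro i
    refine (lintegral_realConv_le hp hpc ((hDc i).pow 2) (fun _ => sq_nonneg _) (C := CD i ^ 2)
      fun z => ?_).trans ?_
    · simp only [Pi.pow_apply]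
      rw [abs_pow]
      exact pow_le_pow_left₀ (abs_nonneg _) (hDb i z) 2
    · refine (lintegral_sq_smoothPartial_scaledKernel_le hK hW ht hh i).trans_eq ?_
      rw [hSWe, ← ENNReal.ofReal_mul (by positivity)]
  have hh1 : (h ^ (β - 1)) ^ 2 = τ * h ^ (β - 2) := by
    rw [hτ, ← Real.rpow_natCast, ← Real.rpow_mul hh.le, ← Real.rpow_add hh]
    congr 1
    push_cast
    ring
  have hh2 : τ ^ 2 * (h ^ 2)⁻¹ = τ * h ^ (β - 2) := by
    rw [Real.rpow_sub hh, ← hτ, Real.rpow_two]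
    ring
  have hcoord : ∀ i, ∫⁻ x, ENNReal.ofReal ((n : ℝ)⁻¹ * V i x + Q i x ^ 2) ≤
      ENNReal.ofReal ((A⁻¹ * SW + CG) * (τ * h ^ (β - 2))) := by
    intro i
    have e : ∀ x, ENNReal.ofReal ((n : ℝ)⁻¹ * V i x + Q i x ^ 2) =
        ENNReal.ofReal (n : ℝ)⁻¹ * ENNReal.ofReal (V i x) + ENNReal.ofReal (Q i x ^ 2) := fun x => by
      rw [ENNReal.ofReal_add (mul_nonneg (by positivity) (hV0 i x)) (sq_nonneg _),
        ENNReal.ofReal_mul (by positivity)]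
    simp_rw [e]
    have hQm : Measurable fun x => ENNReal.ofReal (Q i x ^ 2) :=
      ((hQc i).pow 2).measurable.ennreal_ofReal
    rw [lintegral_add_right _ hQm,
      lintegral_const_mul' _ _ ENNReal.ofReal_ne_top]
    calc _ ≤ ENNReal.ofReal (n : ℝ)⁻¹ * ENNReal.ofReal ((h ^ d)⁻¹ * (h ^ 2)⁻¹ * SW)
          + ENNReal.ofReal (CG * (h ^ (β - 1)) ^ 2) := by
          gcongr
          · exact hVint i
          · exact hgrad p hps h t hh ht i
      _ = ENNReal.ofReal ((n : ℝ)⁻¹ * ((h ^ d)⁻¹ * (h ^ 2)⁻¹ * SW) + CG * (h ^ (β - 1)) ^ 2) := by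
          rw [← ENNReal.ofReal_mul (by positivity), ← ENNReal.ofReal_add (by positivity)
            (by positivity)]
      _ ≤ _ := by
          refine ENNReal.ofReal_le_ofReal ?_
          calc _ = ((n : ℝ)⁻¹ * (h ^ d)⁻¹) * ((h ^ 2)⁻¹ * SW) + CG * (h ^ (β - 1)) ^ 2 := by ring
            _ ≤ (A⁻¹ * τ ^ 2) * ((h ^ 2)⁻¹ * SW) + CG * (h ^ (β - 1)) ^ 2 := by gcongr
            _ = A⁻¹ * SW * (τ ^ 2 * (h ^ 2)⁻¹) + CG * (h ^ (β - 1)) ^ 2 := by ring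
            _ = _ := by
              rw [hh1, hh2]
              ring
  have hscore : ∫⁻ x, ENNReal.ofReal (‖score f x‖ ^ 2 * min (f x) τ) ≤
      ENNReal.ofReal (D₂ * (τ ^ ((γ + 1) / ((d : ℝ) + γ + 1))) ^ (1 - 1 / k)) := by
    refine (lintegral_score_sq_mul_min_le ht hp hpc1 hk hpM hτ0).trans ?_
    calc _ ≤ ENNReal.ofReal (max M 0) ^ (1 / k) *
          ENNReal.ofReal (C₃ * τ ^ ((γ + 1) / ((d : ℝ) + γ + 1))) ^ (1 - 1 / k) := by
          gcongr
          · exact le_max_left _ _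
          · exact hmin f (htail p hp hpt t ht htT) τ hτ0
      _ = _ := by
          rw [ENNReal.ofReal_rpow_of_nonneg (le_max_right _ _) (by positivity),
            ENNReal.ofReal_rpow_of_nonneg (by positivity) (by linarith),
            ← ENNReal.ofReal_mul (by positivity), Real.mul_rpow (by positivity) (by positivity),
            hD₂, mul_assoc]
  have hprob : IsProbabilityMeasure (sampleLaw p n) := by
    change IsProbabilityMeasure (Measure.pi fun _ : Fin n => densityMeasure p)
    infer_instance
  have hmeas : Measurable fun z : (Fin n → E d) × E d => ENNReal.ofReal
      (‖scoreEstimator K h (r * τ) t z.1 z.2 - score f z.2‖ ^ 2 * f z.2) := by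
    refine (Measurable.mul (Measurable.pow_const (Measurable.norm ?_) 2)
      (hfc.measurable.comp measurable_snd)).ennreal_ofReal
    exact (measurable_scoreEstimator hK hh ht _).sub ((measurable_score f).comp measurable_snd)
  have hsum0 : ∀ x i, 0 ≤ (n : ℝ)⁻¹ * V i x + Q i x ^ 2 := fun x i =>
    add_nonneg (mul_nonneg (by positivity) (hV0 i x)) (sq_nonneg _)
  have hmc : ∀ i, Measurable fun x => ENNReal.ofReal ((n : ℝ)⁻¹ * V i x + Q i x ^ 2) := fun i =>
    ((continuous_const.mul (hVc i)).add ((hQc i).pow 2)).measurable.ennreal_ofReal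
  calc risk K h (r * τ) t p n = ∫⁻ x, ∫⁻ X, ENNReal.ofReal
        (‖scoreEstimator K h (r * τ) t X x - score f x‖ ^ 2 * f x) ∂(sampleLaw p n) :=
        lintegral_lintegral_swap hmeas.aemeasurable
    _ ≤ ∫⁻ x, ENNReal.ofReal C * (ENNReal.ofReal τ⁻¹ *
          ∑ i, ENNReal.ofReal ((n : ℝ)⁻¹ * V i x + Q i x ^ 2)
          + ENNReal.ofReal (‖score f x‖ ^ 2 * min (f x) τ)) := by
        refine lintegral_mono fun x => (hpoint x).trans_eq ?_
        have hs0 : 0 ≤ ∑ i, ((n : ℝ)⁻¹ * V i x + Q i x ^ 2) := Finset.sum_nonneg fun i _ => hsum0 x i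
        rw [ENNReal.ofReal_mul hC.le, ENNReal.ofReal_add (mul_nonneg (by positivity) hs0)
          (mul_nonneg (sq_nonneg _) (le_min (hfpos x).le hτ0.le)), ENNReal.ofReal_mul (by positivity),
          ENNReal.ofReal_sum_of_nonneg fun i _ => hsum0 x i]
    _ = ENNReal.ofReal C * (ENNReal.ofReal τ⁻¹ *
          (∑ i, ∫⁻ x, ENNReal.ofReal ((n : ℝ)⁻¹ * V i x + Q i x ^ 2))
          + ∫⁻ x, ENNReal.ofReal (‖score f x‖ ^ 2 * min (f x) τ)) := by
        rw [lintegral_const_mul' _ _ ENNReal.ofReal_ne_top, lintegral_add_left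
          ((Finset.measurable_fun_sum _ fun i _ => hmc i).const_mul _),
          lintegral_const_mul' _ _ ENNReal.ofReal_ne_top, lintegral_finsetSum _ fun i _ => hmc i]
    _ ≤ ENNReal.ofReal C * (ENNReal.ofReal τ⁻¹ *
          ∑ _i : Fin d, ENNReal.ofReal ((A⁻¹ * SW + CG) * (τ * h ^ (β - 2)))
          + ENNReal.ofReal (D₂ * (τ ^ ((γ + 1) / ((d : ℝ) + γ + 1))) ^ (1 - 1 / k))) := by
        gcongr with i
        exact hcoord i
    _ = ENNReal.ofReal (C * (D₁ * h ^ (β - 2)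
          + D₂ * (τ ^ ((γ + 1) / ((d : ℝ) + γ + 1))) ^ (1 - 1 / k))) := by
        rw [Finset.sum_const, Finset.card_univ, Fintype.card_fin, nsmul_eq_mul,
          ← ENNReal.ofReal_natCast, ← ENNReal.ofReal_mul (by positivity),
          ← ENNReal.ofReal_mul (by positivity), ← ENNReal.ofReal_add (by positivity)
          (by positivity), ← ENNReal.ofReal_mul hC.le]
        congr 2
        rw [hD₁]
        field_simp
    _ ≤ _ := by
        refine ENNReal.ofReal_le_ofReal ?_
        rw [mul_assoc C (D₁ + D₂ + 1)]
        refine mul_le_mul_of_nonneg_left ?_ hC.le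
        have h1 : 0 ≤ h ^ (β - 2) := by positivity
        have h2 : 0 ≤ (τ ^ ((γ + 1) / ((d : ℝ) + γ + 1))) ^ (1 - 1 / k) := by positivity
        nlinarith [mul_nonneg hD₁0 h2, mul_nonneg hD₂0 h1]

end Risk

end DecoupledScore

end

theorem theorem11 (d : ℕ) (hd : 1 ≤ d) (β L : ℝ) (hβ : 2 < β) (hL : 0 < L)
    (K : DecoupledScore.E d → ℝ) (hK : DecoupledScore.IsKernel ⌊β⌋₊ K) :
    ∃ C₀ : ℝ, 0 < C₀ ∧ ∀ Cρ : ℝ, C₀ ≤ Cρ →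
      ∀ γ C₂ k M T a b : ℝ, 0 < γ → 0 < C₂ → 1 ≤ k → 0 ≤ M → 0 < T → 0 < a → a ≤ b →
        ∃ C : ℝ, 0 < C ∧
          ∀ p₀ : DecoupledScore.E d → ℝ,
            DecoupledScore.PolynomialTail γ C₂ p₀ →
            DecoupledScore.SobolevClass β L p₀ →
            DecoupledScore.HolderClass β L p₀ →
            DecoupledScore.ScoreMomentBound k M p₀ →
            ∀ n : ℕ, 1 ≤ n → ∀ h : ℝ,
              a * (n : ℝ) ^ (-(1 / (2 * β + (d : ℝ)))) ≤ h →
              h ≤ b * (n : ℝ) ^ (-(1 / (2 * β + (d : ℝ)))) →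
              ∀ t : ℝ, 0 < t → t ≤ T →
                DecoupledScore.risk K h (Cρ * h ^ β) t p₀ n ≤
                  ENNReal.ofReal (C *
                    ((n : ℝ) ^ (-((β - 2) / (2 * β + (d : ℝ)))) +
                      (n : ℝ) ^ (-((1 - 1 / k) *
                        (β * (γ + 1) / ((2 * β + (d : ℝ)) * ((d : ℝ) + γ + 1))))))) := by
  refine ⟨1, one_pos, fun Cρ hCρ γ C₂ k M T a b hγ hC₂ hk hM hT ha hab => ?_⟩
  have hb : 0 < b := ha.trans_le hab
  have hβ0 : 0 < β := by linarith
  have hk0 : 0 < k := by linarith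
  have hk1 : 1 / k ≤ 1 := (div_le_one hk0).2 hk
  set e : ℝ := 2 * β + (d : ℝ) with he
  have he0 : 0 < e := by positivity
  obtain ⟨C, hC, hrisk⟩ := DecoupledScore.exists_risk_le (M := M) (A := a ^ e) hβ hL hK
    (by linarith : 0 < Cρ) hγ hC₂ hk hT (by positivity) hb
  set s : ℝ := β * ((γ + 1) / ((d : ℝ) + γ + 1)) * (1 - 1 / k) with hs
  have hs0 : 0 ≤ s := mul_nonneg (by positivity) (by linarith)
  refine ⟨C * (b ^ (β - 2) + b ^ s), by positivity,
    fun p₀ h1 h2 h3 h4 n hn h hah hhb t ht htT => ?_⟩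
  have hn' : (0 : ℝ) < n := by exact_mod_cast hn
  have hn1 : (1 : ℝ) ≤ n := by exact_mod_cast hn
  have hna : (n : ℝ) ^ (-(1 / e)) ≤ 1 :=
    Real.rpow_le_one_of_one_le_of_nonpos hn1 (by have : 0 < 1 / e := by positivity
                                                 linarith)
  have hh : 0 < h := lt_of_lt_of_le (by positivity) hah
  have hpow : ∀ s' : ℝ, 0 ≤ s' → h ^ s' ≤ b ^ s' * (n : ℝ) ^ (-(s' / e)) := by
    intro s' hs'
    calc h ^ s' ≤ (b * (n : ℝ) ^ (-(1 / e))) ^ s' := Real.rpow_le_rpow hh.le hhb hs'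
      _ = _ := by
        rw [Real.mul_rpow hb.le (by positivity), ← Real.rpow_mul hn'.le]
        congr 2
        ring
  have hA : a ^ e ≤ n * (h ^ d * (h ^ β) ^ 2) := by
    have e1 : h ^ d * (h ^ β) ^ 2 = h ^ e := by
      rw [← Real.rpow_natCast h d, ← Real.rpow_natCast (h ^ β) 2, ← Real.rpow_mul hh.le,
        ← Real.rpow_add hh]
      congr 1
      push_cast
      rw [he]
      ring
    rw [e1]
    calc a ^ e = n * (a * (n : ℝ) ^ (-(1 / e))) ^ e := by
          rw [Real.mul_rpow ha.le (by positivity), ← Real.rpow_mul hn'.le]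
          have : -(1 / e) * e = -1 := by field_simp
          rw [this, Real.rpow_neg_one]
          field_simp
      _ ≤ _ := by
          have := Real.rpow_le_rpow (by positivity) hah he0.le
          gcongr
  refine (hrisk p₀ h1 h2 h3 h4 n hn h hh (hhb.trans (mul_le_of_le_one_right hb.le hna)) hA t ht
    htT).trans (ENNReal.ofReal_le_ofReal ?_)
  have r1 := hpow (β - 2) (by linarith)
  have r2 := hpow s hs0
  have e2 : ((h ^ β) ^ ((γ + 1) / ((d : ℝ) + γ + 1))) ^ (1 - 1 / k) = h ^ s := by
    rw [← Real.rpow_mul hh.le, ← Real.rpow_mul hh.le]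
  have e3 : s / e = (1 - 1 / k) * (β * (γ + 1) / (e * ((d : ℝ) + γ + 1))) := by
    rw [hs]
    have : (0 : ℝ) < (d : ℝ) + γ + 1 := by positivity
    field_simp
  rw [e2, ← e3, mul_assoc]
  refine mul_le_mul_of_nonneg_left ?_ hC.le
  have q1 : 0 ≤ (n : ℝ) ^ (-((β - 2) / e)) := by positivity
  have q2 : 0 ≤ (n : ℝ) ^ (-(s / e)) := by positivity
  have q3 : 0 ≤ b ^ (β - 2) := by positivity
  have q4 : 0 ≤ b ^ s := by positivity
  nlinarith [mul_nonneg q3 q2, mul_nonneg q4 q1]
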